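/- A *supergeometry* $(X,T^*_{X,-})$ is a complex manifold $X$ with structure sheaf $\mathcal O_X$ and a holomorphic vector bundle, viewed as a locally free sheaf $T^*_{X,-}$. Put $\mathcal A_X=\wedge^\bullet T^*_{X,-}$, with even and odd parts $\mathcal A_X^{\pm}$, and $\mathcal J^k=\bigoplus_{j\ge k}\wedge^jT^*_{X,-}$. An *embedding* $(Y,T^*_{Y,-})\subset(X,T^*_{X,-})$ is a closed holomorphic embedding $i:Y\to X$ with a surjection $T^*_{X,-}\to i_*T^*_{Y,-}$ of $\mathcal O_X$-modules. Let $N^*_+=\mathcal I_Y\subset\mathcal O_X$ be the ideal sheaf of $Y$, $N^*_-=\ker(T^*_{X,-}\to i_*T^*_{Y,-})$, and $\widehat{\mathcal I}=\ker(\mathcal A_X\to\wedge^\bullet i_*T^*_{Y,-})$. For $k\ge2$ let $\mathcal G^{(k)}_X$ be the sheaf of groups of parity-preserving $\mathbb C$-algebra automorphisms $\alpha$ of $\mathcal A_X$ with $\alpha(u)-u\in\mathcal J^k$ for all $u$, and $\mathcal G^{(k)}_{Y;X}$ the subsheaf of those preserving $\widehat{\mathcal I}$. An *ideal sheaf for an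 embedding* over $(Y,T^*_{Y,-})\subset(X,T^*_{X,-})$ is a $\mathbb Z_2$-graded sheaf of ideals $\mathcal I=\mathcal I^+\oplus\mathcal I^-\subset\mathcal A_X$ such that $\mathcal I^\pm$ has image $N^*_\pm$ modulo $\mathcal J^2$, and $\mathcal A_X/\mathcal I$ is locally isomorphic to $\wedge^\bullet i_*T^*_{Y,-}$ as a sheaf of supercommutative $\mathbb C$-algebras. A *system of generators* of $\mathcal I$ is a pair $F=(F^+,F^-)$ of $\mathcal O_X$-linear morphisms $F^\pm:N^*_\pm\to\mathcal I^\pm$ which are the identity modulo $\mathcal J^2$ and whose images generate $\mathcal I$. Its *maximal splitting degree* $m_F\in\{2,3,\dots\}\cup\{\infty\}$ is the least $m\ge2$ such that the component of $F^+$ or of $F^-$ in $\wedge^mT^*_{X,-}$ is non-zero, and $\infty$ if there is none. Let $\mathscr S^{\ge k}$ be the set of pairs $(\mathcal I,F)$ of an ideal sheaf for an embedding and a system of generators of it with $m_F\ge k$. **Theorem.** Let $(Y,T^*_{Y,-})\subset(X,T^*_{X,-})$ be an embedding of supergeometries and $\widehat F$ a system of generators of $\widehat{\mathcal I}$ with $m_{\widehat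 F}=\infty$. Then $(\widehat{\mathcal I},\widehat F)\in\mathscr S^{\ge k}$ for every $k\ge2$, and there are maps $$\Phi_k:\mathscr S^{\ge k}\longrightarrow\check H^1\big(X,\mathcal G^{(k)}_{Y;X}\big)\qquad(k\ge2)$$ sending $(\widehat{\mathcal I},\widehat F)$ to the base point, such that for every $k\ge2$ the diagram $$\begin{array}{ccc}\mathscr S^{\ge k+1}&\hookrightarrow&\mathscr S^{\ge k}\\ \downarrow&&\downarrow\\ \check H^1(X,\mathcal G^{(k+1)}_{Y;X})&\to&\check H^1(X,\mathcal G^{(k)}_{Y;X})\end{array}$$ with vertical maps $\Phi_{k+1},\Phi_k$ commutes. They are given as follows. For $(\mathcal I,F)\in\mathscr S^{\ge k}$ there are an open cover $\mathfrak U$ of $X$ and $\alpha_U\in\mathcal G^{(k)}_X(U)$ for $U\in\mathfrak U$, with $\alpha_U(\mathcal I|_U)=\widehat{\mathcal I}|_U$ and such that, near each point of $Y\cap U$, there are finitely many sections $n$ of $N^*_\pm$ whose images $\widehat F(n)$ generate $\widehat{\mathcal I}$ and which satisfy $\alpha_U(F(n))=\widehat F(n)$. Moreover, for every open cover $\mathfrak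 U$ and every choice of $\alpha_U\in\mathcal G^{(k)}_X(U)$ with $\alpha_U(\mathcal I|_U)=\widehat{\mathcal I}|_U$, the family $\{\alpha_U\alpha_V^{-1}\}$ is a $1$-cocycle with values in $\mathcal G^{(k)}_{Y;X}$, and $\Phi_k(\mathcal I,F)$ is its class. -/

import Mathlib

open TopologicalSpace CategoryTheory Opposite
open scoped Manifold ContDiff Bundle

universe u v w

noncomputable section

/-! ## Cech cohomology in degree one of a presheaf of (nonabelian) groups -/

/-- An indexed open cover of the space `X`. -/
structure SpaceCover (X : Type u) [TopologicalSpace X] where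
  ι : Type u
  U : ι → Opens X
  covers : ∀ x : X, ∃ i, x ∈ U i

/-- The cover of `X` by `X` itself. -/
def SpaceCover.trivial (X : Type u) [TopologicalSpace X] : SpaceCover X where
  ι := PUnit
  U := fun _ => ⊤
  covers := fun _ => ⟨PUnit.unit, Set.mem_univ _⟩

/-- `𝔙.Refinement 𝔘` is the data of a refinement map from the cover `𝔙` to the cover `𝔘`. -/
structure SpaceCover.Refinement {X : Type u} [TopologicalSpace X] (𝔙 𝔘 : SpaceCover X) where
  r : 𝔙.ι → 𝔘.ι
  le : ∀ j, 𝔙.U j ≤ 𝔘.U (r j)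

section Cech

variable {X : Type u} [TopologicalSpace X]

/-- Pull-back of a 1-cocycle along a refinement map. -/
def refineCocycle (G : (Opens X)ᵒᵖ ⥤ GrpCat.{w}) {𝔙 𝔘 : SpaceCover X} (ρ : 𝔙.Refinement 𝔘)
    (γ : PresheafOfGroups.OneCocycle G 𝔘.U) : PresheafOfGroups.OneCocycle G 𝔙.U where
  ev i j _ a b := γ.ev (ρ.r i) (ρ.r j) (a ≫ homOfLE (ρ.le i)) (b ≫ homOfLE (ρ.le j))
  ev_precomp i j _ _ φ a b := by
    rw [γ.ev_precomp]; rfl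
  ev_trans i j k _ a b c := γ.ev_trans _ _ _ _ _ _

/-- Image of a 1-cocycle under a morphism of presheaves of groups. -/
def mapCocycle {G G' : (Opens X)ᵒᵖ ⥤ GrpCat.{w}} (η : G ⟶ G') {𝔘 : SpaceCover X}
    (γ : PresheafOfGroups.OneCocycle G 𝔘.U) : PresheafOfGroups.OneCocycle G' 𝔘.U where
  ev i j T a b := η.app (op T) (γ.ev i j a b)
  ev_precomp i j T T' φ a b := by
    rw [← γ.ev_precomp i j φ a b]
    exact (ConcreteCategory.congr_hom (η.naturality φ.op) (γ.ev i j a b)).symm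
  ev_trans i j k T a b c := by
    rw [← γ.ev_trans i j k a b c, map_mul]

/-- A 1-cocycle on `𝔘` is identified with every 1-cocycle cohomologous to its pull-back to a
refinement of `𝔘`. -/
def CechRel (G : (Opens X)ᵒᵖ ⥤ GrpCat.{w})
    (p q : Σ 𝔘 : SpaceCover X, PresheafOfGroups.OneCocycle G 𝔘.U) : Prop :=
  ∃ ρ : q.1.Refinement p.1, (refineCocycle G ρ p.2).IsCohomologous q.2

/-- The Cech cohomology set in degree one: the colimit, over all open covers and all refinement
maps, of the sets of cohomology classes of 1-cocycles. -/
def CechH1 (G : (Opens X)ᵒᵖ ⥤ GrpCat.{w}) := Quot (CechRel G)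

/-- The class of a 1-cocycle. -/
def CechH1.mk (G : (Opens X)ᵒᵖ ⥤ GrpCat.{w}) (𝔘 : SpaceCover X)
    (γ : PresheafOfGroups.OneCocycle G 𝔘.U) : CechH1 G := Quot.mk _ ⟨𝔘, γ⟩

/-- The base point, i.e. the class of the trivial cocycle. -/
def CechH1.base (G : (Opens X)ᵒᵖ ⥤ GrpCat.{w}) : CechH1 G :=
  CechH1.mk G (SpaceCover.trivial X) 1

/-- The map on Cech cohomology induced by a morphism of presheaves of groups. -/
def CechH1.map {G G' : (Opens X)ᵒᵖ ⥤ GrpCat.{w}} (η : G ⟶ G') : CechH1 G → CechH1 G' :=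
  Quot.map (fun p => ⟨p.1, mapCocycle η p.2⟩) (by
    rintro ⟨𝔘, γ⟩ ⟨𝔙, γ'⟩ ⟨ρ, β, h⟩
    refine ⟨ρ, fun i => η.app _ (β i), fun i j T a b => ?_⟩
    have key := congrArg (fun z => η.app (op T) z) (h i j a b)
    simp only [map_mul] at key
    have e1 := ConcreteCategory.congr_hom (η.naturality a.op) (β i)
    have e2 := ConcreteCategory.congr_hom (η.naturality b.op) (β j)
    simp only [ConcreteCategory.comp_apply] at e1 e2
    rw [e1, e2] at key
    exact key)

end Cech

/-! ## Supergeometries and the sheaf of exterior algebras -/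

/-- A supergeometry: a complex manifold together with a holomorphic vector bundle on it (the odd
conormal bundle, with fibres `fibre x`). No compactness is required. -/
structure Supergeometry where
  dim : ℕ
  rank : ℕ
  carrier : Type u
  [top : TopologicalSpace carrier]
  [t2 : T2Space carrier]
  [charted : ChartedSpace (EuclideanSpace ℂ (Fin dim)) carrier]
  [manifold : IsManifold 𝓘(ℂ, EuclideanSpace ℂ (Fin dim)) ω carrier]
  fibre : carrier → Type u
  [fibreGroup : ∀ x, AddCommGroup (fibre x)]
  [fibreModule : ∀ x, Module ℂ (fibre x)]
  [fibreTop : ∀ x, TopologicalSpace (fibre x)]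
  [totalTop : TopologicalSpace (Bundle.TotalSpace (EuclideanSpace ℂ (Fin rank)) fibre)]
  [fiberBundle : FiberBundle (EuclideanSpace ℂ (Fin rank)) fibre]
  [vectorBundle : VectorBundle ℂ (EuclideanSpace ℂ (Fin rank)) fibre]
  [holBundle : ContMDiffVectorBundle ω (EuclideanSpace ℂ (Fin rank)) fibre
    𝓘(ℂ, EuclideanSpace ℂ (Fin dim))]

namespace Supergeometry

attribute [instance] top t2 charted manifold fibreGroup fibreModule fibreTop totalTop
  fiberBundle vectorBundle holBundle

variable (S : Supergeometry.{u})

/-- The model of the underlying manifold. -/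
abbrev model : ModelWithCorners ℂ (EuclideanSpace ℂ (Fin S.dim)) (EuclideanSpace ℂ (Fin S.dim)) :=
  𝓘(ℂ, EuclideanSpace ℂ (Fin S.dim))

/-- `g` is a holomorphic function on the open set `W`. -/
def IsHolFun (W : Opens S.carrier) (g : S.carrier → ℂ) : Prop :=
  ContMDiffOn S.model 𝓘(ℂ) ω g W

/-- `σ` is a holomorphic section of the odd conormal bundle over the open set `W`. -/
def IsHolSection (W : Opens S.carrier) (σ : ∀ x, S.fibre x) : Prop :=
  ContMDiffOn S.model (S.model.prod 𝓘(ℂ, EuclideanSpace ℂ (Fin S.rank))) ω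
    (fun x => Bundle.TotalSpace.mk' (EuclideanSpace ℂ (Fin S.rank)) x (σ x)) W

/-- Arbitrary (not necessarily holomorphic) sections of the bundle of exterior algebras. -/
abbrev RoughSec (U : Opens S.carrier) : Type u := ∀ x : U, ExteriorAlgebra ℂ (S.fibre x)

/-- Restriction of rough sections. -/
def roughRes {W U : Opens S.carrier} (h : W ≤ U) : S.RoughSec U →ₐ[ℂ] S.RoughSec W where
  toFun s := fun x => s ⟨x, h x.2⟩
  map_one' := rfl
  map_mul' _ _ := rfl
  map_zero' := rfl
  map_add' _ _ := rfl
  commutes' _ := rfl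

/-- The algebra of sections generated by holomorphic functions and by holomorphic sections of the
odd conormal bundle over `W`. -/
def genSec (W : Opens S.carrier) : Subalgebra ℂ (S.RoughSec W) :=
  Algebra.adjoin ℂ
    ({s | ∃ g, S.IsHolFun W g ∧ s = fun x : W => algebraMap ℂ (ExteriorAlgebra ℂ (S.fibre x)) (g x)} ∪
      {s | ∃ σ, S.IsHolSection W σ ∧ s = fun x : W => ExteriorAlgebra.ι ℂ (σ x)})

theorem roughRes_mem_genSec {W U : Opens S.carrier} (h : W ≤ U) {s : S.RoughSec U}
    (hs : s ∈ S.genSec U) : S.roughRes h s ∈ S.genSec W := by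
  have : S.genSec U ≤ (S.genSec W).comap (S.roughRes h) := by
    refine Algebra.adjoin_le ?_
    rintro s (⟨g, hg, rfl⟩ | ⟨σ, hσ, rfl⟩)
    · exact Algebra.subset_adjoin (Or.inl ⟨g, hg.mono h, rfl⟩)
    · exact Algebra.subset_adjoin (Or.inr ⟨σ, hσ.mono h, rfl⟩)
  exact this hs

/-- The sections over `U` of the sheaf of exterior algebras of the odd conormal sheaf: those
sections of the bundle of exterior algebras which are, locally, sums of products of holomorphic
functions and of holomorphic sections of the odd conormal bundle. -/
def Sec (U : Opens S.carrier) : Subalgebra ℂ (S.RoughSec U) where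
  carrier := {s | ∀ x : U, ∃ (W : Opens S.carrier) (h : W ≤ U), x.1 ∈ W ∧
    S.roughRes h s ∈ S.genSec W}
  mul_mem' {s t} hs ht x := by
    obtain ⟨W, h, hx, hW⟩ := hs x
    obtain ⟨W', h', hx', hW'⟩ := ht x
    refine ⟨W ⊓ W', inf_le_left.trans h, ⟨hx, hx'⟩, ?_⟩
    rw [map_mul]
    exact mul_mem (S.roughRes_mem_genSec inf_le_left hW) (S.roughRes_mem_genSec inf_le_right hW')
  add_mem' {s t} hs ht x := by
    obtain ⟨W, h, hx, hW⟩ := hs x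
    obtain ⟨W', h', hx', hW'⟩ := ht x
    refine ⟨W ⊓ W', inf_le_left.trans h, ⟨hx, hx'⟩, ?_⟩
    rw [map_add]
    exact add_mem (S.roughRes_mem_genSec inf_le_left hW) (S.roughRes_mem_genSec inf_le_right hW')
  algebraMap_mem' c x := ⟨U, le_rfl, x.2, by
    rw [AlgHom.commutes]; exact Subalgebra.algebraMap_mem _ _⟩

/-- The restriction maps of the sheaf of exterior algebras. -/
def res {W U : Opens S.carrier} (h : W ≤ U) : S.Sec U →ₐ[ℂ] S.Sec W :=
  ((S.roughRes h).comp (S.Sec U).val).codRestrict (S.Sec W) (by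
    rintro ⟨s, hs⟩ x
    obtain ⟨V, hV, hx, hsV⟩ := hs ⟨x, h x.2⟩
    exact ⟨V ⊓ W, inf_le_right, ⟨hx, x.2⟩, S.roughRes_mem_genSec inf_le_left hsV⟩)

/-- The component of degree `j` of an element of the exterior algebra of the fibre at `x`. -/
def comp (x : S.carrier) (j : ℕ) (a : ExteriorAlgebra ℂ (S.fibre x)) :
    ExteriorAlgebra ℂ (S.fibre x) :=
  GradedAlgebra.proj (fun i : ℕ => ⋀[ℂ]^i (S.fibre x)) j a

variable {S}

/-- `s` is a section of the part of degree `d`. -/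
def HasDegree {U : Opens S.carrier} (d : ℕ) (s : S.Sec U) : Prop :=
  ∀ (x : U) (j : ℕ), j ≠ d → S.comp x j (s.1 x) = 0

/-- `s` is a section of the even part (for `ε = 0`) or of the odd part (for `ε = 1`). -/
def HasParity {U : Opens S.carrier} (ε : Fin 2) (s : S.Sec U) : Prop :=
  ∀ (x : U) (j : ℕ), j % 2 ≠ ε.val → S.comp x j (s.1 x) = 0

/-- `s` is a section of the `k`-th power of the fermionic ideal, the sum of the exterior powers
of degree at least `k`. -/
def InJ {U : Opens S.carrier} (k : ℕ) (s : S.Sec U) : Prop :=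
  ∀ (x : U) (j : ℕ), j < k → S.comp x j (s.1 x) = 0

variable (S)

/-! ## Green's automorphism groups -/

/-- The group of sections over `U` of the sheaf of automorphisms of the sheaf of exterior
algebras, as a sheaf of supercommutative complex algebras: compatible families of parity
preserving algebra automorphisms over all open subsets of `U`. -/
def Aut (U : Opens S.carrier) :
    Subgroup (∀ W : {W : Opens S.carrier // W ≤ U}, S.Sec W.1 ≃ₐ[ℂ] S.Sec W.1) where
  carrier := {α |
    (∀ (W' W : {W : Opens S.carrier // W ≤ U}) (h : W'.1 ≤ W.1) (s : S.Sec W.1),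
      S.res h (α W s) = α W' (S.res h s)) ∧
    (∀ (W : {W : Opens S.carrier // W ≤ U}) (ε : Fin 2) (s : S.Sec W.1),
      HasParity ε (α W s) ↔ HasParity ε s)}
  mul_mem' {α β} hα hβ := by
    refine ⟨fun W' W h s => ?_, fun W ε s => ?_⟩
    · change S.res h (α W (β W s)) = α W' (β W' (S.res h s))
      rw [hα.1, hβ.1]
    · change HasParity ε (α W (β W s)) ↔ _
      rw [hα.2, hβ.2]
  one_mem' := ⟨fun _ _ _ _ => rfl, fun _ _ _ => Iff.rfl⟩
  inv_mem' {α} hα := by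
    refine ⟨fun W' W h s => ?_, fun W ε s => ?_⟩
    · change S.res h ((α W).symm s) = (α W').symm (S.res h s)
      rw [AlgEquiv.eq_symm_apply, ← hα.1, AlgEquiv.apply_symm_apply]
    · change HasParity ε ((α W).symm s) ↔ _
      rw [← hα.2 W ε ((α W).symm s), AlgEquiv.apply_symm_apply]

variable {S}

/-- The action of an automorphism over `U` on sections over `W ⊆ U`. -/
def act {U : Opens S.carrier} (α : S.Aut U) (W : Opens S.carrier) (h : W ≤ U) :
    S.Sec W ≃ₐ[ℂ] S.Sec W := α.1 ⟨W, h⟩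

variable (S)

/-- Restriction of automorphisms. -/
def autRes {V U : Opens S.carrier} (h : V ≤ U) : S.Aut U →* S.Aut V where
  toFun α := ⟨fun W => α.1 ⟨W.1, W.2.trans h⟩,
    fun W' W h' s => α.2.1 ⟨W'.1, W'.2.trans h⟩ ⟨W.1, W.2.trans h⟩ h' s,
    fun W ε s => α.2.2 ⟨W.1, W.2.trans h⟩ ε s⟩
  map_one' := rfl
  map_mul' _ _ := rfl

/-- Sections over `U` of Green's sheaf of groups of level `k`. -/
def Green (k : ℕ) (U : Opens S.carrier) : Subgroup (S.Aut U) where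
  carrier := {α | ∀ (W : Opens S.carrier) (h : W ≤ U) (s : S.Sec W), InJ k (act α W h s - s)}
  mul_mem' {α β} hα hβ W h s x j hj := by
    have h1 := hα W h (act β W h s) x j hj
    have h2 := hβ W h s x j hj
    have e : act (α * β) W h s - s
        = (act α W h (act β W h s) - act β W h s) + (act β W h s - s) := by
      change act α W h (act β W h s) - s = _
      abel
    rw [e]
    have := congrArg₂ (· + ·) h1 h2
    simpa [comp, map_add] using this
  one_mem' W h s x j hj := by
    have e : act (1 : S.Aut U) W h s - s = 0 := sub_self s
    rw [e]
    exact map_zero _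
  inv_mem' {α} hα W h s x j hj := by
    have h1 := hα W h (act (α⁻¹) W h s) x j hj
    have e0 : act α W h (act (α⁻¹) W h s) = s := (act α W h).apply_symm_apply s
    have e : act (α⁻¹) W h s - s = -(act α W h (act (α⁻¹) W h s) - act (α⁻¹) W h s) := by
      rw [e0]; abel
    rw [e]
    have := congrArg Neg.neg h1
    simpa [comp, map_neg] using this

/-! ## Sheaves of ideals -/

/-- A sheaf of (two-sided) ideals in the sheaf of exterior algebras. -/
structure IdealSheaf where
  sec : ∀ U : Opens S.carrier, Ideal (S.Sec U)
  mul_mem_right : ∀ (U : Opens S.carrier) (s t : S.Sec U), s ∈ sec U → s * t ∈ sec U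
  res_mem : ∀ {W U : Opens S.carrier} (h : W ≤ U) (s : S.Sec U), s ∈ sec U → S.res h s ∈ sec W
  glue : ∀ (U : Opens S.carrier) (s : S.Sec U),
    (∀ x ∈ U, ∃ (W : Opens S.carrier) (h : W ≤ U), x ∈ W ∧ S.res h s ∈ sec W) → s ∈ sec U

variable {S}

/-- The restriction of the ideal sheaf `I` to `U` is generated, as a sheaf of ideals, by the set
`A` of sections over `U`. -/
def IdealSheaf.GeneratedOn (I : S.IdealSheaf) (U : Opens S.carrier) (A : Set (S.Sec U)) : Prop :=
  A ⊆ I.sec U ∧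
  ∀ (W : Opens S.carrier) (h : W ≤ U) (s : S.Sec W), s ∈ I.sec W → ∀ x ∈ W,
    ∃ (V : Opens S.carrier) (hV : V ≤ W), x ∈ V ∧
      S.res hV s ∈ Ideal.span (S.res (hV.trans h) '' A)

end Supergeometry

open Supergeometry

/-! ## Embeddings of supergeometries -/

/-- An embedding `(Y, T*_Y) ⊂ (X, T*_X)` of supergeometries: a closed holomorphic embedding
`i : Y → X` and a surjective morphism `T*_X → i_* T*_Y` of sheaves of modules, given by its linear
maps on fibres. -/
structure SuperEmbedding (Y : Supergeometry.{v}) (X : Supergeometry.{u}) where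
  i : Y.carrier → X.carrier
  isEmbedding : Manifold.IsSmoothEmbedding Y.model X.model ω i
  isClosed_range : IsClosed (Set.range i)
  φ : ∀ y : Y.carrier, X.fibre (i y) →ₗ[ℂ] Y.fibre y
  hol : ∀ (U : Opens X.carrier) (σ : ∀ x, X.fibre x), X.IsHolSection U σ →
    Y.IsHolSection ⟨i ⁻¹' U, U.2.preimage isEmbedding.isEmbedding.continuous⟩
      (fun y => φ y (σ (i y)))
  surj : ∀ (U : Opens X.carrier) (τ : ∀ y, Y.fibre y),
    Y.IsHolSection ⟨i ⁻¹' U, U.2.preimage isEmbedding.isEmbedding.continuous⟩ τ →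
    ∀ x ∈ U, ∃ (W : Opens X.carrier) (σ : ∀ x, X.fibre x), W ≤ U ∧ x ∈ W ∧ X.IsHolSection W σ ∧
      ∀ y, i y ∈ W → φ y (σ (i y)) = τ y

namespace SuperEmbedding

variable {Y : Supergeometry.{v}} {X : Supergeometry.{u}} (f : SuperEmbedding Y X)

/-- The open set `U ∩ Y` of `Y`. -/
def preim (U : Opens X.carrier) : Opens Y.carrier :=
  ⟨f.i ⁻¹' U, U.2.preimage f.isEmbedding.isEmbedding.continuous⟩

theorem preim_mono {W U : Opens X.carrier} (h : W ≤ U) : f.preim W ≤ f.preim U :=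
  fun _ hy => h hy

/-- The kernel of the surjection of the exterior algebra of `T*_X` onto the exterior algebra of
`i_* T*_Y`; the ideal sheaf of the embedding of split models. -/
def kernelIdeal : X.IdealSheaf where
  sec U :=
    { carrier := {s | ∀ (y : Y.carrier) (hy : f.i y ∈ U),
        ExteriorAlgebra.map (f.φ y) (s.1 ⟨f.i y, hy⟩) = 0}
      add_mem' := fun {s t} hs ht y hy => by
        change ExteriorAlgebra.map (f.φ y) (s.1 ⟨f.i y, hy⟩ + t.1 ⟨f.i y, hy⟩) = 0
        rw [map_add, hs y hy, ht y hy, add_zero]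
      zero_mem' := fun y _ => map_zero (ExteriorAlgebra.map (f.φ y))
      smul_mem' := fun c s hs y hy => by
        change ExteriorAlgebra.map (f.φ y) (c.1 ⟨f.i y, hy⟩ * s.1 ⟨f.i y, hy⟩) = 0
        rw [map_mul, hs y hy, mul_zero] }
  mul_mem_right U s t hs y hy := by
    change ExteriorAlgebra.map (f.φ y) (s.1 ⟨f.i y, hy⟩ * t.1 ⟨f.i y, hy⟩) = 0
    rw [map_mul, hs y hy, zero_mul]
  res_mem h s hs y hy := hs y (h hy)
  glue U s hs y hy := by
    obtain ⟨W, h, hx, hW⟩ := hs _ hy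
    exact hW y hx

/-- Sections over `U` of Green's group of level `k` of the embedding: the automorphisms in Green's
group of level `k` of `X` which preserve the kernel ideal. -/
def relGreen (k : ℕ) (U : Opens X.carrier) : Subgroup (X.Aut U) where
  carrier := {α | α ∈ X.Green k U ∧ ∀ (W : Opens X.carrier) (h : W ≤ U) (s : X.Sec W),
    act α W h s ∈ f.kernelIdeal.sec W ↔ s ∈ f.kernelIdeal.sec W}
  mul_mem' {α β} hα hβ := ⟨mul_mem hα.1 hβ.1, fun W h s => by
    change act α W h (act β W h s) ∈ _ ↔ _
    rw [hα.2, hβ.2]⟩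
  one_mem' := ⟨one_mem _, fun _ _ _ => Iff.rfl⟩
  inv_mem' {α} hα := ⟨inv_mem hα.1, fun W h s => by
    have e0 : act α W h (act (α⁻¹) W h s) = s := (act α W h).apply_symm_apply s
    rw [← hα.2 W h (act (α⁻¹) W h s), e0]⟩

/-- The sheaf of groups formed by `f.relGreen k`. -/
def greenSheaf (k : ℕ) : (Opens X.carrier)ᵒᵖ ⥤ GrpCat.{u} where
  obj U := GrpCat.of (f.relGreen k U.unop)
  map {U V} h := GrpCat.ofHom
    (((X.autRes h.unop.le).comp (f.relGreen k U.unop).subtype).codRestrict (f.relGreen k V.unop)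
      (fun α => ⟨fun W hW s => α.2.1 W (hW.trans h.unop.le) s,
        fun W hW s => α.2.2 W (hW.trans h.unop.le) s⟩))
  map_id _ := rfl
  map_comp _ _ := rfl

/-- The automorphism underlying a section of `f.greenSheaf k`. -/
def greenToAut {k : ℕ} {U : Opens X.carrier} (α : (f.greenSheaf k).obj (op U)) : X.Aut U :=
  Subtype.val (show f.relGreen k U from α)

/-- The inclusion of the sheaf of groups of level `k + 1` into the one of level `k`. -/
def greenIncl (k : ℕ) : f.greenSheaf (k + 1) ⟶ f.greenSheaf k where
  app _ := GrpCat.ofHom (Subgroup.inclusion (fun _ hα =>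
    ⟨fun W h s x j hj => hα.1 W h s x j (hj.trans (Nat.lt_succ_self k)), hα.2⟩))
  naturality _ _ _ := rfl

/-! ## Ideal sheaves for embeddings, and systems of generators -/

/-- The conormal sheaf: for `ε = 0` the ideal sheaf of `Y` in the structure sheaf of `X`, and for
`ε = 1` the kernel of `T*_X → i_* T*_Y`, placed in degrees `0` and `1` of the sheaf of exterior
algebras. -/
def conormal (ε : Fin 2) (U : Opens X.carrier) : Set (X.Sec U) :=
  {s | HasDegree ε.val s ∧ s ∈ f.kernelIdeal.sec U}

/-- An isomorphism over `U` between the quotient of the sheaf of exterior algebras of `T*_X` by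
the ideal sheaf `I` and the sheaf of exterior algebras of `i_* T*_Y`, as sheaves of supercommutative
algebras: equivalently, a morphism from the former exterior algebra to the latter, surjective as a
morphism of sheaves and with kernel `I`. -/
structure LocalQuotientIso (I : X.IdealSheaf) (U : Opens X.carrier) where
  map : ∀ W : Opens X.carrier, W ≤ U → (X.Sec W →ₐ[ℂ] Y.Sec (f.preim W))
  map_res : ∀ {W' W : Opens X.carrier} (h : W' ≤ W) (hW : W ≤ U) (s : X.Sec W),
    map W' (h.trans hW) (X.res h s) = Y.res (f.preim_mono h) (map W hW s)
  parity : ∀ (W : Opens X.carrier) (hW : W ≤ U) (ε : Fin 2) (s : X.Sec W),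
    HasParity ε s → HasParity ε (map W hW s)
  ker : ∀ (W : Opens X.carrier) (hW : W ≤ U) (s : X.Sec W), map W hW s = 0 ↔ s ∈ I.sec W
  surj : ∀ (W : Opens X.carrier) (hW : W ≤ U) (t : Y.Sec (f.preim W)), ∀ x ∈ W,
    ∃ (V : Opens X.carrier) (hV : V ≤ W) (s : X.Sec V), x ∈ V ∧
      map V (hV.trans hW) s = Y.res (f.preim_mono hV) t

/-- `I` is an ideal sheaf for an embedding of supermanifolds over `f`. -/
structure IsEmbeddingIdeal (I : X.IdealSheaf) : Prop where
  /-- `I` is graded modulo two -/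
  graded : ∀ (U : Opens X.carrier) (s : X.Sec U), s ∈ I.sec U →
    ∃ s₀ ∈ I.sec U, ∃ s₁ ∈ I.sec U, HasParity 0 s₀ ∧ HasParity 1 s₁ ∧ s = s₀ + s₁
  /-- the even and odd parts of `I` reduce, modulo the square of the fermionic ideal, into the
  conormal sheaves -/
  reduces : ∀ (ε : Fin 2) (U : Opens X.carrier) (s : X.Sec U), s ∈ I.sec U → HasParity ε s →
    ∃ n ∈ f.conormal ε U, InJ 2 (s - n)
  /-- and these reductions are (locally) onto -/
  lifts : ∀ (ε : Fin 2) (U : Opens X.carrier) (n : X.Sec U), n ∈ f.conormal ε U → ∀ x ∈ U,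
    ∃ (W : Opens X.carrier) (h : W ≤ U) (s : X.Sec W), x ∈ W ∧ s ∈ I.sec W ∧ HasParity ε s ∧
      InJ 2 (s - X.res h n)
  /-- the quotient by `I` is locally isomorphic to the exterior algebra of `i_* T*_Y` -/
  localIso : ∀ x : X.carrier, ∃ U : Opens X.carrier, x ∈ U ∧ Nonempty (f.LocalQuotientIso I U)

/-- A system of generators of the ideal sheaf `I`: a pair of morphisms of sheaves of modules over
the structure sheaf of `X` from the even (resp. odd) conormal sheaf to the even (resp. odd) part of
`I`, equal to the identity modulo the square of the fermionic ideal, whose images together generate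
`I`. -/
structure GeneratorSystem (I : X.IdealSheaf) where
  toFun : ∀ (ε : Fin 2) (U : Opens X.carrier), f.conormal ε U → X.Sec U
  map_add : ∀ (ε : Fin 2) (U : Opens X.carrier) (s t r : f.conormal ε U),
    r.1 = s.1 + t.1 → toFun ε U r = toFun ε U s + toFun ε U t
  /-- linearity over the structure sheaf, the part of degree zero of the exterior algebra -/
  map_smul : ∀ (ε : Fin 2) (U : Opens X.carrier) (g : X.Sec U) (s r : f.conormal ε U),
    HasDegree 0 g → r.1 = g * s.1 → toFun ε U r = g * toFun ε U s
  map_res : ∀ (ε : Fin 2) {W U : Opens X.carrier} (h : W ≤ U) (s : f.conormal ε U)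
    (r : f.conormal ε W), r.1 = X.res h s.1 → toFun ε W r = X.res h (toFun ε U s)
  mem : ∀ (ε : Fin 2) (U : Opens X.carrier) (s : f.conormal ε U), toFun ε U s ∈ I.sec U
  parity : ∀ (ε : Fin 2) (U : Opens X.carrier) (s : f.conormal ε U), HasParity ε (toFun ε U s)
  mod_square : ∀ (ε : Fin 2) (U : Opens X.carrier) (s : f.conormal ε U),
    InJ 2 (toFun ε U s - s.1)
  generates : ∀ (U : Opens X.carrier) (s : X.Sec U), s ∈ I.sec U → ∀ x ∈ U,
    ∃ (W : Opens X.carrier) (h : W ≤ U), x ∈ W ∧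
      X.res h s ∈ Ideal.span {t | ∃ (ε : Fin 2) (n : f.conormal ε W), t = toFun ε W n}

namespace GeneratorSystem

variable {f} {I : X.IdealSheaf} (F : f.GeneratorSystem I)

/-- The component of degree `j` of the even or odd part of `F` is zero. -/
def ComponentVanishes (ε : Fin 2) (j : ℕ) : Prop :=
  ∀ (U : Opens X.carrier) (s : f.conormal ε U) (x : U), X.comp x j ((F.toFun ε U s).1 x) = 0

/-- The maximal splitting degree of the even or odd part of `F`: the first degree `m ≥ 2` in which
it has a non-zero component, or infinity. -/
def splittingDegree (ε : Fin 2) : ℕ∞ :=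
  sSup {m : ℕ∞ | ∃ n : ℕ, m = n ∧ ∀ j, 2 ≤ j → j < n → F.ComponentVanishes ε j}

/-- The maximal splitting degree of `F`. -/
def maxSplittingDegree : ℕ∞ := min (F.splittingDegree 0) (F.splittingDegree 1)

end GeneratorSystem

/-- The set of pairs `(I, F)`, with `I` an ideal sheaf for an embedding over `f` and `F` a system
of generators of `I` of maximal splitting degree at least `k`. -/
def GeneratedIdeals (k : ℕ) :=
  {p : Σ I : X.IdealSheaf, f.GeneratorSystem I //
    f.IsEmbeddingIdeal p.1 ∧ (k : ℕ∞) ≤ p.2.maxSplittingDegree}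

/-- The inclusion of the set of pairs of level `k + 1` into the set of pairs of level `k`. -/
def GeneratedIdeals.incl (k : ℕ) (p : f.GeneratedIdeals (k + 1)) : f.GeneratedIdeals k :=
  ⟨p.1, p.2.1, le_trans (by exact_mod_cast Nat.le_succ k) p.2.2⟩

/-- The automorphism `α` over `U` carries the restriction of `I` to `U` onto the restriction of
the kernel ideal. -/
def Straightens {U : Opens X.carrier} (α : X.Aut U) (I : X.IdealSheaf) : Prop :=
  ∀ (W : Opens X.carrier) (h : W ≤ U) (s : X.Sec W),
    act α W h s ∈ f.kernelIdeal.sec W ↔ s ∈ I.sec W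

variable {f} in
/-- The automorphism `α` over `U` carries `F` to `F'` near every point of `Y` in `U`: there are
finitely many local sections of the conormal sheaves whose images under `F'` generate `I'`, and
whose images under `F` are carried by `α` to their images under `F'`. -/
def CarriesGenerators {U : Opens X.carrier} (α : X.Aut U) {I I' : X.IdealSheaf}
    (F : f.GeneratorSystem I) (F' : f.GeneratorSystem I') : Prop :=
  ∀ y : Y.carrier, f.i y ∈ U → ∃ (W : Opens X.carrier) (h : W ≤ U), f.i y ∈ W ∧
    ∃ T : ∀ ε : Fin 2, Set (f.conormal ε W), (∀ ε, (T ε).Finite) ∧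
      I'.GeneratedOn W {t | ∃ ε, ∃ n ∈ T ε, t = F'.toFun ε W n} ∧
      ∀ ε, ∀ n ∈ T ε, act α W h (F.toFun ε W n) = F'.toFun ε W n

end SuperEmbedding

end

/-! Everything except the local existence of straightenings is formal. Two automorphisms of level
`k` carrying the same ideal `I` to the kernel ideal `Î` differ by one that preserves `Î`, so the
products `α_U α_V⁻¹` form a cocycle with values in the relative group, and two such families give
cohomologous cocycles on a common refinement. Hence the class depends on `I` alone, the identity
gives the base point, and a family of level `k + 1` also computes the class of level `k`.

For local existence, away from `Y` both ideals are the whole algebra and the identity serves. Near a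
point of `Y` there are even coordinates `z_a` vanishing on `Y` and odd frame sections `ζ_j`
restricting to zero; by Hadamard's division lemma they generate `Î` (`LocalModel.generatedOn`). The
sections `F(z_a)`, `F(ζ_j)` of `I` agree with `z_a`, `ζ_j` modulo `J^k`. The derivation with values
`z_a - F(z_a)` and `ζ_j - F(ζ_j)` on these coordinates is nilpotent, and its exponential improves
the congruence by one degree. Since `J^m = 0` for large `m`, finitely many such steps give `α` of
level `k` with `α(F(z_a)) = z_a` and `α(F(ζ_j)) = ζ_j` (`LocalModel.exists_green`). This yields `Î ⊆
α(I)`.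

Equality comes from the condition on the quotient by `I`. Composing a local isomorphism of that
quotient with `α⁻¹` gives a parity-preserving surjection `Q` onto the exterior algebra of `T*_Y`
which kills `Î`, and the kernel of such a `Q` is exactly `Î`
(`LocalModel.mem_kernelIdeal_of_quotient`). Indeed, suppose `Q t = 0` while `t` is non-zero on `Y`.
Multiplication by odd sections pushes the lowest part of `t` into top degree, where `t` is, on `Y`
and near some point, proportional to a product of odd lifts of a frame. That product is then killed
by `Q`, although its image is a non-zero top form. -/

/-! ## Complements on exterior algebras -/

namespace ExteriorAlgebra

/-! ### Grading, signs and contractions over a commutative ring. -/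

section Grading

variable {R V V' : Type*} [CommRing R] [AddCommGroup V] [Module R V] [AddCommGroup V'] [Module R V']

/-- The projection of the exterior algebra onto its part of degree `j`. -/
noncomputable abbrev degProj (j : ℕ) : ExteriorAlgebra R V →ₗ[R] ExteriorAlgebra R V :=
  GradedAlgebra.proj (fun i : ℕ => ⋀[R]^i V) j

theorem degProj_mem (j : ℕ) (a : ExteriorAlgebra R V) : degProj j a ∈ ⋀[R]^j V := by
  rw [degProj, GradedAlgebra.proj_apply]; exact SetLike.coe_mem _

theorem degProj_of_mem {j : ℕ} {a : ExteriorAlgebra R V} (ha : a ∈ ⋀[R]^j V) :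
    degProj j a = a := by
  rw [degProj, GradedAlgebra.proj_apply]
  exact DirectSum.decompose_of_mem_same (fun i : ℕ => ⋀[R]^i V) ha

theorem degProj_of_mem_ne {i j : ℕ} {a : ExteriorAlgebra R V} (ha : a ∈ ⋀[R]^i V) (h : i ≠ j) :
    degProj j a = 0 := by
  rw [degProj, GradedAlgebra.proj_apply]
  exact DirectSum.decompose_of_mem_ne (fun i : ℕ => ⋀[R]^i V) ha h

theorem homogeneous_induction {P : ExteriorAlgebra R V → Prop} (zero : P 0)
    (homogeneous : ∀ (i : ℕ) (a : ExteriorAlgebra R V), a ∈ ⋀[R]^i V → P a)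
    (add : ∀ a b, P a → P b → P (a + b)) (a : ExteriorAlgebra R V) : P a := by
  induction a using DirectSum.Decomposition.inductionOn (fun i : ℕ => ⋀[R]^i V) with
  | zero => exact zero
  | homogeneous m => exact homogeneous _ _ m.2
  | add _ _ h h' => exact add _ _ h h'

theorem eq_zero_of_degProj {a : ExteriorAlgebra R V} (h : ∀ j, degProj j a = 0) : a = 0 := by
  apply (DirectSum.decompose (fun i : ℕ => ⋀[R]^i V)).injective
  rw [DirectSum.decompose_zero]
  refine DFinsupp.ext fun j => Subtype.ext ?_
  simpa [GradedAlgebra.proj_apply] using h j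

theorem map_mem (f : V →ₗ[R] V') {i : ℕ} {a : ExteriorAlgebra R V} (ha : a ∈ ⋀[R]^i V) :
    map f a ∈ ⋀[R]^i V' := by
  have h1 : (⋀[R]^i V).map (map f).toLinearMap ≤ ⋀[R]^i V' := by
    rw [exteriorPower, Submodule.map_pow]
    refine pow_le_pow_left' ?_ i
    rw [ι_range_map_map]
    exact LinearMap.map_le_range
  exact h1 ⟨a, ha, rfl⟩

theorem map_degProj (f : V →ₗ[R] V') (j : ℕ) (a : ExteriorAlgebra R V) :
    map f (degProj j a) = degProj j (map f a) := by
  induction a using homogeneous_induction with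
  | zero => simp
  | add a b ha hb => simp only [map_add, ha, hb]
  | homogeneous i a ha =>
    by_cases h : i = j
    · subst h; rw [degProj_of_mem ha, degProj_of_mem (map_mem f ha)]
    · rw [degProj_of_mem_ne ha h, degProj_of_mem_ne (map_mem f ha) h, map_zero]

theorem degProj_mul (n : ℕ) (a b : ExteriorAlgebra R V) : degProj n (a * b) =
    ∑ ij ∈ Finset.HasAntidiagonal.antidiagonal n, degProj ij.1 a * degProj ij.2 b := by
  simp only [degProj, GradedAlgebra.proj_apply, DirectSum.decompose_mul]
  exact DirectSum.coe_mul_apply_eq_sum_antidiagonal (fun i : ℕ => ⋀[R]^i V) _ _ _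

theorem degProj_degProj (i j : ℕ) (a : ExteriorAlgebra R V) :
    degProj j (degProj i a) = if i = j then degProj i a else 0 := by
  split_ifs with h
  · subst h; exact degProj_of_mem (degProj_mem _ a)
  · exact degProj_of_mem_ne (degProj_mem _ a) h

theorem degProj_algebraMap (j : ℕ) (hj : j ≠ 0) (r : R) :
    degProj j (algebraMap R (ExteriorAlgebra R V) r) = 0 := by
  refine degProj_of_mem_ne (i := 0) ?_ hj.symm
  rw [exteriorPower, pow_zero]
  exact Submodule.algebraMap_mem r

theorem ι_mem (v : V) : ι R v ∈ ⋀[R]^1 V := by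
  rw [exteriorPower, pow_one]; exact ⟨v, rfl⟩

theorem mul_mem_exteriorPower {i j : ℕ} {a b : ExteriorAlgebra R V} (ha : a ∈ ⋀[R]^i V)
    (hb : b ∈ ⋀[R]^j V) : a * b ∈ ⋀[R]^(i + j) V := by
  rw [exteriorPower, pow_add]; exact Submodule.mul_mem_mul ha hb

theorem degProj_ι (j : ℕ) (hj : j ≠ 1) (v : V) : degProj j (ι R v) = 0 :=
  degProj_of_mem_ne (ι_mem v) hj.symm

theorem mem_iff_degProj {d : ℕ} {a : ExteriorAlgebra R V} :
    a ∈ ⋀[R]^d V ↔ ∀ j, j ≠ d → degProj j a = 0 := by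
  refine ⟨fun h j hj => degProj_of_mem_ne h hj.symm, fun h => ?_⟩
  have : a = degProj d a := by
    rw [← sub_eq_zero]
    refine eq_zero_of_degProj fun j => ?_
    rw [map_sub, degProj_degProj]
    split_ifs with e
    · subst e; exact sub_self _
    · rw [h j (Ne.symm e), sub_zero]
  rw [this]; exact degProj_mem _ _

/-- Induction on the exterior algebra, multiplying by generators on the left. -/
theorem left_induction {P : ExteriorAlgebra R V → Prop}
    (algebraMap : ∀ r : R, P (algebraMap R _ r)) (add : ∀ x y, P x → P y → P (x + y))
    (ι_mul : ∀ (x : ExteriorAlgebra R V) (v : V), P x → P (ι R v * x)) (x) : P x :=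
  CliffordAlgebra.left_induction (Q := (0 : QuadraticForm R V)) algebraMap add
    (fun x v h => ι_mul x v h) x

theorem exteriorPower_succ_induction {n : ℕ} {P : ExteriorAlgebra R V → Prop}
    (add : ∀ x y, P x → P y → P (x + y))
    (ι_mul : ∀ (x : ExteriorAlgebra R V) (v : V), x ∈ ⋀[R]^n V → P (ι R v * x))
    {x : ExteriorAlgebra R V} (hx : x ∈ ⋀[R]^(n + 1) V) : P x := by
  rw [exteriorPower, pow_succ'] at hx
  induction hx using Submodule.mul_induction_on' with
  | mem_mul_mem m hm n hn => obtain ⟨v, rfl⟩ := hm; exact ι_mul _ _ hn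
  | add x _ y _ hx hy => exact add _ _ hx hy

theorem ι_mul_comm_of_mem {n : ℕ} {x : ExteriorAlgebra R V} (hx : x ∈ ⋀[R]^n V) (v : V) :
    ι R v * x = (-1 : ℤ) ^ n • (x * ι R v) := by
  induction n generalizing x with
  | zero =>
    rw [exteriorPower, pow_zero, Submodule.mem_one] at hx
    obtain ⟨r, rfl⟩ := hx
    rw [pow_zero, one_smul, Algebra.commutes]
  | succ n ih =>
    refine exteriorPower_succ_induction
      (P := fun x => ι R v * x = (-1 : ℤ) ^ (n + 1) • (x * ι R v))
      (fun x y hx hy => ?_) (fun x w hx => ?_) hx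
    · rw [mul_add, hx, hy, add_mul, smul_add]
    · have h := ι_add_mul_swap (R := R) v w
      rw [add_eq_zero_iff_eq_neg] at h
      rw [← mul_assoc, h, neg_mul, mul_assoc, ih hx, mul_smul_comm, mul_assoc, pow_succ', neg_one_mul,
        neg_smul]

theorem ι_mul_odd {ξ : ExteriorAlgebra R V} (hξ : ∀ j, j % 2 ≠ 1 → degProj j ξ = 0) (v : V) :
    ι R v * ξ = -(ξ * ι R v) := by
  classical
  rw [← DirectSum.sum_support_decompose (fun i : ℕ => ⋀[R]^i V) ξ, Finset.mul_sum, Finset.sum_mul,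
    ← Finset.sum_neg_distrib]
  refine Finset.sum_congr rfl fun j _ => ?_
  by_cases hj : j % 2 = 1
  · rw [ι_mul_comm_of_mem (SetLike.coe_mem _), (Nat.odd_iff.2 hj).neg_one_pow, neg_one_smul]
  · have := hξ j hj
    rw [degProj, GradedAlgebra.proj_apply] at this
    rw [this]; simp

theorem ι_mul_even {ξ : ExteriorAlgebra R V} (hξ : ∀ j, j % 2 ≠ 0 → degProj j ξ = 0) (v : V) :
    ι R v * ξ = ξ * ι R v := by
  classical
  rw [← DirectSum.sum_support_decompose (fun i : ℕ => ⋀[R]^i V) ξ, Finset.mul_sum, Finset.sum_mul]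
  refine Finset.sum_congr rfl fun j _ => ?_
  by_cases hj : j % 2 = 0
  · rw [ι_mul_comm_of_mem (SetLike.coe_mem _), (Nat.even_iff.2 hj).neg_one_pow, one_smul]
  · have := hξ j hj
    rw [degProj, GradedAlgebra.proj_apply] at this
    rw [this]; simp

theorem even_comm {n : ExteriorAlgebra R V} (hn : ∀ j, j % 2 ≠ 0 → degProj j n = 0)
    (a : ExteriorAlgebra R V) : a * n = n * a := by
  induction a using left_induction with
  | algebraMap r => exact Algebra.commutes r n
  | add x y hx hy => rw [add_mul, mul_add, hx, hy]
  | ι_mul x v hx => rw [mul_assoc, hx, ← mul_assoc, ι_mul_even hn, mul_assoc]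

/-- The derivation `a ↦ ξ * (d ⌋ a)`. -/
noncomputable def oddDer (d : Module.Dual R V) (ξ : ExteriorAlgebra R V) :
    ExteriorAlgebra R V →ₗ[R] ExteriorAlgebra R V :=
  LinearMap.mulLeft R ξ ∘ₗ CliffordAlgebra.contractLeft (Q := (0 : QuadraticForm R V)) d

theorem contractLeft_ι_mul (d : Module.Dual R V) (v : V) (a : ExteriorAlgebra R V) :
    CliffordAlgebra.contractLeft (Q := (0 : QuadraticForm R V)) d (ι R v * a) =
      d v • a - ι R v * CliffordAlgebra.contractLeft (Q := (0 : QuadraticForm R V)) d a :=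
  CliffordAlgebra.contractLeft_ι_mul d v a

/-- The contraction is an antiderivation and `ξ` is odd: the sign from moving the contraction past
`v` cancels the sign from moving `ξ` past `v`. This is why `oddDer d ξ` is an ordinary derivation.
-/
theorem oddDer_ι_mul {d : Module.Dual R V} {ξ : ExteriorAlgebra R V}
    (hξ : ∀ j, j % 2 ≠ 1 → degProj j ξ = 0) (v : V) (a : ExteriorAlgebra R V) :
    oddDer d ξ (ι R v * a) = d v • (ξ * a) + ι R v * oddDer d ξ a := by
  simp only [oddDer, LinearMap.comp_apply, LinearMap.mulLeft_apply, contractLeft_ι_mul, mul_sub,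
    mul_smul_comm]
  rw [← mul_assoc (ι R v), ι_mul_odd hξ, ← mul_assoc, neg_mul, sub_eq_add_neg]

theorem oddDer_ι (d : Module.Dual R V) (ξ : ExteriorAlgebra R V) (v : V) :
    oddDer d ξ (ι R v) = d v • ξ := by
  change ξ * CliffordAlgebra.contractLeft (Q := (0 : QuadraticForm R V)) d
    (CliffordAlgebra.ι _ v) = _
  rw [CliffordAlgebra.contractLeft_ι, ← Algebra.commutes, Algebra.smul_def]

theorem oddDer_algebraMap (d : Module.Dual R V) (ξ : ExteriorAlgebra R V) (r : R) :
    oddDer d ξ (algebraMap R _ r) = 0 := by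
  change ξ * CliffordAlgebra.contractLeft (Q := (0 : QuadraticForm R V)) d
    (algebraMap R (CliffordAlgebra _) r) = _
  rw [CliffordAlgebra.contractLeft_algebraMap, mul_zero]

theorem oddDer_mul {d : Module.Dual R V} {ξ : ExteriorAlgebra R V}
    (hξ : ∀ j, j % 2 ≠ 1 → degProj j ξ = 0) (a b : ExteriorAlgebra R V) :
    oddDer d ξ (a * b) = a * oddDer d ξ b + oddDer d ξ a * b := by
  induction a using left_induction with
  | algebraMap r =>
    rw [oddDer_algebraMap, zero_mul, add_zero, ← Algebra.smul_def, ← Algebra.smul_def, map_smul]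
  | add x y hx hy => rw [add_mul, map_add, hx, hy, map_add, add_mul, add_mul]; abel
  | ι_mul x v hx =>
    rw [mul_assoc, oddDer_ι_mul hξ, hx, oddDer_ι_mul hξ, mul_add, add_mul, smul_mul_assoc,
      mul_assoc, mul_assoc, mul_assoc]
    abel

theorem contractLeft_mem (d : Module.Dual R V) {n : ℕ} {a : ExteriorAlgebra R V}
    (ha : a ∈ ⋀[R]^(n + 1) V) :
    CliffordAlgebra.contractLeft (Q := (0 : QuadraticForm R V)) d a ∈ ⋀[R]^n V := by
  induction n generalizing a with
  | zero =>
    rw [zero_add, exteriorPower, pow_one] at ha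
    obtain ⟨v, rfl⟩ := ha
    have := CliffordAlgebra.contractLeft_ι (Q := (0 : QuadraticForm R V)) d v
    rw [show ι R v = CliffordAlgebra.ι (0 : QuadraticForm R V) v from rfl, this, exteriorPower,
      pow_zero]
    exact Submodule.algebraMap_mem (A := ExteriorAlgebra R V) (d v)
  | succ n ih =>
    refine exteriorPower_succ_induction
      (P := fun a => CliffordAlgebra.contractLeft (Q := (0 : QuadraticForm R V)) d a ∈
        ⋀[R]^(n + 1) V) (fun x y hx hy => ?_) (fun x v hx => ?_) ha
    · rw [map_add]; exact add_mem hx hy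
    · rw [contractLeft_ι_mul]
      refine sub_mem (Submodule.smul_mem _ _ hx) ?_
      have := mul_mem_exteriorPower (ι_mem v) (ih hx)
      rwa [add_comm 1 n] at this

theorem contractLeft_of_mem_zero (d : Module.Dual R V) {a : ExteriorAlgebra R V}
    (ha : a ∈ ⋀[R]^0 V) :
    CliffordAlgebra.contractLeft (Q := (0 : QuadraticForm R V)) d a = 0 := by
  rw [exteriorPower, pow_zero, Submodule.mem_one] at ha
  obtain ⟨r, rfl⟩ := ha
  exact CliffordAlgebra.contractLeft_algebraMap (Q := 0) d r

theorem degProj_contractLeft (d : Module.Dual R V) (j : ℕ) (a : ExteriorAlgebra R V) :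
    degProj j (CliffordAlgebra.contractLeft (Q := (0 : QuadraticForm R V)) d a) =
      CliffordAlgebra.contractLeft (Q := (0 : QuadraticForm R V)) d (degProj (j + 1) a) := by
  induction a using homogeneous_induction with
  | zero => simp
  | add a b ha hb =>
    rw [map_add (degProj (j + 1)), map_add, map_add (degProj j), map_add, ha, hb]
  | homogeneous i a ha =>
    rcases i with - | i
    · rw [contractLeft_of_mem_zero d ha, degProj_of_mem_ne ha (by omega), map_zero, map_zero]
    · by_cases h : i = j
      · subst h; rw [degProj_of_mem ha, degProj_of_mem (contractLeft_mem d ha)]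
      · rw [degProj_of_mem_ne ha (by omega), degProj_of_mem_ne (contractLeft_mem d ha) h, map_zero]

/-- Replacing the vectors of a product by their images under `p` one at a time produces, at each
stage, a term with a factor in the span of the `e j`. With `p` the projection killing the `ζ`
directions, this removes the odd generators from a section of the kernel ideal. -/
theorem sub_map_mem_span {J : Type*} (e : J → V) (p : V →ₗ[R] V)
    (hp : ∀ v, v - p v ∈ Submodule.span R (Set.range e)) (a : ExteriorAlgebra R V) :
    a - map p a ∈ Ideal.span (Set.range fun j => ι R (e j)) := by
  set L := Ideal.span (Set.range fun j => ι R (e j)) with hL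
  -- `Ideal.span` is only a left ideal. Right multiples stay inside because `ι (e j)` anticommutes
  -- with every vector.
  have h1 : ∀ j (c : ExteriorAlgebra R V), ι R (e j) * c ∈ L := by
    intro j c
    induction c using left_induction with
    | algebraMap r =>
      rw [← Algebra.commutes]; exact L.mul_mem_left _ (Ideal.subset_span ⟨j, rfl⟩)
    | add x y hx hy => rw [mul_add]; exact add_mem hx hy
    | ι_mul x v hx =>
      have h := ι_add_mul_swap (R := R) (e j) v
      rw [add_eq_zero_iff_eq_neg] at h
      rw [← mul_assoc, h, neg_mul, mul_assoc]
      exact neg_mem (L.mul_mem_left _ hx)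
  have h2 : ∀ w ∈ Submodule.span R (Set.range e), ∀ c : ExteriorAlgebra R V, ι R w * c ∈ L := by
    intro w hw c
    induction hw using Submodule.span_induction with
    | mem x hx => obtain ⟨j, rfl⟩ := hx; exact h1 j c
    | zero => rw [map_zero, zero_mul]; exact zero_mem _
    | add x y _ _ hx hy => rw [map_add, add_mul]; exact add_mem hx hy
    | smul r x _ hx => rw [map_smul, smul_mul_assoc, Algebra.smul_def]; exact L.mul_mem_left _ hx
  induction a using left_induction with
  | algebraMap r => rw [AlgHom.commutes, sub_self]; exact zero_mem _
  | add x y hx hy => rw [map_add, add_sub_add_comm]; exact add_mem hx hy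
  | ι_mul x v hx =>
    have e : ι R v * x - map p (ι R v * x)
        = ι R v * (x - map p x) + ι R (v - p v) * map p x := by
      rw [map_mul, map_apply_ι, map_sub, mul_sub, sub_mul]; abel
    rw [e]
    exact add_mem (L.mul_mem_left _ hx) (h2 _ (hp v) _)

end Grading

/-! ### Finite-dimensional exterior algebras over a field. -/

section Field

variable {K V : Type*} [Field K] [AddCommGroup V] [Module K V] [FiniteDimensional K V]

instance : FiniteDimensional K (ExteriorAlgebra K V) := by
  classical
  exact Module.Basis.finiteDimensional_of_finite (Module.finBasis K V).ExteriorAlgebra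

theorem eq_zero_of_mem_exteriorPower {n : ℕ} (hn : Module.finrank K V < n)
    {a : ExteriorAlgebra K V} (ha : a ∈ ⋀[K]^n V) : a = 0 := by
  have h0 : Module.finrank K (⋀[K]^n V) = 0 := by
    rw [exteriorPower.finrank_eq, Nat.choose_eq_zero_of_lt hn]
  have := Module.finrank_zero_iff.1 h0
  exact congrArg Subtype.val (Subsingleton.elim (⟨a, ha⟩ : ⋀[K]^n V) 0)

theorem degProj_eq_zero {n : ℕ} (hn : Module.finrank K V < n) (a : ExteriorAlgebra K V) :
    degProj n a = 0 :=
  eq_zero_of_mem_exteriorPower hn (degProj_mem n a)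

/-- The top exterior power is a line, so `a` and `b` are multiples of one vector. The form `ℓ b • a
= ℓ a • b` expresses proportionality without division. -/
theorem smul_comm_of_mem_top {a b : ExteriorAlgebra K V}
    (ha : a ∈ ⋀[K]^(Module.finrank K V) V) (hb : b ∈ ⋀[K]^(Module.finrank K V) V)
    (ℓ : Module.Dual K (ExteriorAlgebra K V)) : ℓ b • a = ℓ a • b := by
  have h1 : Module.finrank K (⋀[K]^(Module.finrank K V) V) = 1 := by
    rw [exteriorPower.finrank_eq, Nat.choose_self]
  obtain ⟨v, -, hv⟩ := finrank_eq_one_iff'.1 h1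
  obtain ⟨r, hr⟩ := hv ⟨a, ha⟩
  obtain ⟨s, hs⟩ := hv ⟨b, hb⟩
  have hr' : r • (v : ExteriorAlgebra K V) = a := congrArg Subtype.val hr
  have hs' : s • (v : ExteriorAlgebra K V) = b := congrArg Subtype.val hs
  rw [← hr', ← hs', map_smul, map_smul, smul_smul, smul_smul, smul_eq_mul, smul_eq_mul]
  congr 1
  ring

omit [FiniteDimensional K V] in
-- Euler's identity: the operator on the left is the derivation extending the identity of `V`, hence
-- multiplies degree `n` by `n`.
theorem sum_ι_mul_contractLeft {n : ℕ} {κ : Type*} [Fintype κ] (b : Module.Basis κ K V)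
    {a : ExteriorAlgebra K V} (ha : a ∈ ⋀[K]^n V) :
    ∑ i, ι K (b i) *
      CliffordAlgebra.contractLeft (Q := (0 : QuadraticForm K V)) (b.coord i) a = (n : K) • a := by
  induction n generalizing a with
  | zero => simp [contractLeft_of_mem_zero _ ha]
  | succ n ih =>
    refine exteriorPower_succ_induction
      (P := fun a => ∑ i, ι K (b i) *
        CliffordAlgebra.contractLeft (Q := (0 : QuadraticForm K V)) (b.coord i) a =
        ((n + 1 : ℕ) : K) • a) (fun x y hx hy => ?_) (fun x v hx => ?_) ha
    · simp only [map_add, mul_add, Finset.sum_add_distrib, hx, hy, smul_add]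
    · have h1 : ∑ i, b.coord i v • ι K (b i) = ι K v := by
        simp only [← map_smul, ← map_sum, Module.Basis.coord_apply, b.sum_repr]
      have h2 : ∀ i, ι K (b i) *
          CliffordAlgebra.contractLeft (Q := (0 : QuadraticForm K V)) (b.coord i) (ι K v * x) =
          (b.coord i v • ι K (b i)) * x + ι K v * (ι K (b i) *
          CliffordAlgebra.contractLeft (Q := (0 : QuadraticForm K V)) (b.coord i) x) := by
        intro i
        have h := ι_add_mul_swap (R := K) (b i) v
        rw [add_eq_zero_iff_eq_neg] at h
        rw [contractLeft_ι_mul, mul_sub, mul_smul_comm, smul_mul_assoc, ← mul_assoc (ι K (b i)), h,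
          neg_mul, sub_neg_eq_add, mul_assoc]
      simp only [h2, Finset.sum_add_distrib, ← Finset.sum_mul, ← Finset.mul_sum, h1]
      rw [ih hx, mul_smul_comm, Nat.cast_succ, add_smul, one_smul, add_comm]

/-- An element of degree less than the top degree annihilated by all vectors vanishes. -/
theorem eq_zero_of_forall_ι_mul_eq_zero [CharZero K] {d : ℕ} (hd : d < Module.finrank K V)
    {a : ExteriorAlgebra K V} (ha : a ∈ ⋀[K]^d V) (h : ∀ v, ι K v * a = 0) : a = 0 := by
  have b := Module.finBasis K V
  have h1 := sum_ι_mul_contractLeft b ha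
  -- Contracting `ι (b i) * a = 0` with the dual basis vector shows that every summand of Euler's
  -- identity equals `a`. The sum is then both `finrank • a` and `d • a`, and `d < finrank`.
  have h2 : ∀ i, ι K (b i) *
      CliffordAlgebra.contractLeft (Q := (0 : QuadraticForm K V)) (b.coord i) a = a := by
    intro i
    have := contractLeft_ι_mul (b.coord i) (b i) a
    rw [h, map_zero] at this
    simp only [Module.Basis.coord_apply, Module.Basis.repr_self, Finsupp.single_eq_same,
      one_smul] at this
    exact (sub_eq_zero.1 this.symm).symm
  rw [Finset.sum_congr rfl fun i _ => h2 i, Finset.sum_const, Finset.card_univ, Fintype.card_fin,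
    ← Nat.cast_smul_eq_nsmul K, ← sub_eq_zero, ← sub_smul] at h1
  refine (smul_eq_zero.1 h1).resolve_left (sub_ne_zero.2 ?_)
  exact_mod_cast hd.ne'

/-- A non-zero product below top degree is not annihilated by all vectors, so it can be lengthened
by one more factor. -/
theorem exists_prod_ι_ne_zero [CharZero K] (n : ℕ) (hn : n ≤ Module.finrank K V) :
    ∃ v : List V, v.length = n ∧ (v.map (ι K)).prod ≠ 0 := by
  induction n with
  | zero => exact ⟨[], rfl, by simp⟩
  | succ n ih =>
    obtain ⟨v, hv, h⟩ := ih (by omega)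
    have hmem : ∀ l : List V, (l.map (ι K)).prod ∈ ⋀[K]^l.length V := by
      intro l
      induction l with
      | nil => rw [exteriorPower, List.length_nil, pow_zero]; exact Submodule.one_le.1 le_rfl
      | cons w l ih =>
        rw [List.map_cons, List.prod_cons, List.length_cons, add_comm]
        exact mul_mem_exteriorPower (ι_mem w) ih
    by_contra hcon
    push Not at hcon
    refine h (eq_zero_of_forall_ι_mul_eq_zero (d := n) (by omega) (hv ▸ hmem v) fun w => ?_)
    have := hcon (w :: v) (by simp [hv])
    simpa using this

end Field

end ExteriorAlgebra

/-! ## Division of analytic functions by linear forms -/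

section Hadamard

variable {𝕜 E F : Type*} [NontriviallyNormedField 𝕜] [NormedAddCommGroup E] [NormedSpace 𝕜 E]
  [NormedAddCommGroup F] [NormedSpace 𝕜 F]

/-- The multilinear map whose value on the diagonal at `h` is the divided difference, in the
direction `e`, of `p` between `h` and `q h`. -/
noncomputable def ContinuousMultilinearMap.divDiff {n : ℕ} (p : E [×(n + 1)]→L[𝕜] F)
    (q : E →L[𝕜] E) (e : E) : E [×n]→L[𝕜] F :=
  ∑ i : Fin (n + 1), (p.curryMid i e).compContinuousLinearMap
    (fun j => if (j : ℕ) < i then q else ContinuousLinearMap.id 𝕜 E)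

/-- Telescoping: the `i`-th summand is the change of `p` when its `i`-th argument passes from `h` to
`q h`, the earlier arguments being `q h` already and the later ones still `h`. -/
theorem ContinuousMultilinearMap.divDiff_apply {n : ℕ} (p : E [×(n + 1)]→L[𝕜] F)
    (q : E →L[𝕜] E) (h : E) :
    p.divDiff q (h - q h) (fun _ => h) = p (fun _ => h) - p (fun _ => q h) := by
  have h1 : ∀ i : Fin (n + 1), (p.curryMid i (h - q h)).compContinuousLinearMap
      (fun j => if (j : ℕ) < i then q else ContinuousLinearMap.id 𝕜 E) (fun _ => h) =
      p (fun j => if (j : ℕ) < i then q h else h) -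
        p (fun j => if (j : ℕ) < i + 1 then q h else h) := by
    intro i
    rw [ContinuousMultilinearMap.compContinuousLinearMap_apply,
      ContinuousMultilinearMap.curryMid_apply]
    -- Inserting at position `i` keeps the indices below `i` and shifts the others by one. The
    -- condition `j < i` is unaffected, so the insertion is an update of a function on `Fin (n +
    -- 1)`.
    have e1 : ∀ z : E, (i.insertNth z (fun j : Fin n => (if (j : ℕ) < i then q else
        ContinuousLinearMap.id 𝕜 E) h) : Fin (n + 1) → E) =
        Function.update (fun j : Fin (n + 1) => if (j : ℕ) < i then q h else h) i z := by
      intro z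
      ext j
      refine Fin.succAboveCases i ?_ (fun j => ?_) j
      · simp
      · rw [Fin.insertNth_apply_succAbove, Function.update_of_ne (Fin.succAbove_ne i j)]
        by_cases hj : (j : ℕ) < i
        · rw [Fin.succAbove_of_castSucc_lt _ _ (by simpa [Fin.lt_def] using hj)]
          simp [hj]
        · rw [Fin.succAbove_of_le_castSucc _ _ (by simpa [Fin.le_def] using hj)]
          have : ¬ (j : ℕ) + 1 < i := by omega
          simp [hj, this]
    rw [e1, p.map_update_sub]
    congr 2
    · ext j
      by_cases hj : j = i
      · subst hj; simp
      · simp [Function.update_of_ne hj]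
    · ext j
      by_cases hj : j = i
      · subst hj; simp
      · have : (j : ℕ) ≠ i := fun h => hj (Fin.ext h)
        rw [Function.update_of_ne hj]
        by_cases h2 : (j : ℕ) < i
        · simp [h2, h2.trans (Nat.lt_succ_self _)]
        · have : ¬ (j : ℕ) < i + 1 := by omega
          simp [h2, this]
  rw [ContinuousMultilinearMap.divDiff, sum_apply,
    Finset.sum_congr rfl fun i _ => h1 i,
    Fin.sum_univ_eq_sum_range (fun i => p (fun j => if (j : ℕ) < i then q h else h) -
        p (fun j => if (j : ℕ) < i + 1 then q h else h)), Finset.sum_range_sub']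
  congr 2
  ext j
  simp [j.2]

theorem ContinuousMultilinearMap.divDiff_sum {n : ℕ} (p : E [×(n + 1)]→L[𝕜] F)
    (q : E →L[𝕜] E) {A : Type*} (s : Finset A) (c : A → 𝕜) (e : A → E) :
    p.divDiff q (∑ a ∈ s, c a • e a) = ∑ a ∈ s, c a • p.divDiff q (e a) := by
  have h : ∀ (i : Fin (n + 1)) (v : Fin n → E), p.curryMid i (∑ a ∈ s, c a • e a) v =
      ∑ a ∈ s, c a • p.curryMid i (e a) v := by
    intro i v
    rw [_root_.map_sum, _root_.sum_apply]
    exact Finset.sum_congr rfl fun a _ => by rw [_root_.map_smul]; rfl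
  ext v
  simp only [divDiff, _root_.sum_apply, compContinuousLinearMap_apply, smul_apply, h,
    Finset.smul_sum]
  exact Finset.sum_comm

theorem ContinuousMultilinearMap.norm_divDiff_le {n : ℕ} (p : E [×(n + 1)]→L[𝕜] F)
    (q : E →L[𝕜] E) (e : E) {c : ℝ} (hc : 1 ≤ c) (hq : ‖q‖ ≤ c) :
    ‖p.divDiff q e‖ ≤ (n + 1) * (‖p‖ * ‖e‖ * c ^ n) := by
  refine (norm_sum_le _ _).trans ?_
  have : ∀ i : Fin (n + 1), ‖(p.curryMid i e).compContinuousLinearMap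
      (fun j => if (j : ℕ) < i then q else ContinuousLinearMap.id 𝕜 E)‖ ≤ ‖p‖ * ‖e‖ * c ^ n := by
    intro i
    refine (norm_compContinuousLinearMap_le _ _).trans ?_
    refine mul_le_mul ?_ ?_ (Finset.prod_nonneg fun _ _ => norm_nonneg _) (by positivity)
    · refine ((p.curryMid i).le_opNorm e).trans ?_
      rw [norm_curryMid]
    · calc _ ≤ ∏ j : Fin n, c := by
            refine Finset.prod_le_prod (fun _ _ => norm_nonneg _) fun j _ => ?_
            split_ifs
            · exact hq
            · exact ContinuousLinearMap.norm_id_le.trans hc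
        _ = c ^ n := by simp
  refine (Finset.sum_le_sum fun i _ => this i).trans ?_
  simp

/-- The formal multilinear series of divided differences. -/
noncomputable def FormalMultilinearSeries.divDiff (p : FormalMultilinearSeries 𝕜 E F)
    (q : E →L[𝕜] E) (e : E) : FormalMultilinearSeries 𝕜 E F :=
  fun n => (p (n + 1)).divDiff q e

/-- The `n`-th term gains at most the factor `(n + 1) c ^ n` with `c = max 1 ‖q‖`. As `n + 1 ≤ 2 ^
n`, dividing an admissible radius `r` by `2 c` absorbs it. -/
theorem FormalMultilinearSeries.radius_divDiff_pos {p : FormalMultilinearSeries 𝕜 E F}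
    (hp : 0 < p.radius) (q : E →L[𝕜] E) (e : E) : 0 < (p.divDiff q e).radius := by
  obtain ⟨r, hr0, hr⟩ := ENNReal.lt_iff_exists_nnreal_btwn.1 hp
  obtain ⟨C, hC0, hC⟩ := p.norm_mul_pow_le_of_lt_radius hr
  have hr0' : (0 : ℝ) < r := by exact_mod_cast hr0
  set c : NNReal := max 1 ‖q‖₊ with hc
  have hc1 : (1 : ℝ) ≤ c := by exact_mod_cast le_max_left _ _
  have hcq : ‖q‖ ≤ c := by exact_mod_cast le_max_right 1 ‖q‖₊
  have hpos : 0 < r / (2 * c) := by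
    have : 0 < c := lt_of_lt_of_le one_pos (le_max_left _ _)
    have : 0 < r := by exact_mod_cast hr0
    positivity
  refine lt_of_lt_of_le (b := ((r / (2 * c) : NNReal) : ENNReal)) (by exact_mod_cast hpos) ?_
  refine (p.divDiff q e).le_radius_of_bound (C / r * ‖e‖) fun n => ?_
  have h1 := (p (n + 1)).norm_divDiff_le q e hc1 hcq
  have h2 : (n + 1 : ℝ) ≤ 2 ^ n := by exact_mod_cast Nat.lt_two_pow_self
  have hcpos : (0 : ℝ) < c := by linarith
  calc ‖p.divDiff q e n‖ * ((r / (2 * c) : NNReal) : ℝ) ^ n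
      ≤ (n + 1) * (‖p (n + 1)‖ * ‖e‖ * (c : ℝ) ^ n) * ((r / (2 * c) : NNReal) : ℝ) ^ n := by
        gcongr; exact h1
    _ = ((n + 1) / 2 ^ n) * ((‖p (n + 1)‖ * r ^ (n + 1)) / r * ‖e‖) := by
        push_cast
        rw [div_pow, mul_pow]
        field_simp
        ring
    _ ≤ 1 * (C / r * ‖e‖) := by
        gcongr
        · exact (div_le_one (by positivity)).2 h2
        · exact hC (n + 1)
    _ = _ := one_mul _

/-- An analytic function vanishing where finitely many linear forms vanish is, locally, a linear
combination of these forms with analytic coefficients. -/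
theorem AnalyticAt.exists_eq_sum_mul [CompleteSpace 𝕜] {A : Type*} [Fintype A] {f : E → 𝕜} {x : E}
    (hf : AnalyticAt 𝕜 f x) (e : A → E) (ℓ : A → E →L[𝕜] 𝕜) :
    ∃ K : A → E → 𝕜, (∀ a, AnalyticAt 𝕜 (K a) x) ∧
      ∀ᶠ h in nhds (0 : E), f (x + h) - f (x + (h - ∑ a, ℓ a h • e a)) =
        ∑ a, ℓ a h * K a (x + h) := by
  obtain ⟨p, r, hp⟩ := hf
  -- With this `q`, `h - q h = ∑ ℓ a h • e a`. As the divided difference is linear in its direction,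
  -- it splits into the parts along the `e a`, which supply the coefficients `K a`.
  let q : E →L[𝕜] E := ContinuousLinearMap.id 𝕜 E - ∑ a, (ℓ a).smulRight (e a)
  have hq : ∀ h, q h = h - ∑ a, ℓ a h • e a := fun h => by
    simp [q]
  have hk : ∀ a, HasFPowerSeriesOnBall (p.divDiff q (e a)).sum (p.divDiff q (e a)) 0
      (p.divDiff q (e a)).radius := fun a =>
    (p.divDiff q (e a)).hasFPowerSeriesOnBall
      (FormalMultilinearSeries.radius_divDiff_pos hp.radius_pos q (e a))
  refine ⟨fun a y => (p.divDiff q (e a)).sum (y - x), fun a => ?_, ?_⟩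
  · have := (hk a).analyticAt
    refine AnalyticAt.fun_comp (f := fun y => y - x) ?_ (analyticAt_id.sub analyticAt_const)
    simpa using this
  · have e1 : ∀ᶠ h in nhds (0 : E), h ∈ Metric.eball (0 : E) r :=
      Metric.eball_mem_nhds 0 hp.r_pos
    have e2 : ∀ᶠ h in nhds (0 : E), q h ∈ Metric.eball (0 : E) r := by
      have : Filter.Tendsto q (nhds 0) (nhds 0) := by
        simpa using q.continuous.tendsto 0
      exact this.eventually (Metric.eball_mem_nhds 0 hp.r_pos)
    have e3 : ∀ᶠ h in nhds (0 : E), ∀ a,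
        h ∈ Metric.eball (0 : E) (p.divDiff q (e a)).radius :=
      Filter.eventually_all.2 fun a => Metric.eball_mem_nhds 0 (hk a).r_pos
    filter_upwards [e1, e2, e3] with h h1 h2 h3
    have s1 := (hp.hasSum h1).sub (hp.hasSum h2)
    -- The series of divided differences starts from the linear term of `p`. The constant terms at
    -- `h` and `q h` are split off here and cancel at the end.
    rw [← hasSum_nat_add_iff' 1] at s1
    have s2 : HasSum (fun n => ∑ a, ℓ a h * p.divDiff q (e a) n fun _ => h)
        (∑ a, ℓ a h * (p.divDiff q (e a)).sum h) := by
      refine hasSum_sum fun a _ => HasSum.mul_left _ ?_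
      have := (hk a).hasSum (h3 a)
      rwa [zero_add] at this
    have s3 : ∀ n, ∑ a, ℓ a h * p.divDiff q (e a) n (fun _ => h) =
        (p (n + 1) fun _ => h) - p (n + 1) fun _ => q h := by
      intro n
      rw [← ContinuousMultilinearMap.divDiff_apply,
        show h - q h = ∑ a, ℓ a h • e a by rw [hq]; abel, ContinuousMultilinearMap.divDiff_sum,
        sum_apply]
      rfl
    simp only [s3] at s2
    have := s1.unique s2
    rw [← hq, add_sub_cancel_left, ← this]
    simp only [Finset.range_one, Finset.sum_singleton]
    have : (p 0 fun _ => h) = p 0 fun _ => q h := by congr 1; ext i; exact i.elim0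
    rw [this]; ring

end Hadamard

/-! ## Holomorphic functions, sections and frames -/

namespace Supergeometry

variable {S : Supergeometry.{u}}

theorem IsHolFun.mono {W U : Opens S.carrier} {g : S.carrier → ℂ} (hg : S.IsHolFun U g)
    (h : W ≤ U) : S.IsHolFun W g := ContMDiffOn.mono hg h

theorem IsHolFun.congr {W : Opens S.carrier} {g g' : S.carrier → ℂ} (hg : S.IsHolFun W g)
    (h : ∀ x ∈ W, g' x = g x) : S.IsHolFun W g' := ContMDiffOn.congr hg h

theorem IsHolFun.of_local {U : Opens S.carrier} {g : S.carrier → ℂ}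
    (h : ∀ x ∈ U, ∃ W : Opens S.carrier, x ∈ W ∧ S.IsHolFun W g) : S.IsHolFun U g := fun x hx => by
  obtain ⟨W, hxW, hW⟩ := h x hx
  exact (hW.contMDiffAt (W.2.mem_nhds hxW)).contMDiffWithinAt

variable (S) in
/-- The algebra of functions which are holomorphic on `W`. -/
noncomputable def holAlg (W : Opens S.carrier) : Subalgebra ℂ (S.carrier → ℂ) where
  carrier := {g | S.IsHolFun W g}
  mul_mem' hg hh := ContMDiffOn.mul hg hh
  add_mem' hg hh := ContMDiffOn.add hg hh
  algebraMap_mem' _ := contMDiffOn_const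

theorem mem_holAlg {W : Opens S.carrier} {g : S.carrier → ℂ} : g ∈ S.holAlg W ↔ S.IsHolFun W g :=
  Iff.rfl

theorem IsHolFun.const (W : Opens S.carrier) (c : ℂ) : S.IsHolFun W fun _ => c := contMDiffOn_const

theorem IsHolFun.add {W : Opens S.carrier} {g h : S.carrier → ℂ} (hg : S.IsHolFun W g)
    (hh : S.IsHolFun W h) : S.IsHolFun W (fun x => g x + h x) := ContMDiffOn.add hg hh

theorem IsHolFun.mul {W : Opens S.carrier} {g h : S.carrier → ℂ} (hg : S.IsHolFun W g)
    (hh : S.IsHolFun W h) : S.IsHolFun W (fun x => g x * h x) := ContMDiffOn.mul hg hh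

theorem IsHolFun.inv {W : Opens S.carrier} {g : S.carrier → ℂ} (hg : S.IsHolFun W g)
    (h : ∀ x ∈ W, g x ≠ 0) : S.IsHolFun W (fun x => (g x)⁻¹) := ContMDiffOn.inv₀ hg h

theorem IsHolFun.sum {W : Opens S.carrier} {κ : Type*} (s : Finset κ) {g : κ → S.carrier → ℂ}
    (hg : ∀ k ∈ s, S.IsHolFun W (g k)) : S.IsHolFun W (fun x => ∑ k ∈ s, g k x) := by
  have := sum_mem (S := S.holAlg W) hg
  rw [mem_holAlg] at this
  exact this.congr fun x _ => by simp

/-- The open set of points of `W` at which `g` does not vanish. -/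
def IsHolFun.nonvanishing {W : Opens S.carrier} {g : S.carrier → ℂ} (hg : S.IsHolFun W g) :
    Opens S.carrier :=
  ⟨(W : Set S.carrier) ∩ g ⁻¹' {0}ᶜ,
    (ContMDiffOn.continuousOn hg).isOpen_inter_preimage W.2 isOpen_compl_singleton⟩

theorem IsHolSection.mono {W U : Opens S.carrier} {σ : ∀ x, S.fibre x} (hσ : S.IsHolSection U σ)
    (h : W ≤ U) : S.IsHolSection W σ := ContMDiffOn.mono hσ h

theorem IsHolSection.smul {W : Opens S.carrier} {g : S.carrier → ℂ} {σ : ∀ x, S.fibre x}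
    (hg : S.IsHolFun W g) (hσ : S.IsHolSection W σ) : S.IsHolSection W (fun x => g x • σ x) :=
  ContMDiffOn.smul_section hg hσ

theorem IsHolSection.sum {W : Opens S.carrier} {κ : Type*} (s : Finset κ)
    {σ : κ → ∀ x, S.fibre x} (hσ : ∀ k ∈ s, S.IsHolSection W (σ k)) :
    S.IsHolSection W (fun x => ∑ k ∈ s, σ k x) :=
  ContMDiffOn.sum_section hσ

theorem IsHolSection.sub {W : Opens S.carrier} {σ τ : ∀ x, S.fibre x}
    (hσ : S.IsHolSection W σ) (hτ : S.IsHolSection W τ) :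
    S.IsHolSection W (fun x => σ x - τ x) :=
  ContMDiffOn.sub_section hσ hτ

variable (S) in
/-- The preferred trivialization of the odd conormal bundle at `p`. -/
noncomputable abbrev triv (p : S.carrier) :
    Bundle.Trivialization (EuclideanSpace ℂ (Fin S.rank))
      (Bundle.TotalSpace.proj :
        Bundle.TotalSpace (EuclideanSpace ℂ (Fin S.rank)) S.fibre → S.carrier) :=
  trivializationAt _ S.fibre p

variable (S) in
/-- The domain of the preferred trivialization at `p`. -/
noncomputable def trivDom (p : S.carrier) : Opens S.carrier :=
  ⟨(S.triv p).baseSet, (S.triv p).open_baseSet⟩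

theorem mem_trivDom (p : S.carrier) : p ∈ S.trivDom p :=
  mem_baseSet_trivializationAt (EuclideanSpace ℂ (Fin S.rank)) S.fibre p

theorem finrank_fibre (x : S.carrier) : Module.finrank ℂ (S.fibre x) = S.rank := by
  rw [((S.triv x).linearEquivAt ℂ x (mem_trivDom x)).finrank_eq, finrank_euclideanSpace,
    Fintype.card_fin]

instance (x : S.carrier) : FiniteDimensional ℂ (S.fibre x) :=
  Module.Finite.equiv ((S.triv x).linearEquivAt ℂ x (mem_trivDom x)).symm

theorem isHolSection_symm (p : S.carrier) (v : EuclideanSpace ℂ (Fin S.rank)) :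
    S.IsHolSection (S.trivDom p) (fun x => (S.triv p).symmₗ ℂ x v) := by
  refine ((S.triv p).contMDiffOn_section_baseSet_iff).2 ?_
  refine (contMDiffOn_const (c := v)).congr fun x hx => ?_
  have := (S.triv p).linearMapAt_symmₗ (R := ℂ) hx v
  rwa [(S.triv p).coe_linearMapAt_of_mem hx] at this

theorem exists_section (p : S.carrier) (a : S.fibre p) :
    ∃ σ, S.IsHolSection (S.trivDom p) σ ∧ σ p = a :=
  ⟨_, isHolSection_symm p ((S.triv p).linearMapAt ℂ p a),
    (S.triv p).symmₗ_linearMapAt (mem_trivDom p) a⟩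

theorem IsHolSection.coord {p : S.carrier} {W : Opens S.carrier} (hW : W ≤ S.trivDom p)
    {σ : ∀ x, S.fibre x} (hσ : S.IsHolSection W σ)
    (ℓ : Module.Dual ℂ (EuclideanSpace ℂ (Fin S.rank))) :
    S.IsHolFun W (fun x => ℓ ((S.triv p).linearMapAt ℂ x (σ x))) := by
  have h1 := ((S.triv p).contMDiffOn_section_iff W.2 hW).1 hσ
  have h2 : ContMDiff 𝓘(ℂ, EuclideanSpace ℂ (Fin S.rank)) 𝓘(ℂ) ω
      (LinearMap.toContinuousLinearMap ℓ) :=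
    (LinearMap.toContinuousLinearMap ℓ).contMDiff
  refine (h2.comp_contMDiffOn h1).congr fun x hx => ?_
  rw [(S.triv p).coe_linearMapAt_of_mem (hW hx)]
  rfl

variable (S) in
/-- A holomorphic frame of the odd conormal bundle over `U`, indexed by `κ`. -/
structure Frame (U : Opens S.carrier) (κ : Type) [Fintype κ] where
  ofV : ∀ x, (κ → ℂ) →ₗ[ℂ] S.fibre x
  toV : ∀ x, S.fibre x →ₗ[ℂ] (κ → ℂ)
  ofV_toV : ∀ x ∈ U, ∀ a, ofV x (toV x a) = a
  toV_ofV : ∀ x ∈ U, ∀ c, toV x (ofV x c) = c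
  isHol_toV : ∀ W ≤ U, ∀ σ, S.IsHolSection W σ → ∀ k, S.IsHolFun W (fun x => toV x (σ x) k)
  isHol_ofV : ∀ c, S.IsHolSection U (fun x => ofV x c)

/-- Restriction of a frame. -/
def Frame.restrict {U W : Opens S.carrier} {κ : Type} [Fintype κ] (fr : S.Frame U κ) (h : W ≤ U) :
    S.Frame W κ where
  ofV := fr.ofV
  toV := fr.toV
  ofV_toV x hx := fr.ofV_toV x (h hx)
  toV_ofV x hx := fr.toV_ofV x (h hx)
  isHol_toV V hV := fr.isHol_toV V (hV.trans h)
  isHol_ofV c := (fr.isHol_ofV c).mono h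

theorem card_eq_rank {κ : Type} [Fintype κ] {p : S.carrier} (b : Module.Basis κ ℂ (S.fibre p)) :
    Fintype.card κ = S.rank := by
  rw [← finrank_fibre p, Module.finrank_eq_card_basis b]

/-- Holomorphic sections which form a basis at a point form a frame near this point. -/
theorem exists_frame {κ : Type} [Fintype κ] {p : S.carrier} {W : Opens S.carrier} (hp : p ∈ W)
    (θ : κ → ∀ x, S.fibre x) (hθ : ∀ k, S.IsHolSection W (θ k))
    (b : Module.Basis κ ℂ (S.fibre p)) (hb : ∀ k, b k = θ k p) :
    ∃ (U : Opens S.carrier) (_ : U ≤ W) (fr : S.Frame U κ), p ∈ U ∧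
      ∀ x c, fr.ofV x c = ∑ k, c k • θ k x := by
  classical
  let e := S.triv p
  let W' := W ⊓ S.trivDom p
  let b₀ : Module.Basis κ ℂ (EuclideanSpace ℂ (Fin S.rank)) :=
    b.map (e.linearEquivAt ℂ p (mem_trivDom p))
  -- The matrix has entries in the algebra of holomorphic functions, so its determinant and the
  -- entries of its adjugate are holomorphic without computation. At `p` it is the identity.
  let A : Matrix κ κ (S.holAlg W') := fun j k =>
    ⟨fun x => b₀.coord j (e.linearMapAt ℂ x (θ k x)),
      ((hθ k).mono inf_le_left).coord inf_le_right _⟩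
  let ev : ∀ x, S.holAlg W' →+* ℂ := fun x => (Pi.evalRingHom _ x).comp (S.holAlg W').subtype
  have hA : ∀ x j k, (ev x).mapMatrix A j k = b₀.coord j (e.linearMapAt ℂ x (θ k x)) :=
    fun _ _ _ => rfl
  have hev : ∀ x (g : S.holAlg W'), ev x g = g.1 x := fun _ _ => rfl
  have hdet : S.IsHolFun W' A.det.1 := A.det.2
  have hp1 : (ev p).mapMatrix A = 1 := by
    ext j k
    rw [hA, ← hb]
    have : e.linearMapAt ℂ p (b k) = b₀ k := by
      rw [e.coe_linearMapAt_of_mem (mem_trivDom p)]; rfl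
    rw [this, Module.Basis.coord_apply, Module.Basis.repr_self, Matrix.one_apply,
      Finsupp.single_apply]
    simp [eq_comm]
  let U := hdet.nonvanishing
  have hUW' : U ≤ W' := fun x hx => hx.1
  let ofV : ∀ x, (κ → ℂ) →ₗ[ℂ] S.fibre x := fun x => Fintype.linearCombination ℂ (θ · x)
  -- Cramer's rule: the inverse of the matrix as adjugate over determinant.
  let toV : ∀ x, S.fibre x →ₗ[ℂ] (κ → ℂ) := fun x =>
    (A.det.1 x)⁻¹ • (((ev x).mapMatrix A).adjugate.mulVecLin ∘ₗ b₀.equivFun.toLinearMap ∘ₗ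
      e.linearMapAt ℂ x)
  have h1 : ∀ x ∈ U, ∀ c, toV x (ofV x c) = c := by
    intro x hx c
    have e1 : b₀.equivFun (e.linearMapAt ℂ x (ofV x c)) = ((ev x).mapMatrix A).mulVec c := by
      ext j
      simp only [ofV, Fintype.linearCombination_apply, map_sum, map_smul, Finset.sum_apply,
        Pi.smul_apply, Matrix.mulVec, dotProduct, hA, smul_eq_mul, Module.Basis.coord_apply,
        Module.Basis.equivFun_apply, mul_comm]
    have hx0 : A.det.1 x ≠ 0 := hx.2
    have e2 : ((ev x).mapMatrix A).det = A.det.1 x := by rw [← RingHom.map_det]; rfl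
    change (A.det.1 x)⁻¹ • ((ev x).mapMatrix A).adjugate.mulVec
      (b₀.equivFun (e.linearMapAt ℂ x (ofV x c))) = c
    rw [e1, Matrix.mulVec_mulVec, Matrix.adjugate_mul, e2, Matrix.smul_mulVec, Matrix.one_mulVec,
      smul_smul, inv_mul_cancel₀ hx0, one_smul]
  refine ⟨U, hUW'.trans inf_le_left, ⟨ofV, toV, ?_, h1, ?_, ?_⟩, ⟨⟨hp, mem_trivDom p⟩, ?_⟩, ?_⟩
  · intro x hx a
    have hinj : Function.Injective (ofV x) := fun c c' h => by
      rw [← h1 x hx c, ← h1 x hx c', h]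
    have hsurj : Function.Surjective (ofV x) :=
      (LinearMap.injective_iff_surjective_of_finrank_eq_finrank
        (by rw [finrank_fibre, Module.finrank_fintype_fun_eq_card, card_eq_rank b])).1 hinj
    obtain ⟨c, rfl⟩ := hsurj a
    rw [h1 x hx]
  · intro V hV σ hσ k
    have h2 : ∀ j, S.IsHolFun V fun x => b₀.coord j (e.linearMapAt ℂ x (σ x)) := fun j =>
      hσ.coord (hV.trans (hUW'.trans inf_le_right)) _
    have h3 : ∀ j, S.IsHolFun V (A.adjugate k j).1 := fun j =>
      IsHolFun.mono (A.adjugate k j).2 (hV.trans hUW')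
    have h4 : S.IsHolFun V fun x => (A.det.1 x)⁻¹ :=
      (hdet.mono (hV.trans hUW')).inv fun x hx => (hV hx).2
    refine (h4.mul (IsHolFun.sum Finset.univ fun j _ => (h3 j).mul (h2 j))).congr fun x _ => ?_
    change (A.det.1 x)⁻¹ * (((ev x).mapMatrix A).adjugate.mulVec
      (b₀.equivFun (e.linearMapAt ℂ x (σ x)))) k = _
    rw [← RingHom.map_adjugate]
    rfl
  · intro c
    exact IsHolSection.sum Finset.univ fun k _ =>
      IsHolSection.smul (IsHolFun.const U (c k)) ((hθ k).mono (hUW'.trans inf_le_left))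
  · have : A.det.1 p = 1 := by
      have := (ev p).map_det A
      rwa [hp1, Matrix.det_one] at this
    change A.det.1 p ≠ 0
    rw [this]; exact one_ne_zero
  · intro x c
    exact Fintype.linearCombination_apply ..

end Supergeometry

/-! ## Sections of the sheaf of exterior algebras in a frame -/

namespace Supergeometry

variable {S : Supergeometry.{u}}

/-- Extension by zero of a function defined on an open set. -/
noncomputable def extZero {W : Opens S.carrier} (g : W → ℂ) : S.carrier → ℂ :=
  Function.extend Subtype.val g 0

theorem extZero_apply {W : Opens S.carrier} (g : W → ℂ) (x : W) : extZero g x = g x :=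
  Subtype.val_injective.extend_apply g 0 x

theorem extZero_apply' {W : Opens S.carrier} (g : W → ℂ) {x : S.carrier} (hx : x ∈ W) :
    extZero g x = g ⟨x, hx⟩ := extZero_apply g ⟨x, hx⟩

/-! ### Holomorphic functions with values in a vector space. -/

section HolVal

variable {A B C : Type*} [AddCommGroup A] [Module ℂ A] [AddCommGroup B] [Module ℂ B]
  [AddCommGroup C] [Module ℂ C]

/-- `f` is a holomorphic function on `W` with values in the vector space `A`. -/
def IsHolVal {W : Opens S.carrier} (f : W → A) : Prop :=
  ∀ ℓ : Module.Dual ℂ A, S.IsHolFun W (extZero fun x => ℓ (f x))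

theorem IsHolVal.of_sum {W : Opens S.carrier} {κ : Type*} [Fintype κ] {g : κ → S.carrier → ℂ}
    (hg : ∀ k, S.IsHolFun W (g k)) (b : κ → A) {f : W → A}
    (hf : ∀ x : W, f x = ∑ k, g k x • b k) : IsHolVal f := fun ℓ =>
  (IsHolFun.sum Finset.univ fun k _ => (hg k).mul (IsHolFun.const W (ℓ (b k)))).congr
    fun x hx => by
      rw [extZero_apply' _ hx, hf]
      simp [map_sum]

theorem IsHolVal.exists_sum [FiniteDimensional ℂ A] {W : Opens S.carrier} {f : W → A}
    (hf : IsHolVal f) : ∃ g : Fin (Module.finrank ℂ A) → S.carrier → ℂ,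
      (∀ k, S.IsHolFun W (g k)) ∧ ∀ x : W, f x = ∑ k, g k x • Module.finBasis ℂ A k :=
  ⟨fun k => extZero fun x => (Module.finBasis ℂ A).coord k (f x), fun _ => hf _, fun x => by
    simp only [extZero_apply, Module.Basis.coord_apply, Module.Basis.sum_repr]⟩

theorem IsHolVal.map {W : Opens S.carrier} {f : W → A} (hf : IsHolVal f) (L : A →ₗ[ℂ] B) :
    IsHolVal fun x => L (f x) := fun ℓ => hf (ℓ ∘ₗ L)

theorem IsHolVal.map₂ [FiniteDimensional ℂ A] [FiniteDimensional ℂ B] {W : Opens S.carrier}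
    {f : W → A} (hf : IsHolVal f) {g : W → B} (hg : IsHolVal g) (L : A →ₗ[ℂ] B →ₗ[ℂ] C) :
    IsHolVal fun x => L (f x) (g x) := by
  obtain ⟨F, hF, hFs⟩ := hf.exists_sum
  obtain ⟨G, hG, hGs⟩ := hg.exists_sum
  refine IsHolVal.of_sum (κ := Fin _ × Fin _) (g := fun k x => F k.1 x * G k.2 x)
    (fun k => (hF k.1).mul (hG k.2))
    (fun k => L (Module.finBasis ℂ A k.1) (Module.finBasis ℂ B k.2)) fun x => ?_
  rw [hFs, hGs, Fintype.sum_prod_type]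
  simp only [map_sum, LinearMap.sum_apply, map_smul, LinearMap.smul_apply, Finset.smul_sum,
    smul_smul, mul_comm]
  exact Finset.sum_comm

theorem IsHolVal.congr {W : Opens S.carrier} {f g : W → A} (hf : IsHolVal f)
    (h : ∀ x, g x = f x) : IsHolVal g := by
  rwa [show g = f from funext h]

theorem IsHolVal.add {W : Opens S.carrier} {f g : W → A} (hf : IsHolVal f) (hg : IsHolVal g) :
    IsHolVal fun x => f x + g x := fun ℓ =>
  ((hf ℓ).add (hg ℓ)).congr fun x hx => by simp [extZero_apply' _ hx]

theorem IsHolVal.sum {W : Opens S.carrier} {κ : Type*} (s : Finset κ) {f : κ → W → A}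
    (hf : ∀ k ∈ s, IsHolVal (f k)) : IsHolVal fun x => ∑ k ∈ s, f k x := fun ℓ =>
  (IsHolFun.sum s fun k hk => hf k hk ℓ).congr fun x hx => by
    simp [extZero_apply' _ hx, map_sum]

theorem IsHolVal.const (W : Opens S.carrier) (a : A) : IsHolVal fun _ : W => a := fun ℓ =>
  (IsHolFun.const W (ℓ a)).congr fun _ hx => extZero_apply' _ hx

theorem IsHolVal.res {W U : Opens S.carrier} (h : W ≤ U) {f : U → A} (hf : IsHolVal f) :
    IsHolVal fun x : W => f ⟨x, h x.2⟩ := fun ℓ =>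
  ((hf ℓ).mono h).congr fun x hx => by rw [extZero_apply' _ hx, extZero_apply' _ (h hx)]

theorem IsHolVal.of_local {U : Opens S.carrier} {f : U → A}
    (h : ∀ x ∈ U, ∃ (W : Opens S.carrier) (hW : W ≤ U), x ∈ W ∧
      IsHolVal fun x : W => f ⟨x, hW x.2⟩) : IsHolVal f := fun ℓ =>
  IsHolFun.of_local fun x hx => by
    obtain ⟨W, hW, hxW, hf⟩ := h x hx
    exact ⟨W, hxW, (hf ℓ).congr fun x hx => by
      rw [extZero_apply' _ hx, extZero_apply' _ (hW hx)]⟩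

theorem IsHolVal.mul {A : Type*} [Ring A] [Algebra ℂ A] [FiniteDimensional ℂ A]
    {W : Opens S.carrier} {f g : W → A} (hf : IsHolVal f) (hg : IsHolVal g) :
    IsHolVal fun x => f x * g x := hf.map₂ hg (LinearMap.mul ℂ A)

end HolVal

theorem res_self {U : Opens S.carrier} (h : U ≤ U) (s : S.Sec U) : S.res h s = s := rfl

theorem sec_ext {U : Opens S.carrier} {s t : S.Sec U} (h : ∀ x : U, s.1 x = t.1 x) : s = t :=
  Subtype.ext (funext h)

theorem mem_sec_of_mem_genSec {U : Opens S.carrier} {s : S.RoughSec U} (hs : s ∈ S.genSec U) :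
    s ∈ S.Sec U := fun x => ⟨U, le_rfl, x.2, hs⟩

theorem mem_sec_of_local {U : Opens S.carrier} {s : S.RoughSec U}
    (h : ∀ x ∈ U, ∃ (W : Opens S.carrier) (hW : W ≤ U), x ∈ W ∧ S.roughRes hW s ∈ S.Sec W) :
    s ∈ S.Sec U := fun x => by
  obtain ⟨W, hW, hx, hs⟩ := h x x.2
  obtain ⟨V, hV, hxV, hsV⟩ := hs ⟨x, hx⟩
  exact ⟨V, hV.trans hW, hxV, hsV⟩

/-- A holomorphic function, as a section of the sheaf of exterior algebras. -/
def ofFun {W : Opens S.carrier} {g : S.carrier → ℂ} (hg : S.IsHolFun W g) : S.Sec W :=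
  ⟨fun x => algebraMap ℂ (ExteriorAlgebra ℂ (S.fibre x)) (g x),
    mem_sec_of_mem_genSec (Algebra.subset_adjoin (Or.inl ⟨g, hg, rfl⟩))⟩

theorem ofFun_apply {W : Opens S.carrier} {g : S.carrier → ℂ} (hg : S.IsHolFun W g) (x : W) :
    (ofFun hg).1 x = algebraMap ℂ (ExteriorAlgebra ℂ (S.fibre x)) (g x) := rfl

/-! ### Sections of the exterior algebra as holomorphic functions of coefficients in a frame. -/

namespace Frame

open ExteriorAlgebra

variable {U : Opens S.carrier} {κ : Type} [Fintype κ] (fr : S.Frame U κ)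

theorem map_toV_map_ofV {x : S.carrier} (hx : x ∈ U) (a : ExteriorAlgebra ℂ (κ → ℂ)) :
    map (fr.toV x) (map (fr.ofV x) a) = a := by
  rw [← AlgHom.comp_apply, map_comp_map,
    show fr.toV x ∘ₗ fr.ofV x = LinearMap.id from LinearMap.ext (fr.toV_ofV x hx), map_id,
    AlgHom.id_apply]

theorem map_ofV_map_toV {x : S.carrier} (hx : x ∈ U) (a : ExteriorAlgebra ℂ (S.fibre x)) :
    map (fr.ofV x) (map (fr.toV x) a) = a := by
  rw [← AlgHom.comp_apply, map_comp_map,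
    show fr.ofV x ∘ₗ fr.toV x = LinearMap.id from LinearMap.ext (fr.ofV_toV x hx), map_id,
    AlgHom.id_apply]

/-- The coefficients of a section in a frame. -/
noncomputable def coef {W : Opens S.carrier} (s : S.Sec W) (x : W) : ExteriorAlgebra ℂ (κ → ℂ) :=
  map (fr.toV x) (s.1 x)

theorem map_ofV_coef {W : Opens S.carrier} (h : W ≤ U) (s : S.Sec W) (x : W) :
    map (fr.ofV x) (fr.coef s x) = s.1 x := fr.map_ofV_map_toV (h x.2) _

theorem coef_mul {W : Opens S.carrier} (s t : S.Sec W) (x : W) :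
    fr.coef (s * t) x = fr.coef s x * fr.coef t x := map_mul (map (fr.toV x)) _ _

theorem coef_add {W : Opens S.carrier} (s t : S.Sec W) (x : W) :
    fr.coef (s + t) x = fr.coef s x + fr.coef t x := map_add (map (fr.toV x)) _ _

theorem coef_smul {W : Opens S.carrier} (c : ℂ) (s : S.Sec W) (x : W) :
    fr.coef (c • s) x = c • fr.coef s x := map_smul (map (fr.toV x)) _ _

theorem coef_res {V W : Opens S.carrier} (h : V ≤ W) (s : S.Sec W) (x : V) :
    fr.coef (S.res h s) x = fr.coef s ⟨x, h x.2⟩ := rfl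

theorem coef_injective {W : Opens S.carrier} (h : W ≤ U) {s t : S.Sec W}
    (e : ∀ x, fr.coef s x = fr.coef t x) : s = t :=
  sec_ext fun x => by rw [← fr.map_ofV_coef h s, ← fr.map_ofV_coef h t, e]

theorem degProj_coef {W : Opens S.carrier} (s : S.Sec W) (x : W) (j : ℕ) :
    degProj j (fr.coef s x) = map (fr.toV x) (S.comp x j (s.1 x)) :=
  (map_degProj (fr.toV x) j (s.1 x)).symm

theorem comp_eq_zero_iff {W : Opens S.carrier} (h : W ≤ U) (s : S.Sec W) (x : W) (j : ℕ) :
    S.comp x j (s.1 x) = 0 ↔ degProj j (fr.coef s x) = 0 := by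
  rw [degProj_coef]
  refine ⟨fun e => by rw [e, map_zero], fun e => ?_⟩
  rw [← fr.map_ofV_map_toV (h x.2) (S.comp x j (s.1 x)), e, map_zero]

theorem isHolVal_coef_of_mem_genSec {W : Opens S.carrier} (h : W ≤ U) {s : S.RoughSec W}
    (hs : s ∈ S.genSec W) : IsHolVal fun x : W => map (fr.toV x) (s x) := by
  induction hs using Algebra.adjoin_induction with
  | mem s hs =>
    rcases hs with ⟨g, hg, rfl⟩ | ⟨σ, hσ, rfl⟩
    · refine IsHolVal.of_sum (κ := Unit) (g := fun _ => g) (fun _ => hg) (fun _ => 1) fun x => ?_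
      simp [Algebra.algebraMap_eq_smul_one]
    · have h1 : IsHolVal fun x : W => fr.toV x (σ x) := by
        classical
        refine IsHolVal.of_sum (g := fun k x => fr.toV x (σ x) k) (fr.isHol_toV W h σ hσ)
          (fun k => Pi.single k 1) fun x => ?_
        exact pi_eq_sum_univ' _
      refine (h1.map (ι ℂ)).congr fun x => ?_
      rw [map_apply_ι]
  | algebraMap c =>
    have := IsHolVal.const W (algebraMap ℂ (ExteriorAlgebra ℂ (κ → ℂ)) c)
    refine this.congr fun x => ?_
    exact (AlgHom.commutes _ c)
  | add s t _ _ hs ht => exact (hs.add ht).congr fun x => (map_add (map (fr.toV x)) _ _)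
  | mul s t _ _ hs ht => exact (hs.mul ht).congr fun x => (map_mul (map (fr.toV x)) _ _)

theorem isHolVal_coef {W : Opens S.carrier} (h : W ≤ U) (s : S.Sec W) : IsHolVal (fr.coef s) :=
  IsHolVal.of_local fun x hx => by
    obtain ⟨V, hV, hxV, hsV⟩ := s.2 ⟨x, hx⟩
    exact ⟨V, hV, hxV, fr.isHolVal_coef_of_mem_genSec (hV.trans h) hsV⟩

theorem map_ofV_mem_genSec {W : Opens S.carrier} (h : W ≤ U) (a : ExteriorAlgebra ℂ (κ → ℂ)) :
    (fun x : W => map (fr.ofV x) a) ∈ S.genSec W := by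
  induction a using left_induction with
  | algebraMap r =>
    have : (fun x : W => map (fr.ofV x) (algebraMap ℂ _ r)) = algebraMap ℂ (S.RoughSec W) r :=
      funext fun x => AlgHom.commutes _ _
    rw [this]
    exact Subalgebra.algebraMap_mem _ _
  | add a b ha hb =>
    have : (fun x : W => map (fr.ofV x) (a + b)) =
      (fun x : W => map (fr.ofV x) a) + fun x : W => map (fr.ofV x) b :=
      funext fun x => map_add _ _ _
    rw [this]; exact add_mem ha hb
  | ι_mul a v ha =>
    have : (fun x : W => map (fr.ofV x) (ι ℂ v * a)) =
      (fun x : W => ι ℂ (fr.ofV x v)) * fun x : W => map (fr.ofV x) a :=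
      funext fun x => by rw [map_mul, map_apply_ι]; rfl
    rw [this]
    exact mul_mem (Algebra.subset_adjoin (Or.inr ⟨_, (fr.isHol_ofV v).mono h, rfl⟩)) ha

/-- The sections which are constant in a frame. -/
noncomputable def const {W : Opens S.carrier} (h : W ≤ U) :
    ExteriorAlgebra ℂ (κ → ℂ) →ₐ[ℂ] S.Sec W where
  toFun a := ⟨fun x => map (fr.ofV x) a, mem_sec_of_mem_genSec (fr.map_ofV_mem_genSec h a)⟩
  map_one' := sec_ext fun x => map_one (map (fr.ofV x))
  map_mul' a b := sec_ext fun x => map_mul (map (fr.ofV x)) a b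
  map_zero' := sec_ext fun x => map_zero (map (fr.ofV x))
  map_add' a b := sec_ext fun x => map_add (map (fr.ofV x)) a b
  commutes' r := sec_ext fun x => (map (fr.ofV x)).commutes r

theorem const_apply {W : Opens S.carrier} (h : W ≤ U) (a : ExteriorAlgebra ℂ (κ → ℂ)) (x : W) :
    (fr.const h a).1 x = map (fr.ofV x) a := rfl

theorem coef_const {W : Opens S.carrier} (h : W ≤ U) (a : ExteriorAlgebra ℂ (κ → ℂ)) (x : W) :
    fr.coef (fr.const h a) x = a := fr.map_toV_map_ofV (h x.2) a

theorem map_ofV_mem_sec {W : Opens S.carrier} (h : W ≤ U) {f : W → ExteriorAlgebra ℂ (κ → ℂ)}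
    (hf : IsHolVal f) : (fun x : W => map (fr.ofV x) (f x)) ∈ S.Sec W := by
  obtain ⟨g, hg, hgf⟩ := hf.exists_sum
  have : (fun x : W => map (fr.ofV x) (f x)) =
      ((∑ k, ofFun (hg k) * fr.const h (Module.finBasis ℂ _ k) : S.Sec W) : S.RoughSec W) := by
    funext x
    rw [AddSubmonoidClass.coe_finsetSum, Finset.sum_apply, hgf, map_sum]
    refine Finset.sum_congr rfl fun k _ => ?_
    rw [map_smul, Algebra.smul_def]
    rfl
  rw [this]
  exact SetLike.coe_mem _

/-- The section with given coefficients in a frame. -/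
noncomputable def ofCoef {W : Opens S.carrier} (h : W ≤ U) {f : W → ExteriorAlgebra ℂ (κ → ℂ)}
    (hf : IsHolVal f) : S.Sec W := ⟨_, fr.map_ofV_mem_sec h hf⟩

theorem coef_ofCoef {W : Opens S.carrier} (h : W ≤ U) {f : W → ExteriorAlgebra ℂ (κ → ℂ)}
    (hf : IsHolVal f) (x : W) : fr.coef (fr.ofCoef h hf) x = f x := fr.map_toV_map_ofV (h x.2) _

theorem ofCoef_apply {W : Opens S.carrier} (h : W ≤ U) {f : W → ExteriorAlgebra ℂ (κ → ℂ)}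
    (hf : IsHolVal f) (x : W) : (fr.ofCoef h hf).1 x = map (fr.ofV x) (f x) := rfl

theorem coef_ofFun {W : Opens S.carrier} {g : S.carrier → ℂ} (hg : S.IsHolFun W g) (x : W) :
    fr.coef (ofFun hg) x = algebraMap ℂ _ (g x) := (map (fr.toV x)).commutes _

theorem exists_sum {W : Opens S.carrier} (h : W ≤ U) (s : S.Sec W) :
    ∃ g : Fin (Module.finrank ℂ (ExteriorAlgebra ℂ (κ → ℂ))) → S.carrier → ℂ,
      ∃ hg : ∀ k, S.IsHolFun W (g k),
        s = ∑ k, ofFun (hg k) * fr.const h (Module.finBasis ℂ _ k) := by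
  obtain ⟨g, hg, hgf⟩ := (fr.isHolVal_coef h s).exists_sum
  refine ⟨g, hg, sec_ext fun x => ?_⟩
  rw [AddSubmonoidClass.coe_finsetSum, Finset.sum_apply, ← fr.map_ofV_coef h, hgf, map_sum]
  refine Finset.sum_congr rfl fun k _ => ?_
  rw [map_smul, Algebra.smul_def]
  rfl

end Frame

theorem exists_frame_at (p : S.carrier) :
    ∃ (U : Opens S.carrier) (_ : S.Frame U (Fin S.rank)), p ∈ U := by
  let b : Module.Basis (Fin S.rank) ℂ (S.fibre p) :=
    Module.finBasisOfFinrankEq ℂ (S.fibre p) (finrank_fibre p)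
  choose σ hσ hb using fun k => exists_section p (b k)
  obtain ⟨U, -, fr, hp, -⟩ := exists_frame (mem_trivDom p) σ hσ b fun k => (hb k).symm
  exact ⟨U, fr, hp⟩

/-- In a local frame, taking the degree `j` part is a constant linear map on the coefficients, hence
keeps them holomorphic. -/
theorem comp_mem_sec {U : Opens S.carrier} (j : ℕ) (s : S.Sec U) :
    (fun x : U => S.comp x j (s.1 x)) ∈ S.Sec U :=
  mem_sec_of_local fun x hx => by
    obtain ⟨V, fr, hxV⟩ := exists_frame_at x
    refine ⟨V ⊓ U, inf_le_right, ⟨hxV, hx⟩, ?_⟩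
    have h1 := fr.map_ofV_mem_sec inf_le_left
      ((fr.isHolVal_coef inf_le_left (S.res (inf_le_right : V ⊓ U ≤ U) s)).map
        (ExteriorAlgebra.degProj j))
    convert h1 using 1
    funext y
    rw [fr.degProj_coef, fr.map_ofV_map_toV y.2.1]
    rfl

/-- The component of degree `j` of a section. -/
noncomputable def secComp {U : Opens S.carrier} (j : ℕ) (s : S.Sec U) : S.Sec U :=
  ⟨_, comp_mem_sec j s⟩

theorem secComp_apply {U : Opens S.carrier} (j : ℕ) (s : S.Sec U) (x : U) :
    (secComp j s).1 x = S.comp x j (s.1 x) := rfl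

theorem comp_eq_zero_of_rank_lt {j : ℕ} (hj : S.rank < j) (x : S.carrier)
    (a : ExteriorAlgebra ℂ (S.fibre x)) : S.comp x j a = 0 :=
  ExteriorAlgebra.degProj_eq_zero (by rwa [finrank_fibre]) a

theorem hasDegree_ofFun {W : Opens S.carrier} {g : S.carrier → ℂ} (hg : S.IsHolFun W g) :
    HasDegree 0 (ofFun hg) := fun x j hj => ExteriorAlgebra.degProj_algebraMap j hj (g x)

theorem hasDegree_secComp {U : Opens S.carrier} (j : ℕ) (s : S.Sec U) :
    HasDegree j (secComp j s) := fun x i hi => by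
  have := ExteriorAlgebra.degProj_degProj j i (s.1 x)
  rwa [if_neg (Ne.symm hi)] at this

end Supergeometry

/-! ## The cohomology class of a family of local automorphisms -/

namespace SuperEmbedding

open Supergeometry

variable {Y : Supergeometry.{v}} {X : Supergeometry.{u}} (f : SuperEmbedding Y X)

/-- `α` is a family of automorphisms of level `k` carrying `I` to the kernel ideal. -/
def IsStraightening (k : ℕ) (I : X.IdealSheaf) (𝔘 : SpaceCover X.carrier)
    (α : ∀ i, X.Aut (𝔘.U i)) : Prop :=
  ∀ i, α i ∈ X.Green k (𝔘.U i) ∧ f.Straightens (α i) I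

variable {f}

/-- `β⁻¹` carries the kernel ideal to `I`, and `α` carries `I` back to the kernel ideal. -/
theorem mul_inv_mem_relGreen {k : ℕ} {I : X.IdealSheaf} {U V T : Opens X.carrier}
    {α : X.Aut U} {β : X.Aut V} (hα : α ∈ X.Green k U) (hαI : f.Straightens α I)
    (hβ : β ∈ X.Green k V) (hβI : f.Straightens β I) (hU : T ≤ U) (hV : T ≤ V) :
    X.autRes hU α * (X.autRes hV β)⁻¹ ∈ f.relGreen k T := by
  have h1 : X.autRes hU α ∈ X.Green k T := fun W hW s => hα W (hW.trans hU) s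
  have h2 : X.autRes hV β ∈ X.Green k T := fun W hW s => hβ W (hW.trans hV) s
  refine ⟨mul_mem h1 (inv_mem h2), fun W hW s => ?_⟩
  change act α W (hW.trans hU) ((act β W (hW.trans hV)).symm s) ∈ _ ↔ _
  rw [hαI, ← hβI W (hW.trans hV), AlgEquiv.apply_symm_apply]

theorem mul_inv_mul_mul_inv {G : Type*} [Group G] (a b c : G) :
    a * b⁻¹ * (b * c⁻¹) = a * c⁻¹ := by
  rw [mul_assoc, inv_mul_cancel_left]

theorem oneCocycle_ext {G : (Opens X.carrier)ᵒᵖ ⥤ GrpCat.{w}} {𝔘 : SpaceCover X.carrier}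
    {γ γ' : PresheafOfGroups.OneCocycle G 𝔘.U} (h : γ.toOneCochain = γ'.toOneCochain) :
    γ = γ' := by
  cases γ; cases γ'; cases h; rfl

/-- The cocycle attached to a straightening family. -/
def straighteningCocycle {k : ℕ} {I : X.IdealSheaf} {𝔘 : SpaceCover X.carrier}
    {α : ∀ i, X.Aut (𝔘.U i)} (hα : f.IsStraightening k I 𝔘 α) :
    PresheafOfGroups.OneCocycle (f.greenSheaf k) 𝔘.U where
  ev i j T a b := (⟨X.autRes a.le (α i) * (X.autRes b.le (α j))⁻¹,
    mul_inv_mem_relGreen (hα i).1 (hα i).2 (hα j).1 (hα j).2 a.le b.le⟩ : f.relGreen k T)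
  ev_precomp i j _ _ φ a b := rfl
  ev_trans i j l T a b c := by
    refine Subtype.ext ?_
    change X.autRes a.le (α i) * (X.autRes b.le (α j))⁻¹ *
      (X.autRes b.le (α j) * (X.autRes c.le (α l))⁻¹) = X.autRes a.le (α i) * (X.autRes c.le (α l))⁻¹
    exact mul_inv_mul_mul_inv _ _ _

/-- The pairwise intersections of the members of two covers. -/
def _root_.SpaceCover.inter (𝔘 𝔙 : SpaceCover X.carrier) : SpaceCover X.carrier where
  ι := 𝔘.ι × 𝔙.ι
  U p := 𝔘.U p.1 ⊓ 𝔙.U p.2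
  covers x := by
    obtain ⟨i, hi⟩ := 𝔘.covers x
    obtain ⟨j, hj⟩ := 𝔙.covers x
    exact ⟨(i, j), hi, hj⟩

theorem mk_refineCocycle {G : (Opens X.carrier)ᵒᵖ ⥤ GrpCat.{w}} {𝔙 𝔘 : SpaceCover X.carrier}
    (ρ : 𝔙.Refinement 𝔘) (γ : PresheafOfGroups.OneCocycle G 𝔘.U) :
    CechH1.mk G 𝔙 (refineCocycle G ρ γ) = CechH1.mk G 𝔘 γ :=
  (Quot.sound ⟨ρ, (PresheafOfGroups.OneCocycle.equivalence_isCohomologous _ _).refl _⟩).symm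

theorem mk_eq_of_isCohomologous {G : (Opens X.carrier)ᵒᵖ ⥤ GrpCat.{w}}
    {𝔘 : SpaceCover X.carrier} {γ γ' : PresheafOfGroups.OneCocycle G 𝔘.U}
    (h : γ.IsCohomologous γ') : CechH1.mk G 𝔘 γ = CechH1.mk G 𝔘 γ' :=
  Quot.sound ⟨⟨id, fun _ => le_rfl⟩, h⟩

/-- On the cover by pairwise intersections, the cochain `β α⁻¹` takes values in the relative group
because both families straighten the same `I`. It relates the two cocycles: both sides of the
coboundary relation telescope to `β_p α_q⁻¹`. -/
theorem mk_straighteningCocycle_eq {k : ℕ} {I : X.IdealSheaf} {𝔘 𝔙 : SpaceCover X.carrier}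
    {α : ∀ i, X.Aut (𝔘.U i)} {β : ∀ j, X.Aut (𝔙.U j)} (hα : f.IsStraightening k I 𝔘 α)
    (hβ : f.IsStraightening k I 𝔙 β) :
    CechH1.mk (f.greenSheaf k) 𝔘 (straighteningCocycle hα) =
      CechH1.mk (f.greenSheaf k) 𝔙 (straighteningCocycle hβ) := by
  let ρ : (𝔘.inter 𝔙).Refinement 𝔘 := ⟨Prod.fst, fun _ => inf_le_left⟩
  let ρ' : (𝔘.inter 𝔙).Refinement 𝔙 := ⟨Prod.snd, fun _ => inf_le_right⟩
  rw [← mk_refineCocycle ρ, ← mk_refineCocycle ρ']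
  refine mk_eq_of_isCohomologous ⟨fun p =>
    (⟨X.autRes inf_le_right (β p.2) * (X.autRes inf_le_left (α p.1))⁻¹,
      mul_inv_mem_relGreen (hβ p.2).1 (hβ p.2).2 (hα p.1).1 (hα p.1).2 _ _⟩ :
      f.relGreen k (𝔘.U p.1 ⊓ 𝔙.U p.2)), fun p q T a b => ?_⟩
  refine Subtype.ext ?_
  change X.autRes (a.le.trans inf_le_right) (β p.2) *
      (X.autRes (a.le.trans inf_le_left) (α p.1))⁻¹ *
      (X.autRes (a.le.trans inf_le_left) (α p.1) * (X.autRes (b.le.trans inf_le_left) (α q.1))⁻¹) =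
    X.autRes (a.le.trans inf_le_right) (β p.2) * (X.autRes (b.le.trans inf_le_right) (β q.2))⁻¹ *
      (X.autRes (b.le.trans inf_le_right) (β q.2) * (X.autRes (b.le.trans inf_le_left) (α q.1))⁻¹)
  exact (mul_inv_mul_mul_inv _ _ _).trans (mul_inv_mul_mul_inv _ _ _).symm

theorem map_mk_straighteningCocycle {k : ℕ} {I : X.IdealSheaf} {𝔘 : SpaceCover X.carrier}
    {α : ∀ i, X.Aut (𝔘.U i)} (hα : f.IsStraightening (k + 1) I 𝔘 α)
    (hα' : f.IsStraightening k I 𝔘 α) :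
    CechH1.map (f.greenIncl k) (CechH1.mk _ 𝔘 (straighteningCocycle hα)) =
      CechH1.mk _ 𝔘 (straighteningCocycle hα') := rfl

theorem Green_succ_le (k : ℕ) (U : Opens X.carrier) : X.Green (k + 1) U ≤ X.Green k U :=
  fun _ h W hW s x j hj => h W hW s x j (hj.trans (Nat.lt_succ_self k))

theorem isStraightening_one (k : ℕ) :
    f.IsStraightening k f.kernelIdeal (SpaceCover.trivial X.carrier) (fun _ => 1) :=
  fun _ => ⟨one_mem _, fun _ _ _ => Iff.rfl⟩

theorem mk_straighteningCocycle_one (k : ℕ) :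
    CechH1.mk (f.greenSheaf k) (SpaceCover.trivial X.carrier)
      (straighteningCocycle (isStraightening_one k)) = CechH1.base (f.greenSheaf k) := by
  refine congrArg (CechH1.mk _ _) ?_
  refine oneCocycle_ext ?_
  refine PresheafOfGroups.OneCochain.ext ?_
  funext i j T a b
  refine Subtype.ext ?_
  exact mul_inv_cancel (1 : X.Aut T)

open Classical in
/-- The map `Φ`, given that straightening families exist. -/
noncomputable def obstructionMap (f : SuperEmbedding Y X) (k : ℕ) (p : f.GeneratedIdeals k) :
    CechH1 (f.greenSheaf k) :=
  if h : ∃ (𝔘 : SpaceCover X.carrier) (α : ∀ i, X.Aut (𝔘.U i)),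
      f.IsStraightening k p.1.1 𝔘 α then
    CechH1.mk _ h.choose (straighteningCocycle h.choose_spec.choose_spec)
  else CechH1.base _

theorem obstructionMap_eq {k : ℕ} (p : f.GeneratedIdeals k) {𝔘 : SpaceCover X.carrier}
    {α : ∀ i, X.Aut (𝔘.U i)} (hα : f.IsStraightening k p.1.1 𝔘 α) :
    f.obstructionMap k p = CechH1.mk _ 𝔘 (straighteningCocycle hα) := by
  have h : ∃ (𝔘 : SpaceCover X.carrier) (α : ∀ i, X.Aut (𝔘.U i)),
      f.IsStraightening k p.1.1 𝔘 α := ⟨𝔘, α, hα⟩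
  rw [obstructionMap, dif_pos h]
  exact mk_straighteningCocycle_eq _ _

/-- The main statement, given the local existence of straightening automorphisms. -/
theorem exists_obstructionMap (Fhat : f.GeneratorSystem f.kernelIdeal)
    (hFhat : Fhat.maxSplittingDegree = ⊤) (hker : f.IsEmbeddingIdeal f.kernelIdeal)
    (hloc : ∀ k, 2 ≤ k → ∀ (p : f.GeneratedIdeals k) (x : X.carrier),
      ∃ (U : Opens X.carrier) (α : X.Aut U), x ∈ U ∧ α ∈ X.Green k U ∧ f.Straightens α p.1.1 ∧
        CarriesGenerators α p.1.2 Fhat) :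
    ∃ Φ : ∀ k : ℕ, f.GeneratedIdeals k → CechH1 (f.greenSheaf k), ∀ k : ℕ, 2 ≤ k →
      (∃ h, Φ k ⟨⟨f.kernelIdeal, Fhat⟩, h⟩ = CechH1.base (f.greenSheaf k)) ∧
      (∀ p : f.GeneratedIdeals (k + 1),
        Φ k (SuperEmbedding.GeneratedIdeals.incl f k p) =
          CechH1.map (f.greenIncl k) (Φ (k + 1) p)) ∧
      ∀ p : f.GeneratedIdeals k,
        (∃ (𝔘 : SpaceCover X.carrier) (α : ∀ i, X.Aut (𝔘.U i)), ∀ i,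
          α i ∈ X.Green k (𝔘.U i) ∧ f.Straightens (α i) p.1.1 ∧
            SuperEmbedding.CarriesGenerators (α i) p.1.2 Fhat) ∧
        ∀ (𝔘 : SpaceCover X.carrier) (α : ∀ i, X.Aut (𝔘.U i)),
          (∀ i, α i ∈ X.Green k (𝔘.U i) ∧ f.Straightens (α i) p.1.1) →
          ∃ γ : CategoryTheory.PresheafOfGroups.OneCocycle (f.greenSheaf k) 𝔘.U,
            (∀ (i j : 𝔘.ι) (T : TopologicalSpace.Opens X.carrier)
              (a : T ⟶ 𝔘.U i) (b : T ⟶ 𝔘.U j),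
              f.greenToAut (γ.ev i j a b) =
                X.autRes a.le (α i) * (X.autRes b.le (α j))⁻¹) ∧
            Φ k p = CechH1.mk (f.greenSheaf k) 𝔘 γ := by
  have hcov : ∀ k, 2 ≤ k → ∀ p : f.GeneratedIdeals k,
      ∃ (𝔘 : SpaceCover X.carrier) (α : ∀ i, X.Aut (𝔘.U i)), ∀ i,
          α i ∈ X.Green k (𝔘.U i) ∧ f.Straightens (α i) p.1.1 ∧
            SuperEmbedding.CarriesGenerators (α i) p.1.2 Fhat := by
    intro k hk p
    choose U α hx h using hloc k hk p
    exact ⟨⟨X.carrier, U, fun x => ⟨x, hx x⟩⟩, α, h⟩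
  refine ⟨f.obstructionMap, fun k hk => ⟨⟨⟨hker, ?_⟩, ?_⟩, fun p => ?_, fun p =>
    ⟨hcov k hk p, fun 𝔘 α hα => ⟨straighteningCocycle hα, fun _ _ _ _ _ => rfl,
      obstructionMap_eq p hα⟩⟩⟩⟩
  · change (k : ℕ∞) ≤ Fhat.maxSplittingDegree
    rw [hFhat]; exact le_top
  · exact (obstructionMap_eq _ (isStraightening_one k)).trans (mk_straighteningCocycle_one k)
  -- A family of level `k + 1` is also one of level `k`, so a single family computes the classes at
  -- both levels.
  · obtain ⟨𝔘, α, h⟩ := hcov (k + 1) (by omega) p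
    have hα : f.IsStraightening (k + 1) p.1.1 𝔘 α := fun i => ⟨(h i).1, (h i).2.1⟩
    have hα' : f.IsStraightening k p.1.1 𝔘 α := fun i => ⟨Green_succ_le k _ (h i).1, (h i).2.1⟩
    rw [obstructionMap_eq p hα, map_mk_straighteningCocycle hα hα']
    exact obstructionMap_eq (SuperEmbedding.GeneratedIdeals.incl f k p) hα'

end SuperEmbedding

/-! ## Exponentials of nilpotent derivations -/

section DerExp

variable {B : Type*} [Ring B] [Algebra ℂ B]

/-- The exponential series of an endomorphism, cut off at `N`. -/
noncomputable def expSum (N : ℕ) (D : B →ₗ[ℂ] B) : B →ₗ[ℂ] B :=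
  ∑ i ∈ Finset.range N, (i.factorial : ℂ)⁻¹ • D ^ i

theorem expSum_apply (N : ℕ) (D : B →ₗ[ℂ] B) (x : B) :
    expSum N D x = ∑ i ∈ Finset.range N, (i.factorial : ℂ)⁻¹ • (D ^ i) x := by
  simp [expSum]

/-- The exponential of a nilpotent derivation is multiplicative by the binomial formula for `D ^ n
(x * y)`, and the exponential of `-D` inverts it. -/
theorem exists_algEquiv_expSum {N : ℕ} {D : B →ₗ[ℂ] B}
    (hD : ∀ x y, D (x * y) = x * D y + D x * y) (hN : D ^ N = 0) :
    ∃ e : B ≃ₐ[ℂ] B, (∀ x, e x = expSum N D x) ∧ ∀ x, e.symm x = expSum N (-D) x := by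
  -- `IsNilpotent.exp` is formed with rational coefficients. Restriction of scalars along `ℚ → ℂ`
  -- makes it agree with `expSum`.
  let m : Module ℚ B := Module.compHom B (algebraMap ℚ ℂ)
  have hsmul : ∀ (q : ℚ) (x : B), q • x = (q : ℂ) • x := fun q x => by
    change (algebraMap ℚ ℂ q) • x = _
    rw [eq_ratCast]
  have hnil : IsNilpotent (D : Module.End ℂ B) := ⟨N, hN⟩
  have hN' : (-D : Module.End ℂ B) ^ N = 0 := by
    rw [← neg_one_smul ℂ D, smul_pow, hN, smul_zero]
  have hexp : ∀ (D' : Module.End ℂ B), D' ^ N = 0 → ∀ x, IsNilpotent.exp D' x = expSum N D' x := by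
    intro D' h x
    rw [IsNilpotent.exp_eq_sum h, expSum_apply, LinearMap.sum_apply]
    refine Finset.sum_congr rfl fun i _ => ?_
    rw [LinearMap.smul_apply, hsmul]
    push_cast
    rfl
  have hl : ∀ x, expSum N (-D) (expSum N D x) = x := fun x => by
    rw [← hexp D hN, ← hexp (-D) hN', ← Module.End.mul_apply, hnil.exp_neg_mul_exp_self,
      Module.End.one_apply]
  have hr : ∀ x, expSum N D (expSum N (-D) x) = x := fun x => by
    rw [← hexp D hN, ← hexp (-D) hN', ← Module.End.mul_apply, hnil.exp_mul_exp_neg_self,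
      Module.End.one_apply]
  have hmul : ∀ x y, expSum N D (x * y) = expSum N D x * expSum N D y := fun x y => by
    simp only [← hexp D hN]
    exact Module.End.exp_mul_of_derivation ℂ B D hD hnil x y
  -- A multiplicative map that attains the value `1` sends `1` to `1`; here the value is attained at
  -- `expSum N (-D) 1`.
  have hone : expSum N D 1 = 1 := by
    have := hmul 1 (expSum N (-D) 1)
    rwa [one_mul, hr, mul_one, eq_comm] at this
  exact ⟨AlgEquiv.ofLinearEquiv ⟨expSum N D, expSum N (-D), hl, hr⟩ hone hmul,
    fun _ => rfl, fun _ => rfl⟩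

end DerExp

/-! ### Derivations that raise the fermionic filtration, and their exponentials. -/

namespace Supergeometry

variable {S : Supergeometry.{u}}

/-- The sections in the `k`-th power of the fermionic ideal. -/
def jSub (k : ℕ) (U : Opens S.carrier) : Submodule ℂ (S.Sec U) where
  carrier := {s | InJ k s}
  add_mem' {s t} hs ht x j hj := by
    change ExteriorAlgebra.degProj j (s.1 x + t.1 x) = 0
    rw [map_add]
    exact (congrArg₂ (· + ·) (hs x j hj) (ht x j hj)).trans (add_zero 0)
  zero_mem' x j _ := map_zero (ExteriorAlgebra.degProj j)
  smul_mem' c s hs x j hj := by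
    change ExteriorAlgebra.degProj j (c • s.1 x) = 0
    rw [map_smul]
    exact (congrArg (c • ·) (hs x j hj)).trans (smul_zero c)

theorem mem_jSub {k : ℕ} {U : Opens S.carrier} {s : S.Sec U} : s ∈ jSub k U ↔ InJ k s := Iff.rfl

/-- The sections of given parity. -/
def paritySub (ε : Fin 2) (U : Opens S.carrier) : Submodule ℂ (S.Sec U) where
  carrier := {s | HasParity ε s}
  add_mem' {s t} hs ht x j hj := by
    change ExteriorAlgebra.degProj j (s.1 x + t.1 x) = 0
    rw [map_add]
    exact (congrArg₂ (· + ·) (hs x j hj) (ht x j hj)).trans (add_zero 0)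
  zero_mem' x j _ := map_zero (ExteriorAlgebra.degProj j)
  smul_mem' c s hs x j hj := by
    change ExteriorAlgebra.degProj j (c • s.1 x) = 0
    rw [map_smul]
    exact (congrArg (c • ·) (hs x j hj)).trans (smul_zero c)

theorem mem_paritySub {ε : Fin 2} {U : Opens S.carrier} {s : S.Sec U} :
    s ∈ paritySub ε U ↔ HasParity ε s := Iff.rfl

theorem InJ.eq_zero {k : ℕ} {U : Opens S.carrier} {s : S.Sec U} (hs : InJ k s)
    (hk : S.rank < k) : s = 0 := sec_ext fun x => ExteriorAlgebra.eq_zero_of_degProj fun j => by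
  by_cases hj : j < k
  · exact hs x j hj
  · exact comp_eq_zero_of_rank_lt (by omega) _ _

theorem InJ.mono {k l : ℕ} {U : Opens S.carrier} {s : S.Sec U} (hs : InJ k s) (h : l ≤ k) :
    InJ l s := fun x j hj => hs x j (hj.trans_le h)

theorem InJ.res {k : ℕ} {W U : Opens S.carrier} (h : W ≤ U) {s : S.Sec U} (hs : InJ k s) :
    InJ k (S.res h s) := fun x j hj => hs ⟨x, h x.2⟩ j hj

theorem HasParity.res {ε : Fin 2} {W U : Opens S.carrier} (h : W ≤ U) {s : S.Sec U}
    (hs : HasParity ε s) : HasParity ε (S.res h s) := fun x j hj => hs ⟨x, h x.2⟩ j hj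

theorem inJ_zero {U : Opens S.carrier} (s : S.Sec U) : InJ 0 s := fun _ j hj => absurd hj (by omega)

variable (S) in
/-- A nilpotent derivation of degree `k` of the sheaf of exterior algebras over `U`. -/
structure GreenDer (k : ℕ) (U : Opens S.carrier) where
  D : ∀ W : Opens S.carrier, W ≤ U → S.Sec W →ₗ[ℂ] S.Sec W
  leibniz : ∀ W h s t, D W h (s * t) = s * D W h t + D W h s * t
  D_res : ∀ {W' W : Opens S.carrier} (h' : W' ≤ W) (h : W ≤ U) (s : S.Sec W),
    S.res h' (D W h s) = D W' (h'.trans h) (S.res h' s)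
  parity : ∀ W h (ε : Fin 2) (s : S.Sec W), HasParity ε s → HasParity ε (D W h s)
  inJ : ∀ W h (s : S.Sec W), InJ k (D W h s)
  raise : ∀ W h j (s : S.Sec W), InJ j s → InJ (j + 1) (D W h s)

namespace GreenDer

variable {k : ℕ} {U : Opens S.carrier} (δ : S.GreenDer k U)

theorem pow_inJ {W : Opens S.carrier} (h : W ≤ U) (n j : ℕ) (s : S.Sec W) (hs : InJ j s) :
    InJ (j + n) ((δ.D W h ^ n) s) := by
  induction n with
  | zero => simpa using hs
  | succ n ih => rw [pow_succ', Module.End.mul_apply]; exact δ.raise W h _ _ ih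

/-- Each application moves one step down the filtration by the `J^j`, and no component of degree
above `rank` exists. -/
theorem pow_rank_succ {W : Opens S.carrier} (h : W ≤ U) : δ.D W h ^ (S.rank + 1) = 0 :=
  LinearMap.ext fun s => (δ.pow_inJ h (S.rank + 1) 0 s (inJ_zero s)).eq_zero (by omega)

theorem pow_res {W' W : Opens S.carrier} (h' : W' ≤ W) (h : W ≤ U) (n : ℕ) (s : S.Sec W) :
    S.res h' ((δ.D W h ^ n) s) = (δ.D W' (h'.trans h) ^ n) (S.res h' s) := by
  induction n with
  | zero => rfl
  | succ n ih => rw [pow_succ', pow_succ', Module.End.mul_apply, Module.End.mul_apply, δ.D_res, ih]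

theorem pow_parity {W : Opens S.carrier} (h : W ≤ U) (n : ℕ) (ε : Fin 2) (s : S.Sec W)
    (hs : HasParity ε s) : HasParity ε ((δ.D W h ^ n) s) := by
  induction n with
  | zero => exact hs
  | succ n ih => rw [pow_succ', Module.End.mul_apply]; exact δ.parity W h _ _ ih

theorem expSum_res {W' W : Opens S.carrier} (h' : W' ≤ W) (h : W ≤ U) (N : ℕ) (s : S.Sec W) :
    S.res h' (expSum N (δ.D W h) s) = expSum N (δ.D W' (h'.trans h)) (S.res h' s) := by
  simp only [expSum_apply, map_sum, map_smul, δ.pow_res]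

theorem expSum_parity {W : Opens S.carrier} (h : W ≤ U) (N : ℕ) (ε : Fin 2) (s : S.Sec W)
    (hs : HasParity ε s) : HasParity ε (expSum N (δ.D W h) s) := by
  rw [expSum_apply, ← mem_paritySub]
  exact sum_mem fun i _ => Submodule.smul_mem _ _ (δ.pow_parity h i ε s hs)

theorem expSum_neg_parity {W : Opens S.carrier} (h : W ≤ U) (N : ℕ) (ε : Fin 2) (s : S.Sec W)
    (hs : HasParity ε s) : HasParity ε (expSum N (-δ.D W h) s) := by
  rw [expSum_apply, ← mem_paritySub]
  refine sum_mem fun i _ => Submodule.smul_mem _ _ ?_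
  have : (-δ.D W h) ^ i = (-1 : ℂ) ^ i • δ.D W h ^ i := by
    rw [← neg_one_smul ℂ (δ.D W h), smul_pow]
  rw [this, LinearMap.smul_apply]
  exact Submodule.smul_mem _ _ (δ.pow_parity h i ε s hs)

/-- The terms of order at least two apply `D` again to `D s`, which is already in `J^k`, and each
further application gains a degree. The cut-off `N + 2` ensures that the terms of order zero and one
are present. -/
theorem expSum_sub_inJ {W : Opens S.carrier} (h : W ≤ U) (N : ℕ) (s : S.Sec W) :
    InJ (k + 1) (expSum (N + 2) (δ.D W h) s - s - δ.D W h s) := by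
  rw [expSum_apply, ← mem_jSub, Finset.sum_range_succ', Finset.sum_range_succ']
  have : ∀ i, (δ.D W h ^ (i + 1 + 1)) s ∈ jSub (k + 1) W := fun i => by
    rw [pow_succ, pow_succ', Module.End.mul_apply, Module.End.mul_apply, mem_jSub]
    refine (δ.raise W h (k + i) _ (δ.pow_inJ h i k _ (δ.inJ W h s))).mono (by omega)
  simp only [zero_add, Nat.factorial_one, Nat.factorial_zero, Nat.cast_one, inv_one, pow_one,
    pow_zero, one_smul, Module.End.one_apply]
  rw [add_sub_cancel_right, add_sub_cancel_right]
  exact sum_mem fun i _ => Submodule.smul_mem _ _ (this i)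

/-- The exponential of a derivation lies in Green's group. -/
theorem exists_exp : ∃ β ∈ S.Green k U, ∀ W h (s : S.Sec W),
    InJ (k + 1) (act β W h s - s - δ.D W h s) := by
  -- The exponent is one more than nilpotency needs, so that the cut-off has the form `N + 2` even
  -- in rank zero.
  have hN : ∀ W h, δ.D W h ^ (S.rank + 2) = 0 := fun W h => by
    rw [pow_succ', δ.pow_rank_succ h, mul_zero]
  choose e he he' using fun W : {W : Opens S.carrier // W ≤ U} =>
    exists_algEquiv_expSum (δ.leibniz W.1 W.2) (hN W.1 W.2)
  have hsub : ∀ W h (s : S.Sec W), InJ (k + 1) (e ⟨W, h⟩ s - s - δ.D W h s) := fun W h s => by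
    rw [he]; exact δ.expSum_sub_inJ h _ s
  refine ⟨⟨e, fun W' W h s => ?_, fun W ε s => ⟨fun h => ?_, fun h => ?_⟩⟩, fun W h s => ?_, hsub⟩
  · rw [he, he]; exact δ.expSum_res h W.2 _ s
  -- That parity is reflected follows from parity preservation by the inverse, the exponential of
  -- `-D`.
  · rw [← (e W).symm_apply_apply s, he']
    exact δ.expSum_neg_parity W.2 _ ε _ h
  · rw [he]; exact δ.expSum_parity W.2 _ ε _ h
  · have := add_mem (mem_jSub.2 ((hsub W h s).mono (Nat.le_succ k)))
      (mem_jSub.2 (δ.inJ W h s))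
    rwa [sub_add_cancel] at this

end GreenDer

end Supergeometry

/-! ## Derivations of the sheaf of exterior algebras -/

namespace Supergeometry

variable {S : Supergeometry.{u}}

variable (S) in
/-- A derivation of the sheaf of holomorphic functions over `U`. -/
structure HolDer (U : Opens S.carrier) where
  d : (S.carrier → ℂ) → S.carrier → ℂ
  hol : ∀ W ≤ U, ∀ g, S.IsHolFun W g → S.IsHolFun W (d g)
  add : ∀ W ≤ U, ∀ g h, S.IsHolFun W g → S.IsHolFun W h → ∀ x ∈ W,
    d (fun x => g x + h x) x = d g x + d h x
  mul : ∀ W ≤ U, ∀ g h, S.IsHolFun W g → S.IsHolFun W h → ∀ x ∈ W,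
    d (fun x => g x * h x) x = g x * d h x + d g x * h x
  const : ∀ c, ∀ x ∈ U, d (fun _ => c) x = 0
  congr : ∀ W ≤ U, ∀ g h, (∀ x ∈ W, g x = h x) → ∀ x ∈ W, d g x = d h x

namespace HolDer

variable {U : Opens S.carrier} (δ : S.HolDer U)

theorem sum_mul {W : Opens S.carrier} (hW : W ≤ U) {κ : Type*} (s : Finset κ)
    {g : κ → S.carrier → ℂ} (hg : ∀ k, S.IsHolFun W (g k)) (c : κ → ℂ) {x : S.carrier}
    (hx : x ∈ W) : δ.d (fun x => ∑ k ∈ s, g k x * c k) x = ∑ k ∈ s, δ.d (g k) x * c k := by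
  classical
  induction s using Finset.induction_on with
  | empty => simpa using δ.const 0 x (hW hx)
  | insert k s hk ih =>
    simp only [Finset.sum_insert hk]
    rw [δ.add W hW _ _ ((hg k).mul (IsHolFun.const W _))
      (IsHolFun.sum s fun k _ => (hg k).mul (IsHolFun.const W _)) x hx, ih,
      δ.mul W hW _ _ (hg k) (IsHolFun.const W _) x hx, δ.const _ x (hW hx), mul_zero, zero_add]

section Val

variable {A B C : Type*} [AddCommGroup A] [Module ℂ A] [FiniteDimensional ℂ A]
  [AddCommGroup B] [Module ℂ B] [FiniteDimensional ℂ B]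
  [AddCommGroup C] [Module ℂ C] [FiniteDimensional ℂ C]

/-- The action of a derivation on vector valued holomorphic functions. -/
noncomputable def dval {W : Opens S.carrier} (f : W → A) (x : W) : A :=
  ∑ k, δ.d (extZero fun x => (Module.finBasis ℂ A).coord k (f x)) x • Module.finBasis ℂ A k

/-- Frees `dval` from the basis in its definition: tested against functionals, identities for `dval`
become identities between scalar functions. -/
theorem dual_dval {W : Opens S.carrier} (hW : W ≤ U) {f : W → A} (hf : IsHolVal f)
    (ℓ : Module.Dual ℂ A) (x : W) : ℓ (δ.dval f x) = δ.d (extZero fun x => ℓ (f x)) x := by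
  have h1 : ∀ x ∈ W, extZero (fun x => ℓ (f x)) x = ∑ k,
      extZero (fun x => (Module.finBasis ℂ A).coord k (f x)) x * ℓ (Module.finBasis ℂ A k) := by
    intro x hx
    simp only [extZero_apply' _ hx]
    refine (congrArg ℓ ((Module.finBasis ℂ A).sum_repr (f ⟨x, hx⟩))).symm.trans ?_
    rw [map_sum]
    exact Finset.sum_congr rfl fun k _ => by rw [map_smul, smul_eq_mul]; rfl
  rw [δ.congr W hW _ _ h1 x x.2, δ.sum_mul hW Finset.univ (fun k => hf _) _ x.2, dval, map_sum]
  simp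

theorem isHolVal_dval {W : Opens S.carrier} (hW : W ≤ U) {f : W → A} (hf : IsHolVal f) :
    IsHolVal (δ.dval f) :=
  IsHolVal.of_sum (fun _ => δ.hol W hW _ (hf _)) _ fun _ => rfl

theorem dual_ext {a b : A} (h : ∀ ℓ : Module.Dual ℂ A, ℓ a = ℓ b) : a = b :=
  (Module.finBasis ℂ A).ext_elem fun k => h ((Module.finBasis ℂ A).coord k)

theorem dval_map {W : Opens S.carrier} (hW : W ≤ U) {f : W → A} (hf : IsHolVal f)
    (L : A →ₗ[ℂ] B) (x : W) : δ.dval (fun x => L (f x)) x = L (δ.dval f x) :=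
  dual_ext fun ℓ => by
    rw [δ.dual_dval hW (hf.map L), ← LinearMap.comp_apply, δ.dual_dval hW hf]
    rfl

theorem dval_smul {W : Opens S.carrier} (hW : W ≤ U) {f : W → A} (hf : IsHolVal f) (c : ℂ)
    (x : W) : δ.dval (fun x => c • f x) x = c • δ.dval f x := by
  have h := δ.dval_map hW hf (LinearMap.lsmul ℂ A c) x
  simp only [LinearMap.lsmul_apply] at h
  exact h

theorem dval_add {W : Opens S.carrier} (hW : W ≤ U) {f g : W → A} (hf : IsHolVal f)
    (hg : IsHolVal g) (x : W) : δ.dval (fun x => f x + g x) x = δ.dval f x + δ.dval g x :=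
  dual_ext fun ℓ => by
    rw [δ.dual_dval hW (hf.add hg), map_add, δ.dual_dval hW hf, δ.dual_dval hW hg,
      ← δ.add W hW _ _ (hf ℓ) (hg ℓ) x x.2]
    exact δ.congr W hW _ _ (fun y hy => by simp [extZero_apply' _ hy]) x x.2

theorem dval_res {V W : Opens S.carrier} (hW : W ≤ U) (h : V ≤ W) (f : W → A) (x : V) :
    δ.dval (fun y : V => f ⟨y, h y.2⟩) x = δ.dval f ⟨x, h x.2⟩ := by
  refine Finset.sum_congr rfl fun k _ => ?_
  congr 1
  exact δ.congr V (h.trans hW) _ _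
    (fun y hy => by rw [extZero_apply' _ hy, extZero_apply' _ (h hy)]) x x.2

theorem dval_const {W : Opens S.carrier} (hW : W ≤ U) (a : A) (x : W) :
    δ.dval (fun _ : W => a) x = 0 := by
  refine Finset.sum_eq_zero fun k _ => ?_
  rw [δ.congr W hW _ (fun _ => (Module.finBasis ℂ A).coord k a)
    (fun y hy => extZero_apply' _ hy) x x.2, δ.const _ x (hW x.2), zero_smul]

theorem dval_smul_const {W : Opens S.carrier} (hW : W ≤ U) {g : S.carrier → ℂ}
    (hg : S.IsHolFun W g) (a : A) (x : W) :
    δ.dval (fun x : W => g x • a) x = δ.d g x • a := by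
  have hf : IsHolVal fun x : W => g x • a :=
    IsHolVal.of_sum (κ := Unit) (fun _ => hg) (fun _ => a) fun x => by simp
  refine dual_ext fun ℓ => ?_
  rw [δ.dual_dval hW hf, map_smul, smul_eq_mul]
  have h1 := δ.sum_mul hW Finset.univ (fun _ : Unit => hg) (fun _ => ℓ a) x.2
  simp only [Finset.univ_unique, Finset.sum_singleton] at h1
  rw [← h1]
  exact δ.congr W hW _ _ (fun y hy => by simp [extZero_apply' _ hy]) x x.2

theorem dval_sum {W : Opens S.carrier} (hW : W ≤ U) {κ : Type*} (s : Finset κ) {f : κ → W → A}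
    (hf : ∀ k, IsHolVal (f k)) (x : W) :
    δ.dval (fun x => ∑ k ∈ s, f k x) x = ∑ k ∈ s, δ.dval (f k) x := by
  classical
  induction s using Finset.induction_on with
  | empty => simpa using δ.dval_const hW (0 : A) x
  | insert k s hk ih =>
    simp only [Finset.sum_insert hk]
    rw [δ.dval_add hW (hf k) (IsHolVal.sum s fun k _ => hf k), ih]

/-- Only `f` is expanded in a basis. Each term is then a scalar function times a constant linear map
applied to `g`, to which the scalar product rule applies. -/
theorem dval_map₂ {W : Opens S.carrier} (hW : W ≤ U) {f : W → A} (hf : IsHolVal f) {g : W → B}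
    (hg : IsHolVal g) (L : A →ₗ[ℂ] B →ₗ[ℂ] C) (x : W) :
    δ.dval (fun x => L (f x) (g x)) x = L (f x) (δ.dval g x) + L (δ.dval f x) (g x) := by
  obtain ⟨F, hF, hFs⟩ := hf.exists_sum
  have hterm : ∀ k, IsHolVal fun x : W => F k x • L (Module.finBasis ℂ A k) (g x) := fun k => by
    have h1 : IsHolVal fun x : W => F k x • Module.finBasis ℂ A k :=
      IsHolVal.of_sum (κ := Unit) (fun _ => hF k) (fun _ => Module.finBasis ℂ A k) fun x => by simp
    exact (h1.map₂ hg L).congr fun x => by simp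
  have hone : ∀ k, δ.dval (fun x : W => F k x • L (Module.finBasis ℂ A k) (g x)) x =
      F k x • L (Module.finBasis ℂ A k) (δ.dval g x) +
        δ.d (F k) x • L (Module.finBasis ℂ A k) (g x) := fun k => by
    have hLg := hg.map (L (Module.finBasis ℂ A k))
    refine dual_ext fun ℓ => ?_
    rw [δ.dual_dval hW (hterm k), map_add, map_smul, map_smul, ← δ.dval_map hW hg,
      δ.dual_dval hW hLg, smul_eq_mul, smul_eq_mul,
      ← extZero_apply (fun x : W => ℓ (L (Module.finBasis ℂ A k) (g x))) x,
      ← δ.mul W hW _ _ (hF k) (hLg ℓ) x x.2]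
    exact δ.congr W hW _ _ (fun y hy => by simp [extZero_apply' _ hy]) x x.2
  have e1 : (fun x => L (f x) (g x)) =
      fun x : W => ∑ k, F k x • L (Module.finBasis ℂ A k) (g x) := by
    funext x; rw [hFs]; simp [map_sum, LinearMap.sum_apply]
  have e2 : δ.dval f x = ∑ k, δ.d (F k) x • Module.finBasis ℂ A k := by
    rw [show f = fun x : W => ∑ k, F k x • Module.finBasis ℂ A k from funext hFs,
      δ.dval_sum hW _ fun k => IsHolVal.of_sum (κ := Unit) (fun _ => hF k)
        (fun _ => Module.finBasis ℂ A k) fun x => by simp]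
    exact Finset.sum_congr rfl fun k _ => δ.dval_smul_const hW (hF k) _ x
  rw [e1, δ.dval_sum hW _ hterm, Finset.sum_congr rfl fun k _ => hone k, Finset.sum_add_distrib,
    e2, hFs]
  simp [map_sum, LinearMap.sum_apply]

theorem dval_eq_zero {W : Opens S.carrier} (hW : W ≤ U) {f : W → A} (hf : ∀ x, f x = 0) (x : W) :
    δ.dval f x = 0 := by
  rw [show f = fun _ => 0 from funext hf]; exact δ.dval_const hW 0 x

theorem dval_mul {A : Type*} [Ring A] [Algebra ℂ A] [FiniteDimensional ℂ A] {W : Opens S.carrier}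
    (hW : W ≤ U) {f g : W → A} (hf : IsHolVal f) (hg : IsHolVal g) (x : W) :
    δ.dval (fun x => f x * g x) x = f x * δ.dval g x + δ.dval f x * g x :=
  δ.dval_map₂ hW hf hg (LinearMap.mul ℂ A) x

end Val

end HolDer

open ExteriorAlgebra

theorem hasParity_coef_iff {U W : Opens S.carrier} {κ : Type} [Fintype κ] (fr : S.Frame U κ)
    (h : W ≤ U) {ε : Fin 2} {s : S.Sec W} :
    HasParity ε s ↔ ∀ (x : W) j, j % 2 ≠ ε.val → degProj j (fr.coef s x) = 0 :=
  forall₂_congr fun x j => imp_congr_right fun _ => fr.comp_eq_zero_iff h s x j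

theorem inJ_coef_iff {U W : Opens S.carrier} {κ : Type} [Fintype κ] (fr : S.Frame U κ)
    (h : W ≤ U) {k : ℕ} {s : S.Sec W} :
    InJ k s ↔ ∀ (x : W) j, j < k → degProj j (fr.coef s x) = 0 :=
  forall₂_congr fun x j => imp_congr_right fun _ => fr.comp_eq_zero_iff h s x j

/-! ### Derivations with prescribed coefficients in a frame. -/

section FrameDer

variable {U : Opens S.carrier} {κ A J : Type} [Fintype κ] [Fintype A] [Fintype J]
  (fr : S.Frame U κ) (δ : A → S.HolDer U) (d : J → Module.Dual ℂ (κ → ℂ)) (n : A → S.Sec U)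
  (ξ : J → S.Sec U)

/-- The coefficients of the image of a section under the derivation `∑ n δ + ∑ ξ (d ⌋ ·)`. -/
noncomputable def frameDer {W : Opens S.carrier} (h : W ≤ U)
    (f : W → ExteriorAlgebra ℂ (κ → ℂ)) (x : W) : ExteriorAlgebra ℂ (κ → ℂ) :=
  ∑ a, fr.coef (n a) ⟨x, h x.2⟩ * (δ a).dval f x +
    ∑ j, oddDer (d j) (fr.coef (ξ j) ⟨x, h x.2⟩) (f x)

theorem isHolVal_frameDer {W : Opens S.carrier} (h : W ≤ U)
    {f : W → ExteriorAlgebra ℂ (κ → ℂ)} (hf : IsHolVal f) :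
    IsHolVal (frameDer fr δ d n ξ h f) := by
  refine (IsHolVal.sum Finset.univ fun a _ => ?_).add (IsHolVal.sum Finset.univ fun j _ => ?_)
  · exact ((fr.isHolVal_coef le_rfl (n a)).res h).mul ((δ a).isHolVal_dval h hf)
  · exact ((fr.isHolVal_coef le_rfl (ξ j)).res h).mul
      (hf.map (CliffordAlgebra.contractLeft (Q := (0 : QuadraticForm ℂ (κ → ℂ))) (d j)))

/-- The even `n a` commute with everything, so `n a * δ a` is again a derivation; the odd `ξ j` make
`oddDer` one. -/
theorem frameDer_mul (hn : ∀ a, HasParity 0 (n a)) (hξ : ∀ j, HasParity 1 (ξ j))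
    {W : Opens S.carrier} (h : W ≤ U) {f g : W → ExteriorAlgebra ℂ (κ → ℂ)} (hf : IsHolVal f)
    (hg : IsHolVal g) (x : W) : frameDer fr δ d n ξ h (fun x => f x * g x) x =
      f x * frameDer fr δ d n ξ h g x + frameDer fr δ d n ξ h f x * g x := by
  have h1 : ∀ a, fr.coef (n a) ⟨x, h x.2⟩ * (δ a).dval (fun x => f x * g x) x =
      f x * (fr.coef (n a) ⟨x, h x.2⟩ * (δ a).dval g x) +
        fr.coef (n a) ⟨x, h x.2⟩ * (δ a).dval f x * g x := fun a => by
    rw [(δ a).dval_mul h hf hg, mul_add, ← mul_assoc,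
      ← even_comm ((hasParity_coef_iff fr le_rfl).1 (hn a) _) (f x), mul_assoc, mul_assoc]
  have h2 : ∀ j, oddDer (d j) (fr.coef (ξ j) ⟨x, h x.2⟩) (f x * g x) =
      f x * oddDer (d j) (fr.coef (ξ j) ⟨x, h x.2⟩) (g x) +
        oddDer (d j) (fr.coef (ξ j) ⟨x, h x.2⟩) (f x) * g x := fun j =>
    oddDer_mul ((hasParity_coef_iff fr le_rfl).1 (hξ j) _) _ _
  simp only [frameDer, h1, h2, Finset.sum_add_distrib, mul_add, add_mul, Finset.mul_sum,
    Finset.sum_mul]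
  abel

/-- Degree bookkeeping behind parity, `inJ` and `raise`. Contraction lowers degree by one, whence
the `l + 1` in `H2`. It is pointwise, whereas differentiation in `H1` needs the component of `f` to
vanish throughout `W`. -/
theorem degProj_frameDer {W : Opens S.carrier} (h : W ≤ U)
    {f : W → ExteriorAlgebra ℂ (κ → ℂ)} (hf : IsHolVal f) (x : W) (j : ℕ)
    (H1 : ∀ i l, i + l = j → (∀ a, degProj i (fr.coef (n a) ⟨x, h x.2⟩) = 0) ∨
      ∀ y, degProj l (f y) = 0)
    (H2 : ∀ i l, i + l = j → (∀ a, degProj i (fr.coef (ξ a) ⟨x, h x.2⟩) = 0) ∨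
      degProj (l + 1) (f x) = 0) :
    degProj j (frameDer fr δ d n ξ h f x) = 0 := by
  rw [frameDer, map_add, map_sum, map_sum, Finset.sum_eq_zero, Finset.sum_eq_zero, add_zero]
  · intro a _
    rw [oddDer, LinearMap.comp_apply, LinearMap.mulLeft_apply, degProj_mul]
    refine Finset.sum_eq_zero fun il hil => ?_
    rw [degProj_contractLeft]
    rcases H2 il.1 il.2 (Finset.HasAntidiagonal.mem_antidiagonal.1 hil) with e | e
    · rw [e, zero_mul]
    · rw [e, map_zero, mul_zero]
  · intro a _
    rw [degProj_mul]
    refine Finset.sum_eq_zero fun il hil => ?_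
    rcases H1 il.1 il.2 (Finset.HasAntidiagonal.mem_antidiagonal.1 hil) with e | e
    · rw [e, zero_mul]
    · rw [← (δ a).dval_map h hf, (δ a).dval_eq_zero h e, mul_zero]

theorem frameDer_add {W : Opens S.carrier} (h : W ≤ U) {f g : W → ExteriorAlgebra ℂ (κ → ℂ)}
    (hf : IsHolVal f) (hg : IsHolVal g) (x : W) : frameDer fr δ d n ξ h (fun x => f x + g x) x =
      frameDer fr δ d n ξ h f x + frameDer fr δ d n ξ h g x := by
  simp only [frameDer, (δ _).dval_add h hf hg, mul_add, map_add, Finset.sum_add_distrib]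
  abel

theorem frameDer_smul {W : Opens S.carrier} (h : W ≤ U) {f : W → ExteriorAlgebra ℂ (κ → ℂ)}
    (hf : IsHolVal f) (c : ℂ) (x : W) : frameDer fr δ d n ξ h (fun x => c • f x) x =
      c • frameDer fr δ d n ξ h f x := by
  have e : ∀ a, (δ a).dval (fun x => c • f x) x = c • (δ a).dval f x := fun a =>
    (δ a).dval_smul h hf c x
  simp only [frameDer, e, mul_smul_comm, map_smul, ← Finset.smul_sum, ← smul_add]

/-- The derivation `∑ n δ + ∑ ξ (d ⌋ ·)` on sections. -/
noncomputable def frameDerSec {W : Opens S.carrier} (h : W ≤ U) : S.Sec W →ₗ[ℂ] S.Sec W where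
  toFun s := fr.ofCoef h (isHolVal_frameDer fr δ d n ξ h (fr.isHolVal_coef h s))
  map_add' s t := fr.coef_injective h (fun x => by
    rw [fr.coef_add]
    simp only [fr.coef_ofCoef]
    rw [show fr.coef (s + t) = fun x => fr.coef s x + fr.coef t x from funext (fr.coef_add s t)]
    exact frameDer_add fr δ d n ξ h (fr.isHolVal_coef h s) (fr.isHolVal_coef h t) x)
  map_smul' c s := fr.coef_injective h (fun x => by
    rw [RingHom.id_apply, fr.coef_smul]
    simp only [fr.coef_ofCoef]
    rw [show fr.coef (c • s) = fun x => c • fr.coef s x from funext (fr.coef_smul c s)]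
    exact frameDer_smul fr δ d n ξ h (fr.isHolVal_coef h s) c x)

theorem coef_frameDerSec {W : Opens S.carrier} (h : W ≤ U) (s : S.Sec W) (x : W) :
    fr.coef (frameDerSec fr δ d n ξ h s) x = frameDer fr δ d n ξ h (fr.coef s) x :=
  fr.coef_ofCoef h (isHolVal_frameDer fr δ d n ξ h (fr.isHolVal_coef h s)) x

/-- The derivation `∑ n δ + ∑ ξ (d ⌋ ·)` attached to a frame. -/
noncomputable def GreenDer.ofFrame {m : ℕ} (hm : 2 ≤ m) (hn : ∀ a, HasParity 0 (n a))
    (hn' : ∀ a, InJ m (n a)) (hξ : ∀ j, HasParity 1 (ξ j)) (hξ' : ∀ j, InJ m (ξ j)) :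
    S.GreenDer m U where
  D W h := frameDerSec fr δ d n ξ h
  leibniz W h s t := fr.coef_injective h fun x => by
    rw [fr.coef_add, fr.coef_mul, fr.coef_mul]
    simp only [coef_frameDerSec]
    rw [show fr.coef (s * t) = fun x => fr.coef s x * fr.coef t x from funext (fr.coef_mul s t)]
    exact frameDer_mul fr δ d n ξ hn hξ h (fr.isHolVal_coef h s) (fr.isHolVal_coef h t) x
  D_res h' h s := fr.coef_injective (h'.trans h) fun x => by
    rw [fr.coef_res]
    rw [coef_frameDerSec, coef_frameDerSec]
    simp only [frameDer]
    congr 1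
    refine Finset.sum_congr rfl fun a _ => ?_
    rw [← (δ a).dval_res h h']
    rfl
  parity W h ε s hs := by
    rw [hasParity_coef_iff fr h] at hs ⊢
    intro x j hj
    rw [coef_frameDerSec]
    refine degProj_frameDer fr δ d n ξ h (fr.isHolVal_coef h s) x j (fun i l hil => ?_)
      fun i l hil => ?_
    · by_cases hi : i % 2 = 0
      · exact Or.inr fun y => hs y l (by omega)
      · exact Or.inl fun a => (hasParity_coef_iff fr le_rfl).1 (hn a) _ i (by simpa using hi)
    · by_cases hi : i % 2 = 1
      · exact Or.inr (hs x (l + 1) (by omega))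
      · exact Or.inl fun a => (hasParity_coef_iff fr le_rfl).1 (hξ a) _ i (by simpa using hi)
  inJ W h s := by
    rw [inJ_coef_iff fr h]
    intro x j hj
    rw [coef_frameDerSec]
    exact degProj_frameDer fr δ d n ξ h (fr.isHolVal_coef h s) x j
      (fun i l hil => Or.inl fun a => (inJ_coef_iff fr le_rfl).1 (hn' a) _ i (by omega))
      fun i l hil => Or.inl fun a => (inJ_coef_iff fr le_rfl).1 (hξ' a) _ i (by omega)
  -- Here `2 ≤ m` matters: contraction costs one degree and `ξ` supplies at least two, a net gain of
  -- at least one.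
  raise W h k s hs := by
    rw [inJ_coef_iff fr h] at hs ⊢
    intro x j hj
    rw [coef_frameDerSec]
    refine degProj_frameDer fr δ d n ξ h (fr.isHolVal_coef h s) x j (fun i l hil => ?_)
      fun i l hil => ?_
    · by_cases hi : i < m
      · exact Or.inl fun a => (inJ_coef_iff fr le_rfl).1 (hn' a) _ i hi
      · exact Or.inr fun y => hs y l (by omega)
    · by_cases hi : i < m
      · exact Or.inl fun a => (inJ_coef_iff fr le_rfl).1 (hξ' a) _ i hi
      · exact Or.inr (hs x (l + 1) (by omega))

variable {fr δ d n ξ}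

theorem GreenDer.coef_ofFrame {m : ℕ} (hm : 2 ≤ m) (hn : ∀ a, HasParity 0 (n a))
    (hn' : ∀ a, InJ m (n a)) (hξ : ∀ j, HasParity 1 (ξ j)) (hξ' : ∀ j, InJ m (ξ j))
    {W : Opens S.carrier} (h : W ≤ U) (s : S.Sec W) (x : W) :
    fr.coef ((GreenDer.ofFrame fr δ d n ξ hm hn hn' hξ hξ').D W h s) x =
      frameDer fr δ d n ξ h (fr.coef s) x := coef_frameDerSec fr δ d n ξ h s x

theorem GreenDer.ofFrame_ofFun [DecidableEq A] {m : ℕ} (hm : 2 ≤ m) (hn : ∀ a, HasParity 0 (n a))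
    (hn' : ∀ a, InJ m (n a)) (hξ : ∀ j, HasParity 1 (ξ j)) (hξ' : ∀ j, InJ m (ξ j))
    {z : S.carrier → ℂ} (hz : S.IsHolFun U z) (b : A)
    (hb : ∀ a, ∀ x ∈ U, (δ a).d z x = if a = b then 1 else 0) :
    (GreenDer.ofFrame fr δ d n ξ hm hn hn' hξ hξ').D U le_rfl (ofFun hz) = n b := by
  refine fr.coef_injective le_rfl fun x => ?_
  rw [GreenDer.coef_ofFrame, frameDer]
  have e1 : fr.coef (ofFun hz) = fun x : U => z x • (1 : ExteriorAlgebra ℂ (κ → ℂ)) :=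
    funext fun x => by rw [fr.coef_ofFun, Algebra.algebraMap_eq_smul_one]
  have e2 : ∀ a, (δ a).dval (fr.coef (ofFun hz)) x = if a = b then 1 else 0 := fun a => by
    rw [e1, (δ a).dval_smul_const le_rfl hz, hb a x x.2]
    split_ifs <;> simp
  have e3 : ∀ j, oddDer (d j) (fr.coef (ξ j) ⟨x, x.2⟩) (fr.coef (ofFun hz) x) = 0 := fun j => by
    rw [fr.coef_ofFun, oddDer_algebraMap]
  simp only [e2, e3, mul_ite, mul_one, mul_zero, Finset.sum_ite_eq', Finset.mem_univ, if_true,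
    Finset.sum_const_zero, add_zero]

theorem GreenDer.ofFrame_const_ι [DecidableEq J] {m : ℕ} (hm : 2 ≤ m)
    (hn : ∀ a, HasParity 0 (n a)) (hn' : ∀ a, InJ m (n a)) (hξ : ∀ j, HasParity 1 (ξ j))
    (hξ' : ∀ j, InJ m (ξ j)) (v : κ → ℂ) (b : J) (hb : ∀ j, d j v = if j = b then 1 else 0) :
    (GreenDer.ofFrame fr δ d n ξ hm hn hn' hξ hξ').D U le_rfl (fr.const le_rfl (ι ℂ v)) = ξ b := by
  refine fr.coef_injective le_rfl fun x => ?_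
  rw [GreenDer.coef_ofFrame, frameDer]
  have e1 : fr.coef (fr.const le_rfl (ι ℂ v)) = fun _ : U => ι ℂ v :=
    funext fun x => fr.coef_const le_rfl _ x
  simp only [e1, (δ _).dval_const le_rfl, mul_zero, Finset.sum_const_zero, zero_add, oddDer_ι, hb,
    ite_smul, one_smul, zero_smul, Finset.sum_ite_eq', Finset.mem_univ, if_true]

end FrameDer

end Supergeometry

/-! ## Coordinates adapted to a closed submanifold -/

namespace Supergeometry

variable {S : Supergeometry.{u}}

theorem isOpen_chart_symm_preimage (ψ : OpenPartialHomeomorph S.carrier (EuclideanSpace ℂ (Fin S.dim)))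
    (W : Opens S.carrier) : IsOpen (ψ.target ∩ ψ.symm ⁻¹' W) :=
  ψ.isOpen_inter_preimage_symm W.2

theorem IsHolFun.contDiffOn_symm {ψ : OpenPartialHomeomorph S.carrier (EuclideanSpace ℂ (Fin S.dim))}
    (hψ : ψ ∈ IsManifold.maximalAtlas S.model ω S.carrier) {W : Opens S.carrier}
    {g : S.carrier → ℂ} (hg : S.IsHolFun W g) :
    ContDiffOn ℂ ω (g ∘ ψ.symm) (ψ.target ∩ ψ.symm ⁻¹' W) := by
  rw [← contMDiffOn_iff_contDiffOn]
  exact ContMDiffOn.comp hg ((contMDiffOn_symm_of_mem_maximalAtlas hψ).mono Set.inter_subset_left)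
    fun x hx => hx.2

theorem IsHolFun.comp_chart {ψ : OpenPartialHomeomorph S.carrier (EuclideanSpace ℂ (Fin S.dim))}
    (hψ : ψ ∈ IsManifold.maximalAtlas S.model ω S.carrier) {W : Opens S.carrier}
    (hW : (W : Set S.carrier) ⊆ ψ.source) {G : EuclideanSpace ℂ (Fin S.dim) → ℂ}
    (hG : ∀ x ∈ W, AnalyticAt ℂ G (ψ x)) : S.IsHolFun W fun x => G (ψ x) := fun x hx => by
  have h1 : ContMDiffAt 𝓘(ℂ, EuclideanSpace ℂ (Fin S.dim)) 𝓘(ℂ) ω G (ψ x) :=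
    (hG x hx).contDiffAt.contMDiffAt
  have h2 := (contMDiffOn_of_mem_maximalAtlas hψ).contMDiffAt (ψ.open_source.mem_nhds (hW hx))
  exact (h1.comp x h2).contMDiffWithinAt

/-- The derivation given by a constant vector field in a chart. -/
noncomputable def HolDer.ofChart (ψ : OpenPartialHomeomorph S.carrier (EuclideanSpace ℂ (Fin S.dim)))
    (hψ : ψ ∈ IsManifold.maximalAtlas S.model ω S.carrier) {U : Opens S.carrier}
    (hU : (U : Set S.carrier) ⊆ ψ.source) (v : EuclideanSpace ℂ (Fin S.dim)) : S.HolDer U :=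
  have hdiff : ∀ W ≤ U, ∀ g, S.IsHolFun W g → ∀ x ∈ W,
      DifferentiableAt ℂ (g ∘ ψ.symm) (ψ x) := fun W hW g hg x hx =>
    ((hg.contDiffOn_symm hψ).contDiffAt ((isOpen_chart_symm_preimage ψ W).mem_nhds
      ⟨ψ.map_source (hU (hW hx)), by
        rw [Set.mem_preimage, ψ.left_inv (hU (hW hx))]; exact hx⟩)).differentiableAt (by simp)
  { d := fun g x => fderiv ℂ (g ∘ ψ.symm) (ψ x) v
    hol := fun W hW g hg => by
      refine IsHolFun.comp_chart hψ (fun x hx => hU (hW hx))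
        (G := fun t => fderiv ℂ (g ∘ ψ.symm) t v) fun x hx => ?_
      have h1 : ContDiffAt ℂ ω (g ∘ ψ.symm) (ψ x) :=
        (hg.contDiffOn_symm hψ).contDiffAt ((isOpen_chart_symm_preimage ψ W).mem_nhds
          ⟨ψ.map_source (hU (hW hx)), by
            rw [Set.mem_preimage, ψ.left_inv (hU (hW hx))]; exact hx⟩)
      exact ((ContinuousLinearMap.apply ℂ ℂ v).analyticAt _).comp
        (ContDiffAt.analyticAt h1).fderiv
    add := fun W hW g h hg hh x hx =>
      congrArg (fun L => L v) (fderiv_add (hdiff W hW g hg x hx) (hdiff W hW h hh x hx))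
    mul := fun W hW g h hg hh x hx => by
      have h1 := congrArg (fun L => L v)
        (fderiv_mul (hdiff W hW g hg x hx) (hdiff W hW h hh x hx))
      simp only [Function.comp_apply, ψ.left_inv (hU (hW hx)), FunLike.coe_add, Pi.add_apply,
        FunLike.coe_smul, Pi.smul_apply, smul_eq_mul] at h1
      rw [mul_comm (fderiv ℂ (g ∘ ψ.symm) (ψ x) v)]
      exact h1
    const := fun c x _ => by
      have : (fun _ : S.carrier => c) ∘ ψ.symm = fun _ => c := rfl
      rw [this, fderiv_fun_const]; rfl
    congr := fun W hW g h hgh x hx => by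
      have : g ∘ ψ.symm =ᶠ[nhds (ψ x)] h ∘ ψ.symm := by
        filter_upwards [(isOpen_chart_symm_preimage ψ W).mem_nhds
          ⟨ψ.map_source (hU (hW hx)), by
            rw [Set.mem_preimage, ψ.left_inv (hU (hW hx))]; exact hx⟩] with t ht
        exact hgh _ ht.2
      rw [this.fderiv_eq] }

end Supergeometry

namespace SuperEmbedding

open Supergeometry

variable {Y : Supergeometry.{v}} {X : Supergeometry.{u}} (f : SuperEmbedding Y X)

theorem _root_.Supergeometry.IsHolFun.comp_i {W : Opens X.carrier} {g : X.carrier → ℂ}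
    (hg : X.IsHolFun W g) : Y.IsHolFun (f.preim W) fun y => g (f.i y) :=
  ContMDiffOn.comp hg f.isEmbedding.contMDiff.contMDiffOn fun _ hy => hy

/-- Coordinates `z` normal to the submanifold on the open set `U`, the corresponding partial
derivatives, and a retraction. -/
structure NormalCoords (U : Opens X.carrier) (A : Type) [Fintype A] [DecidableEq A] where
  z : A → X.carrier → ℂ
  hol_z : ∀ a, X.IsHolFun U (z a)
  zero_iff : ∀ x ∈ U, (x ∈ Set.range f.i ↔ ∀ a, z a x = 0)
  ρ : X.carrier → Y.carrier
  ρ_i : ∀ y, f.i y ∈ U → ρ (f.i y) = y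
  hol_ρ : ContMDiffOn X.model Y.model ω ρ U
  der : A → X.HolDer U
  der_z : ∀ a b, ∀ x ∈ U, (der a).d (z b) x = if a = b then 1 else 0
  hadamard : ∀ W ≤ U, ∀ g, X.IsHolFun W g → (∀ y, f.i y ∈ W → g (f.i y) = 0) →
    ∀ y, f.i y ∈ W → ∃ V ≤ W, f.i y ∈ V ∧ ∃ G : A → X.carrier → ℂ, (∀ a, X.IsHolFun V (G a)) ∧
      ∀ x ∈ V, g x = ∑ a, G a x * z a x

variable {f} in
/-- Restriction of normal coordinates. -/
def NormalCoords.restrict {U W : Opens X.carrier} {A : Type} [Fintype A] [DecidableEq A]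
    (c : f.NormalCoords U A) (h : W ≤ U) : f.NormalCoords W A where
  z := c.z
  hol_z a := (c.hol_z a).mono h
  zero_iff x hx := c.zero_iff x (h hx)
  ρ := c.ρ
  ρ_i y hy := c.ρ_i y (h hy)
  hol_ρ := c.hol_ρ.mono h
  der a :=
    { d := (c.der a).d
      hol := fun V hV => (c.der a).hol V (hV.trans h)
      add := fun V hV => (c.der a).add V (hV.trans h)
      mul := fun V hV => (c.der a).mul V (hV.trans h)
      const := fun t x hx => (c.der a).const t x (h hx)
      congr := fun V hV => (c.der a).congr V (hV.trans h) }
  der_z a b x hx := c.der_z a b x (h hx)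
  hadamard V hV := c.hadamard V (hV.trans h)

/-- In the charts of an immersion, `i` reads `t ↦ (t, 0)` in a product of the model of `Y` with a
complement. The coordinates of the second component are the `z a`, the first component gives the
retraction `ρ`, constant fields along the complement give the derivations, and
`AnalyticAt.exists_eq_sum_mul` gives the division property. -/
theorem exists_normalCoords (y : Y.carrier) : ∃ (n : ℕ) (U : Opens X.carrier),
    f.i y ∈ U ∧ Nonempty (f.NormalCoords U (Fin n)) := by
  let h := f.isEmbedding.isImmersion.isImmersionAt y
  let φ := h.domChart
  let ψ := h.codChart
  let e := h.equiv
  have hφ : φ ∈ IsManifold.maximalAtlas Y.model ω Y.carrier := h.domChart_mem_maximalAtlas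
  have hψ : ψ ∈ IsManifold.maximalAtlas X.model ω X.carrier := h.codChart_mem_maximalAtlas
  have hsrc : ∀ y ∈ φ.source, f.i y ∈ ψ.source := fun y hy => h.source_subset_preimage_source hy
  have hwr : ∀ y ∈ φ.source, ψ (f.i y) = e (φ y, 0) := fun y hy => by
    have h1 : φ y ∈ (φ.extend Y.model).target := by simpa using φ.map_source hy
    have h2 := h.writtenInCharts h1
    have h3 : ψ (f.i (φ.symm (φ y))) = e (φ y, 0) := h2
    rwa [φ.left_inv hy] at h3
  have : FiniteDimensional ℂ h.complement :=
    FiniteDimensional.of_injective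
      (e.toLinearEquiv.toLinearMap ∘ₗ LinearMap.inr ℂ (EuclideanSpace ℂ (Fin Y.dim)) h.complement)
      (e.injective.comp (Prod.mk_right_injective 0))
  let b := Module.finBasis ℂ h.complement
  let c : X.carrier → EuclideanSpace ℂ (Fin Y.dim) × h.complement := fun x => e.symm (ψ x)
  -- An immersion chart alone does not prevent other parts of `Y` from entering the chart of `X`. As
  -- `i` is a topological embedding, intersecting with `O` leaves only the chart domain of `Y`.
  obtain ⟨O, hO, hOφ⟩ := f.isEmbedding.isEmbedding.isOpen_iff.1 φ.open_source
  have hOi : ∀ y, f.i y ∈ O ↔ y ∈ φ.source := fun y => by rw [← hOφ]; rfl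
  have hcc : ContinuousOn c ψ.source := e.symm.continuous.comp_continuousOn ψ.continuousOn
  let U : Opens X.carrier := ⟨O ∩ (ψ.source ∩ (fun x => (c x).1) ⁻¹' φ.target),
    hO.inter ((continuous_fst.comp_continuousOn hcc).isOpen_inter_preimage ψ.open_source
      φ.open_target)⟩
  have hUψ : (U : Set X.carrier) ⊆ ψ.source := fun x hx => hx.2.1
  have hci : ∀ y ∈ φ.source, c (f.i y) = (φ y, 0) := fun y hy => by
    change e.symm (ψ (f.i y)) = _
    rw [hwr y hy, e.symm_apply_apply]
  have hUi : ∀ y ∈ φ.source, f.i y ∈ U := fun y hy =>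
    ⟨(hOi y).2 hy, hsrc y hy, by
      change (c (f.i y)).1 ∈ φ.target
      rw [hci y hy]; exact φ.map_source hy⟩
  have hψρ : ∀ x ∈ U, ψ (f.i (φ.symm (c x).1)) = e ((c x).1, 0) := fun x hx => by
    have ht : (c x).1 ∈ φ.target := hx.2.2
    rw [hwr _ (φ.map_target ht), φ.right_inv ht]
  let z : Fin (Module.finrank ℂ h.complement) → X.carrier → ℂ := fun a x => b.coord a (c x).2
  let ℓ : Fin (Module.finrank ℂ h.complement) → EuclideanSpace ℂ (Fin X.dim) →L[ℂ] ℂ := fun a =>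
    (LinearMap.toContinuousLinearMap (b.coord a)).comp
      ((ContinuousLinearMap.snd ℂ _ _).comp e.symm.toContinuousLinearMap)
  have hℓ : ∀ a x, z a x = ℓ a (ψ x) := fun a x => rfl
  have hρ : ContMDiffOn X.model Y.model ω (fun x => φ.symm (c x).1) U := by
    have h1 : ContMDiffOn X.model 𝓘(ℂ, EuclideanSpace ℂ (Fin Y.dim)) ω (fun x => (c x).1) U :=
      ((ContinuousLinearMap.fst ℂ _ _).comp
        e.symm.toContinuousLinearMap).contMDiff.comp_contMDiffOn
        ((contMDiffOn_of_mem_maximalAtlas hψ).mono hUψ)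
    exact (contMDiffOn_symm_of_mem_maximalAtlas hφ).comp h1 fun x hx => hx.2.2
  refine ⟨_, U, hUi y h.mem_domChart_source, ⟨
    { z := z
      hol_z := fun a => IsHolFun.comp_chart hψ hUψ fun x _ => (ℓ a).analyticAt _
      zero_iff := fun x hx => ⟨?_, fun hz => ?_⟩
      ρ := fun x => φ.symm (c x).1
      ρ_i := fun y hy => ?_
      hol_ρ := hρ
      der := fun a => HolDer.ofChart ψ hψ hUψ (e (0, b a))
      der_z := fun a a' x hx => ?_
      hadamard := ?_ }⟩⟩
  · rintro ⟨y, rfl⟩ a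
    change b.coord a (c (f.i y)).2 = 0
    rw [hci y ((hOi y).1 hx.1)]
    exact map_zero _
  · have h0 : (c x).2 = 0 := b.ext_elem fun a => by
      rw [map_zero]; exact hz a
    refine ⟨φ.symm (c x).1, ?_⟩
    have ht : (c x).1 ∈ φ.target := hx.2.2
    refine ψ.injOn (hsrc _ (φ.map_target ht)) (hUψ hx) ?_
    rw [hψρ x hx, ← h0]
    exact e.apply_symm_apply (ψ x)
  · have hy' := (hOi y).1 hy.1
    change φ.symm (c (f.i y)).1 = y
    rw [hci y hy', φ.left_inv hy']
  · change fderiv ℂ (z a' ∘ ψ.symm) (ψ x) (e (0, b a)) = _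
    have : z a' ∘ ψ.symm =ᶠ[nhds (ψ x)] ℓ a' := by
      filter_upwards [ψ.open_target.mem_nhds (ψ.map_source (hUψ hx))] with t ht
      rw [Function.comp_apply, hℓ, ψ.right_inv ht]
    rw [this.fderiv_eq, (ℓ a').fderiv]
    change b.coord a' (e.symm (e (0, b a))).2 = _
    rw [e.symm_apply_apply, Module.Basis.coord_apply, Module.Basis.repr_self,
      Finsupp.single_apply]
  · intro W hW g hg hg0 y₀ hy₀
    have hy₀' : y₀ ∈ φ.source := (hOi y₀).1 (hW hy₀).1
    have han : AnalyticAt ℂ (g ∘ ψ.symm) (ψ (f.i y₀)) :=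
      ContDiffAt.analyticAt ((hg.contDiffOn_symm hψ).contDiffAt
        ((isOpen_chart_symm_preimage ψ W).mem_nhds ⟨ψ.map_source (hsrc _ hy₀'), by
          rw [Set.mem_preimage, ψ.left_inv (hsrc _ hy₀')]; exact hy₀⟩))
    -- For these vectors and forms, subtracting `∑ ℓ a h • e (0, b a)` from `h` is the projection
    -- onto the directions tangent to `Y`.
    obtain ⟨K, hK, hev⟩ := han.exists_eq_sum_mul (fun a => e (0, b a)) ℓ
    have hψc : ContinuousAt ψ (f.i y₀) := ψ.continuousAt (hsrc _ hy₀')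
    have hev' : ∀ᶠ x in nhds (f.i y₀), (g ∘ ψ.symm) (ψ (f.i y₀) + (ψ x - ψ (f.i y₀))) -
        (g ∘ ψ.symm) (ψ (f.i y₀) + ((ψ x - ψ (f.i y₀)) -
          ∑ a, ℓ a (ψ x - ψ (f.i y₀)) • e (0, b a))) =
        ∑ a, ℓ a (ψ x - ψ (f.i y₀)) * K a (ψ (f.i y₀) + (ψ x - ψ (f.i y₀))) := by
      refine Filter.Tendsto.eventually (f := fun x => ψ x - ψ (f.i y₀)) ?_ hev
      have := hψc.tendsto.sub_const (ψ (f.i y₀))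
      rwa [sub_self] at this
    -- The vanishing of `g` on `Y` is known only inside `W`, so the retraction of `x` has to stay
    -- there.
    have hρW : ∀ᶠ x in nhds (f.i y₀), f.i (φ.symm (c x).1) ∈ W := by
      have h1 : ContinuousAt (fun x => φ.symm (c x).1) (f.i y₀) :=
        hρ.continuousOn.continuousAt (U.2.mem_nhds (hW hy₀))
      have h2 : ContinuousAt (fun x => f.i (φ.symm (c x).1)) (f.i y₀) :=
        f.isEmbedding.isEmbedding.continuous.continuousAt.comp h1
      refine h2.eventually (W.2.mem_nhds ?_)
      change f.i (φ.symm (c (f.i y₀)).1) ∈ W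
      rw [hci y₀ hy₀', φ.left_inv hy₀']
      exact hy₀
    have hKe : ∀ᶠ x in nhds (f.i y₀), ∀ a, AnalyticAt ℂ (K a) (ψ x) :=
      hψc.eventually (Filter.eventually_all.2 fun a => (hK a).eventually_analyticAt)
    obtain ⟨V, hV, hVo, hyV⟩ := eventually_nhds_iff.1
      (hev'.and (hρW.and (hKe.and (W.2.mem_nhds hy₀))))
    refine ⟨⟨V, hVo⟩, fun x hx => (hV x hx).2.2.2, hyV, fun a x => K a (ψ x),
      fun a => IsHolFun.comp_chart hψ (fun x hx => hUψ (hW (hV x hx).2.2.2))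
        fun x hx => (hV x hx).2.2.1 a, fun x hx => ?_⟩
    obtain ⟨h1, h2, -, h4⟩ := hV x hx
    have hxU := hW h4
    have hz0 : ∀ a, ℓ a (ψ (f.i y₀)) = 0 := fun a => by
      rw [← hℓ]
      change b.coord a (c (f.i y₀)).2 = 0
      rw [hci y₀ hy₀']
      exact map_zero _
    simp only [map_sub, hz0, sub_zero, add_sub_cancel] at h1
    -- The projected point is the chart image of the retraction of `x` to `Y`. There `g` vanishes,
    -- so the difference being divided is `g x` itself.
    have h5 : ψ (f.i y₀) + ((ψ x - ψ (f.i y₀)) - ∑ a, ℓ a (ψ x) • e (0, b a)) =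
        e ((c x).1, 0) := by
      have e1 : ∑ a, ℓ a (ψ x) • e (0, b a) = e (0, (c x).2) := by
        have : ((0 : EuclideanSpace ℂ (Fin Y.dim)), (c x).2) = ∑ a, z a x • (0, b a) := by
          ext1
          · simp [Prod.fst_sum]
          · rw [Prod.snd_sum]
            exact (b.sum_repr (c x).2).symm
        rw [this, map_sum]
        exact Finset.sum_congr rfl fun a _ => (map_smul e _ _).symm
      have e2 : ψ x = e (c x) := (e.apply_symm_apply (ψ x)).symm
      rw [e1, ← add_sub_assoc, add_sub_cancel, e2, ← map_sub]
      congr 1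
      ext1 <;> simp
    rw [h5, ← hψρ x hxU, Function.comp_apply, Function.comp_apply, ψ.left_inv (hUψ hxU),
      ψ.left_inv (hsrc _ (φ.map_target hxU.2.2)), hg0 _ h2, sub_zero] at h1
    rw [h1]
    exact Finset.sum_congr rfl fun a _ => by rw [hℓ, mul_comm]

end SuperEmbedding

/-! ## Local models of embeddings of supergeometries -/

namespace SuperEmbedding

open Supergeometry

variable {Y : Supergeometry.{v}} {X : Supergeometry.{u}} (f : SuperEmbedding Y X)

/-- A fibre vector extends to a section over a trivializing open set of `Y`. This set is the trace
of an open set `O` of `X`, over which surjectivity of sheaves applies. -/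
theorem φ_surjective (y : Y.carrier) : Function.Surjective (f.φ y) := fun t => by
  obtain ⟨τ, hτ, rfl⟩ := exists_section y t
  obtain ⟨O, hO, hOd⟩ := f.isEmbedding.isEmbedding.isOpen_iff.1 (Y.trivDom y).2
  have hOi : ∀ y', f.i y' ∈ O ↔ y' ∈ Y.trivDom y := fun y' => by
    change y' ∈ f.i ⁻¹' O ↔ _
    rw [hOd]; rfl
  obtain ⟨W, σ, -, hy, -, h⟩ := f.surj ⟨O, hO⟩ τ (hτ.mono fun y' hy' => (hOi y').1 hy') (f.i y)
    ((hOi y).2 (mem_trivDom y))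
  exact ⟨_, h y hy⟩

/-- Normal coordinates on `U` together with frames of the odd conormal bundles in which the
surjection `f.φ` is the projection to the components indexed by `B`. -/
structure LocalModel (U : Opens X.carrier) (A B J : Type) [Fintype A] [DecidableEq A] [Fintype B]
    [Fintype J] where
  coords : f.NormalCoords U A
  frX : X.Frame U (B ⊕ J)
  frY : Y.Frame (f.preim U) B
  compat : ∀ y, f.i y ∈ U → ∀ c, f.φ y (frX.ofV (f.i y) c) = frY.ofV y (c ∘ Sum.inl)

theorem exists_basis (y : Y.carrier) : ∃ (n : ℕ) (b : Module.Basis (Fin Y.rank) ℂ (Y.fibre y))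
    (e : Module.Basis (Fin Y.rank ⊕ Fin n) ℂ (X.fibre (f.i y))),
    (∀ k, f.φ y (e (Sum.inl k)) = b k) ∧ ∀ j, f.φ y (e (Sum.inr j)) = 0 := by
  let b : Module.Basis (Fin Y.rank) ℂ (Y.fibre y) :=
    Module.finBasisOfFinrankEq ℂ (Y.fibre y) (finrank_fibre y)
  let k := Module.finBasis ℂ (LinearMap.ker (f.φ y))
  choose g hg using fun i => f.φ_surjective y (b i)
  let e : Fin Y.rank ⊕ Fin (Module.finrank ℂ (LinearMap.ker (f.φ y))) → X.fibre (f.i y) :=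
    Sum.elim g fun j => (k j).1
  have hk : ∀ j, f.φ y (k j).1 = 0 := fun j => (k j).2
  have hli : LinearIndependent ℂ e := by
    rw [Fintype.linearIndependent_iff]
    intro c hc
    simp only [Fintype.sum_sum_type, e, Sum.elim_inl, Sum.elim_inr] at hc
    have h1 : ∀ i, c (Sum.inl i) = 0 := by
      have := congrArg (f.φ y) hc
      simp only [map_add, map_sum, map_smul, hg, hk, smul_zero, Finset.sum_const_zero, add_zero,
        map_zero] at this
      exact Fintype.linearIndependent_iff.1 b.linearIndependent _ this
    have h2 : ∀ j, c (Sum.inr j) = 0 := by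
      simp only [h1, zero_smul, Finset.sum_const_zero, zero_add] at hc
      refine Fintype.linearIndependent_iff.1 k.linearIndependent (fun j => c (Sum.inr j)) ?_
      apply Subtype.ext
      simpa using hc
    rintro (i | j)
    exacts [h1 i, h2 j]
  have hsp : ⊤ ≤ Submodule.span ℂ (Set.range e) := fun v _ => by
    have h1 : v - ∑ i, b.repr (f.φ y v) i • g i ∈ LinearMap.ker (f.φ y) := by
      rw [LinearMap.mem_ker, map_sub, map_sum]
      simp only [map_smul, hg]
      rw [b.sum_repr, sub_self]
    have h2 := congrArg Subtype.val (k.sum_repr ⟨_, h1⟩)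
    have h3 : ∑ i, b.repr (f.φ y v) i • g i ∈ Submodule.span ℂ (Set.range e) :=
      sum_mem fun i _ => Submodule.smul_mem _ _ (Submodule.subset_span ⟨Sum.inl i, rfl⟩)
    have h4 : v - ∑ i, b.repr (f.φ y v) i • g i ∈ Submodule.span ℂ (Set.range e) := by
      change (⟨_, h1⟩ : LinearMap.ker (f.φ y)).1 ∈ _
      rw [← h2, AddSubmonoidClass.coe_finsetSum]
      exact sum_mem fun i _ => Submodule.smul_mem _ _ (Submodule.subset_span ⟨Sum.inr i, rfl⟩)
    simpa using add_mem h4 h3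
  exact ⟨_, b, Module.Basis.mk hli hsp, fun i => by rw [Module.Basis.mk_apply]; exact hg i,
    fun j => by rw [Module.Basis.mk_apply]; exact hk j⟩

/-- A basis of the fibre at `f.i y` adapted to the kernel of `f.φ y` extends to sections `θ`. Those
not in the kernel map to a frame on `Y`; the others are killed only at `y`, and become killed along
`Y` after subtracting combinations of the former. -/
theorem exists_localModel (y : Y.carrier) : ∃ (n m l : ℕ) (U : Opens X.carrier), f.i y ∈ U ∧
    Nonempty (f.LocalModel U (Fin n) (Fin m) (Fin l)) := by
  obtain ⟨n, U₀, hyU₀, ⟨c⟩⟩ := f.exists_normalCoords y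
  obtain ⟨l, b, e, heB, heJ⟩ := f.exists_basis y
  choose θ hθ hθe using fun k => exists_section (f.i y) (e k)
  obtain ⟨V, hV, frY, hyV, hfrY⟩ := exists_frame (S := Y) (p := y)
    (W := f.preim (X.trivDom (f.i y))) (mem_trivDom (f.i y))
    (fun k y' => f.φ y' (θ (Sum.inl k) (f.i y'))) (fun k => f.hol _ _ (hθ _)) b
    (fun k => by rw [hθe, heB])
  obtain ⟨W₁, hW₁, hW₁c⟩ : ∃ W₁ ≤ U₀, f.i y ∈ W₁ ∧ ∀ x ∈ W₁, c.ρ x ∈ V :=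
    ⟨⟨(U₀ : Set X.carrier) ∩ c.ρ ⁻¹' V, c.hol_ρ.continuousOn.isOpen_inter_preimage U₀.2 V.2⟩,
      fun x hx => hx.1, ⟨hyU₀, by rw [Set.mem_preimage, c.ρ_i y hyU₀]; exact hyV⟩,
      fun x hx => hx.2⟩
  let W := W₁ ⊓ X.trivDom (f.i y)
  have hWV : f.preim W ≤ V := fun y' hy' => by
    have := hW₁c.2 _ hy'.1
    rwa [c.ρ_i y' (hW₁ hy'.1)] at this
  let C : Fin l → Fin Y.rank → Y.carrier → ℂ := fun j k y' =>
    frY.toV y' (f.φ y' (θ (Sum.inr j) (f.i y'))) k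
  have hC : ∀ j k, Y.IsHolFun V (C j k) := fun j k =>
    frY.isHol_toV V le_rfl _ ((f.hol _ _ (hθ (Sum.inr j))).mono hV) k
  -- The correcting coefficients live on `Y`; composition with the retraction extends them to `X`.
  have hCρ : ∀ j k, X.IsHolFun W (fun x => C j k (c.ρ x)) := fun j k =>
    ContMDiffOn.comp (hC j k) (c.hol_ρ.mono fun x hx => hW₁ hx.1) fun x hx => hW₁c.2 x hx.1
  let ζ : Fin l → ∀ x, X.fibre x := fun j x =>
    θ (Sum.inr j) x - ∑ k, C j k (c.ρ x) • θ (Sum.inl k) x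
  have hζ : ∀ j, X.IsHolSection W (ζ j) := fun j =>
    ((hθ _).mono inf_le_right).sub (IsHolSection.sum _ fun k _ =>
      IsHolSection.smul (hCρ j k) ((hθ _).mono inf_le_right))
  have hζ0 : ∀ y', f.i y' ∈ W → ∀ j, f.φ y' (ζ j (f.i y')) = 0 := fun y' hy' j => by
    have e1 : c.ρ (f.i y') = y' := c.ρ_i y' (hW₁ hy'.1)
    have e2 : ∀ k, C j k (c.ρ (f.i y')) = C j k y' := fun k => congrArg _ e1
    simp only [ζ, map_sub, map_sum, map_smul, e2]
    change f.φ y' (θ (Sum.inr j) (f.i y')) - ∑ k, frY.toV y' _ k • _ = 0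
    rw [← hfrY, frY.ofV_toV _ (hWV hy'), sub_self]
  obtain ⟨U, hU, frX, hyU, hfrX⟩ := exists_frame (S := X) (p := f.i y) (W := W)
    ⟨hW₁c.1, mem_trivDom _⟩ (Sum.elim (fun k => θ (Sum.inl k)) ζ)
    (by
      rintro (k | j)
      exacts [(hθ _).mono inf_le_right, hζ j]) e
    (by
      rintro (k | j)
      · exact (hθe _).symm
      -- At `y` no correction is needed, so the corrected sections still take the values of the
      -- basis `e`.
      · have h1 : ∀ k, C j k (c.ρ (f.i y)) = 0 := fun k => by
          simp only [C, c.ρ_i y hyU₀, hθe, heJ, map_zero, Pi.zero_apply]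
        simp only [Sum.elim_inr, ζ, h1, zero_smul, Finset.sum_const_zero, sub_zero, hθe])
  refine ⟨n, Y.rank, l, U, hyU, ⟨c.restrict (hU.trans (inf_le_left.trans hW₁)), frX,
    frY.restrict (fun y' hy' => hWV (hU hy')), fun y' hy' t => ?_⟩⟩
  change _ = frY.ofV y' _
  rw [hfrX, hfrY, map_sum, Fintype.sum_sum_type]
  simp only [Sum.elim_inl, Sum.elim_inr, map_smul, hζ0 y' (hU hy'), smul_zero,
    Finset.sum_const_zero, add_zero, Function.comp_apply]

variable {f}

namespace LocalModel

open ExteriorAlgebra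

variable {U : Opens X.carrier} {A B J : Type} [Fintype A] [DecidableEq A] [Fintype B] [Fintype J]
  (M : f.LocalModel U A B J)

variable (B J) in
/-- The projection to the components indexed by `B`. -/
def projB : (B ⊕ J → ℂ) →ₗ[ℂ] (B → ℂ) := LinearMap.funLeft ℂ ℂ Sum.inl

variable (B J) in
/-- The inclusion of the components indexed by `B`. -/
def inclB : (B → ℂ) →ₗ[ℂ] (B ⊕ J → ℂ) where
  toFun c := Sum.elim c 0
  map_add' c d := by
    ext (k | k) <;> simp
  map_smul' c d := by
    ext (k | k) <;> simp

theorem map_φ_ofV {y : Y.carrier} (hy : f.i y ∈ U) (a : ExteriorAlgebra ℂ (B ⊕ J → ℂ)) :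
    map (f.φ y) (map (M.frX.ofV (f.i y)) a) = map (M.frY.ofV y) (map (projB B J) a) := by
  rw [← AlgHom.comp_apply, ← AlgHom.comp_apply, map_comp_map, map_comp_map]
  congr 2
  exact LinearMap.ext fun c => M.compat y hy c

theorem map_φ {W : Opens X.carrier} (hW : W ≤ U) (s : X.Sec W) {y : Y.carrier} (hy : f.i y ∈ W) :
    map (f.φ y) (s.1 ⟨f.i y, hy⟩) =
      map (M.frY.ofV y) (map (projB B J) (M.frX.coef s ⟨f.i y, hy⟩)) := by
  rw [← M.map_φ_ofV (hW hy), ← M.frX.map_ofV_coef hW]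

theorem map_φ_eq_zero_iff {W : Opens X.carrier} (hW : W ≤ U) (s : X.Sec W) {y : Y.carrier}
    (hy : f.i y ∈ W) : map (f.φ y) (s.1 ⟨f.i y, hy⟩) = 0 ↔
      map (projB B J) (M.frX.coef s ⟨f.i y, hy⟩) = 0 := by
  rw [M.map_φ hW]
  refine ⟨fun h => ?_, fun h => by rw [h, map_zero]⟩
  rw [← M.frY.map_toV_map_ofV (hW hy : y ∈ f.preim U) (map (projB B J) _), h, map_zero]

/-- The odd coordinates vanishing on the submanifold. -/
noncomputable def ζ [DecidableEq B] [DecidableEq J] (j : J) : X.Sec U :=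
  M.frX.const le_rfl (ι ℂ (Pi.single (Sum.inr j) 1))

/-- The even coordinates vanishing on the submanifold. -/
def z (a : A) : X.Sec U := ofFun (M.coords.hol_z a)

theorem z_mem (a : A) : M.z a ∈ f.conormal 0 U :=
  ⟨hasDegree_ofFun _, fun y hy => by
    rw [z, ofFun_apply, (M.coords.zero_iff _ hy).1 ⟨y, rfl⟩ a, map_zero, map_zero]⟩

theorem hasDegree_ζ [DecidableEq B] [DecidableEq J] (j : J) : HasDegree 1 (M.ζ j) := fun x k hk => by
  rw [ζ, M.frX.const_apply, map_apply_ι]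
  exact degProj_ι k hk _

theorem ζ_mem [DecidableEq B] [DecidableEq J] (j : J) : M.ζ j ∈ f.conormal 1 U :=
  ⟨M.hasDegree_ζ j, fun y hy => by
    rw [M.map_φ_eq_zero_iff le_rfl, ζ, M.frX.coef_const, map_apply_ι]
    have : projB B J (Pi.single (Sum.inr j) 1) = 0 := by
      ext b
      exact Pi.single_eq_of_ne (i := Sum.inr j) (i' := Sum.inl b) (by simp) (1 : ℂ)
    rw [this, map_zero]⟩

/-- The ideal generated by the coordinates vanishing on the submanifold. -/
def idealSpan [DecidableEq B] [DecidableEq J] (V : Opens X.carrier) (h : V ≤ U) : Ideal (X.Sec V) :=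
  Ideal.span (X.res h '' (Set.range M.z ∪ Set.range M.ζ))

variable [DecidableEq B] [DecidableEq J]

theorem res_z_mem {V : Opens X.carrier} (h : V ≤ U) (a : A) : X.res h (M.z a) ∈ M.idealSpan V h :=
  Ideal.subset_span ⟨_, Or.inl ⟨a, rfl⟩, rfl⟩

theorem res_ζ_mem {V : Opens X.carrier} (h : V ≤ U) (j : J) : X.res h (M.ζ j) ∈ M.idealSpan V h :=
  Ideal.subset_span ⟨_, Or.inr ⟨j, rfl⟩, rfl⟩

theorem res_mem_idealSpan {V W : Opens X.carrier} (hV : V ≤ W) (hW : W ≤ U) {s : X.Sec W}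
    (hs : s ∈ M.idealSpan W hW) : X.res hV s ∈ M.idealSpan V (hV.trans hW) := by
  have : M.idealSpan W hW ≤ (M.idealSpan V (hV.trans hW)).comap (X.res hV) := by
    refine Ideal.span_le.2 ?_
    rintro _ ⟨t, ht, rfl⟩
    exact Ideal.subset_span ⟨t, ht, rfl⟩
  exact this hs

theorem const_sub_mem {W : Opens X.carrier} (hW : W ≤ U) (a : ExteriorAlgebra ℂ (B ⊕ J → ℂ)) :
    M.frX.const hW (a - map (inclB B J ∘ₗ projB B J) a) ∈ M.idealSpan W hW := by
  have h1 := sub_map_mem_span (fun j : J => (Pi.single (Sum.inr j) 1 : B ⊕ J → ℂ))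
    (inclB B J ∘ₗ projB B J) (fun v => by
      have : v - (inclB B J ∘ₗ projB B J) v =
          ∑ j, v (Sum.inr j) • (Pi.single (Sum.inr j) 1 : B ⊕ J → ℂ) := by
        ext (k | k)
        · simp [inclB, projB, LinearMap.funLeft]
        · simp [inclB, Finset.sum_apply, Pi.single_apply]
      rw [this]
      exact sum_mem fun j _ => Submodule.smul_mem _ _ (Submodule.subset_span ⟨j, rfl⟩)) a
  have h2 : Ideal.span (Set.range fun j : J => ι ℂ (Pi.single (Sum.inr j) 1 : B ⊕ J → ℂ)) ≤
      (M.idealSpan W hW).comap (M.frX.const hW) := by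
    refine Ideal.span_le.2 ?_
    rintro _ ⟨j, rfl⟩
    exact M.res_ζ_mem hW j
  exact h2 h1

/-- Functions vanishing on `Y` are locally combinations of the `z a`. Finitely many coefficients
allow a common neighbourhood. -/
theorem exists_mem_idealSpan {W : Opens X.carrier} (hW : W ≤ U) {κ : Type*} [Fintype κ]
    {g : κ → X.carrier → ℂ} (hg : ∀ k, X.IsHolFun W (g k)) (t : κ → X.Sec W)
    (h0 : ∀ k y, f.i y ∈ W → g k (f.i y) = 0) {y : Y.carrier} (hy : f.i y ∈ W) :
    ∃ (V : Opens X.carrier) (hV : V ≤ W), f.i y ∈ V ∧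
      X.res hV (∑ k, ofFun (hg k) * t k) ∈ M.idealSpan V (hV.trans hW) := by
  choose V hV hyV G hG hGz using fun k => M.coords.hadamard W hW (g k) (hg k) (h0 k) y hy
  let V' : Opens X.carrier := W ⊓ ⟨⋂ k, V k, isOpen_iInter_of_finite fun k => (V k).2⟩
  have hV'k : ∀ k, V' ≤ V k := fun k x hx => Set.mem_iInter.1 hx.2 k
  refine ⟨V', inf_le_left, ⟨hy, Set.mem_iInter.2 hyV⟩, ?_⟩
  rw [map_sum]
  refine sum_mem fun k _ => ?_
  have h1 : X.res (inf_le_left : V' ≤ W) (ofFun (hg k) * t k) =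
      ∑ a, (X.res inf_le_left (t k) * ofFun ((hG k a).mono (hV'k k))) *
        X.res (inf_le_left.trans hW) (M.z a) := sec_ext fun x => by
    rw [AddSubmonoidClass.coe_finsetSum, Finset.sum_apply]
    change algebraMap ℂ _ (g k x) * (t k).1 ⟨x, x.2.1⟩ = ∑ a, ((t k).1 ⟨x, x.2.1⟩ *
      algebraMap ℂ _ (G k a x)) * algebraMap ℂ _ (M.coords.z a x)
    rw [hGz k x (hV'k k x.2), Algebra.commutes, map_sum, Finset.mul_sum]
    exact Finset.sum_congr rfl fun a _ => by rw [map_mul, mul_assoc]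
  rw [h1]
  exact sum_mem fun a _ => Ideal.mul_mem_left _ _ (M.res_z_mem _ a)

/-- Near `Y`, split off the part of `s` involving the `ζ j`. What remains has coefficients vanishing
on `Y`, which the `z a` generate. Off `Y` some `z a` is invertible and the ideal is everything. -/
theorem exists_mem_idealSpan_of_mem {W : Opens X.carrier} (hW : W ≤ U) {s : X.Sec W}
    (hs : s ∈ f.kernelIdeal.sec W) {x : X.carrier} (hx : x ∈ W) :
    ∃ (V : Opens X.carrier) (hV : V ≤ W), x ∈ V ∧
      X.res hV s ∈ M.idealSpan V (hV.trans hW) := by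
  by_cases hxY : x ∈ Set.range f.i
  · obtain ⟨y, rfl⟩ := hxY
    obtain ⟨g, hg, hsg⟩ := M.frX.exists_sum hW s
    let p := inclB B J ∘ₗ projB B J
    -- `s'` is `s` with every term containing some `ζ j` deleted; its coefficients on `Y` are those
    -- of the restriction of `s`, hence zero.
    let s' := M.frX.ofCoef hW ((M.frX.isHolVal_coef hW s).map (map p).toLinearMap)
    have hs' : ∀ y (hy : f.i y ∈ W), M.frX.coef s' ⟨f.i y, hy⟩ = 0 := fun y hy => by
      have h1 := (M.map_φ_eq_zero_iff hW s hy).1 (hs y hy)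
      rw [M.frX.coef_ofCoef]
      change map p _ = 0
      rw [← map_comp_map, AlgHom.comp_apply, h1, map_zero]
    have hconst : ∀ (c : ℂ) (x : W) a, map (M.frX.ofV x) (c • a) =
        algebraMap ℂ _ c * map (M.frX.ofV x) a := fun c x a => by
      rw [map_smul, Algebra.smul_def]
    obtain ⟨g', hg', hs'g⟩ := M.frX.exists_sum hW s'
    have hcoef : ∀ {g : _ → X.carrier → ℂ} (hg : ∀ k, X.IsHolFun W (g k)) (x : W),
        M.frX.coef (∑ k, ofFun (hg k) * M.frX.const hW (Module.finBasis ℂ _ k)) x =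
          ∑ k, g k x • Module.finBasis ℂ (ExteriorAlgebra ℂ (B ⊕ J → ℂ)) k := by
      intro g hg x
      have h1 : (∑ k, ofFun (hg k) * M.frX.const hW (Module.finBasis ℂ _ k)).1 x =
          map (M.frX.ofV x) (∑ k, g k x • Module.finBasis ℂ _ k) := by
        rw [AddSubmonoidClass.coe_finsetSum, Finset.sum_apply, map_sum]
        exact Finset.sum_congr rfl fun k _ => (hconst _ _ _).symm
      change map (M.frX.toV x) _ = _
      rw [h1, M.frX.map_toV_map_ofV (hW x.2)]
    have hg'0 : ∀ k y, f.i y ∈ W → g' k (f.i y) = 0 := fun k y hy => by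
      have h1 := hs' y hy
      rw [hs'g, hcoef] at h1
      exact Fintype.linearIndependent_iff.1 (Module.finBasis ℂ _).linearIndependent _ h1 k
    obtain ⟨V, hV, hyV, hVs⟩ := M.exists_mem_idealSpan hW hg' _ hg'0 hx
    refine ⟨V, hV, hyV, ?_⟩
    have hsub : s - s' ∈ M.idealSpan W hW := by
      have : s - s' = ∑ k, ofFun (hg k) * M.frX.const hW
          (Module.finBasis ℂ _ k - map p (Module.finBasis ℂ _ k)) := by
        simp only [map_sub, mul_sub, Finset.sum_sub_distrib]
        rw [← hsg]
        congr 1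
        refine sec_ext fun x => ?_
        rw [M.frX.ofCoef_apply]
        change map (M.frX.ofV x) (map p (M.frX.coef s x)) = _
        rw [hsg, hcoef, map_sum, map_sum, AddSubmonoidClass.coe_finsetSum, Finset.sum_apply]
        refine Finset.sum_congr rfl fun k _ => ?_
        rw [map_smul, hconst]
        rfl
      rw [this]
      exact sum_mem fun k _ => Ideal.mul_mem_left _ _ (M.const_sub_mem hW _)
    have e : s = (s - s') + s' := by abel
    rw [e, map_add]
    refine add_mem (M.res_mem_idealSpan hV hW hsub) ?_
    rw [hs'g]
    exact hVs
  · have h1 : ∃ a, M.coords.z a x ≠ 0 := by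
      by_contra h
      push Not at h
      exact hxY ((M.coords.zero_iff x (hW hx)).2 h)
    obtain ⟨a, ha⟩ := h1
    let hz := (M.coords.hol_z a).mono hW
    have hVW : hz.nonvanishing ≤ W := fun x hx => hx.1
    refine ⟨hz.nonvanishing, hVW, ⟨hx, ha⟩, ?_⟩
    have hinv := (hz.mono hVW).inv fun x hx => hx.2
    have e : X.res hVW s = (X.res hVW s * ofFun hinv) * X.res (hVW.trans hW) (M.z a) :=
      sec_ext fun x => by
        change s.1 _ = (s.1 _ * algebraMap ℂ _ (M.coords.z a x)⁻¹) * algebraMap ℂ _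
          (M.coords.z a x)
        have hx0 : M.coords.z a x ≠ 0 := x.2.2
        rw [mul_assoc, ← map_mul, inv_mul_cancel₀ hx0, map_one, mul_one]
    rw [e]
    exact Ideal.mul_mem_left _ _ (M.res_z_mem _ a)

theorem generatedOn : f.kernelIdeal.GeneratedOn U (Set.range M.z ∪ Set.range M.ζ) := by
  refine ⟨?_, fun W h s hs x hx => M.exists_mem_idealSpan_of_mem h hs hx⟩
  rintro _ (⟨a, rfl⟩ | ⟨j, rfl⟩)
  exacts [(M.z_mem a).2, (M.ζ_mem j).2]

end LocalModel

end SuperEmbedding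

/-! ## The kernel ideal is an ideal sheaf for an embedding -/

namespace Supergeometry

variable {S : Supergeometry.{u}}

theorem comp_secComp {U : Opens S.carrier} (s : S.Sec U) (x : U) (i j : ℕ) :
    S.comp x j ((secComp i s).1 x) = if i = j then S.comp x j (s.1 x) else 0 := by
  rw [secComp_apply]
  refine (ExteriorAlgebra.degProj_degProj i j (s.1 x)).trans ?_
  split_ifs with h
  · rw [h]; rfl
  · rfl

theorem comp_sum_secComp {U : Opens S.carrier} (T : Finset ℕ) (s : S.Sec U) (x : U) (j : ℕ) :
    S.comp x j ((∑ i ∈ T, secComp i s).1 x) = if j ∈ T then S.comp x j (s.1 x) else 0 := by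
  rw [AddSubmonoidClass.coe_finsetSum, Finset.sum_apply, comp, map_sum]
  refine (Finset.sum_congr rfl fun i _ => comp_secComp s x i j).trans ?_
  rw [Finset.sum_ite_eq']

theorem sec_ext_comp {U : Opens S.carrier} {s t : S.Sec U}
    (h : ∀ (x : U) j, S.comp x j (s.1 x) = S.comp x j (t.1 x)) : s = t :=
  sec_ext fun x => sub_eq_zero.1 <| ExteriorAlgebra.eq_zero_of_degProj fun j => by
    rw [map_sub]; exact sub_eq_zero.2 (h x j)

/-- The even (for `ε = 0`) or odd (for `ε = 1`) part of a section. -/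
noncomputable def parityPart {U : Opens S.carrier} (ε : Fin 2) (s : S.Sec U) : S.Sec U :=
  ∑ i ∈ (Finset.range (S.rank + 1)).filter (fun j => j % 2 = ε.val), secComp i s

theorem hasParity_parityPart {U : Opens S.carrier} (ε : Fin 2) (s : S.Sec U) :
    HasParity ε (parityPart ε s) := fun x j hj => by
  rw [parityPart, comp_sum_secComp]
  exact if_neg (c := j ∈ Finset.filter _ _) fun h => hj (Finset.mem_filter.1 h).2

theorem HasDegree.hasParity {U : Opens S.carrier} {s : S.Sec U} {ε : Fin 2}
    (h : HasDegree ε.val s) : HasParity ε s := fun x j hj => h x j fun e => hj (by omega)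

theorem comp_add (x : S.carrier) (j : ℕ) (a b : ExteriorAlgebra ℂ (S.fibre x)) :
    S.comp x j (a + b) = S.comp x j a + S.comp x j b := map_add (ExteriorAlgebra.degProj j) a b

theorem comp_sub (x : S.carrier) (j : ℕ) (a b : ExteriorAlgebra ℂ (S.fibre x)) :
    S.comp x j (a - b) = S.comp x j a - S.comp x j b := map_sub (ExteriorAlgebra.degProj j) a b

theorem parityPart_add {U : Opens S.carrier} (s : S.Sec U) :
    parityPart 0 s + parityPart 1 s = s := sec_ext_comp fun x j => by
  have e : (parityPart 0 s + parityPart 1 s).1 x = (parityPart 0 s).1 x + (parityPart 1 s).1 x :=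
    rfl
  rw [e, comp_add, parityPart, parityPart, comp_sum_secComp, comp_sum_secComp]
  by_cases hj : j < S.rank + 1
  · rcases Nat.mod_two_eq_zero_or_one j with h | h <;> simp [hj, h]
  · rw [comp_eq_zero_of_rank_lt (by omega)]
    simp

end Supergeometry

namespace SuperEmbedding

open Supergeometry

variable {Y : Supergeometry.{v}} {X : Supergeometry.{u}} (f : SuperEmbedding Y X)

theorem secComp_mem_kernelIdeal {U : Opens X.carrier} {s : X.Sec U}
    (hs : s ∈ f.kernelIdeal.sec U) (j : ℕ) : secComp j s ∈ f.kernelIdeal.sec U := fun y hy => by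
  have h1 := ExteriorAlgebra.map_degProj (f.φ y) j (s.1 ⟨f.i y, hy⟩)
  rw [hs y hy, map_zero] at h1
  exact h1

/-- The pullback of rough sections along an embedding. -/
noncomputable def roughPullback (W : Opens X.carrier) : X.RoughSec W →ₐ[ℂ] Y.RoughSec (f.preim W) :=
  AlgHom.ofLinearMap
    { toFun := fun s y => ExteriorAlgebra.map (f.φ y) (s ⟨f.i y, y.2⟩)
      map_add' := fun _ _ => funext fun y => map_add (ExteriorAlgebra.map (f.φ y)) _ _
      map_smul' := fun _ _ => funext fun y => map_smul (ExteriorAlgebra.map (f.φ y)) _ _ }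
    (funext fun y => map_one (ExteriorAlgebra.map (f.φ y)))
    fun _ _ => funext fun y => map_mul (ExteriorAlgebra.map (f.φ y)) _ _

theorem roughPullback_mem_genSec {W : Opens X.carrier} {s : X.RoughSec W} (hs : s ∈ X.genSec W) :
    f.roughPullback W s ∈ Y.genSec (f.preim W) := by
  have : X.genSec W ≤ (Y.genSec (f.preim W)).comap (f.roughPullback W) := by
    refine Algebra.adjoin_le ?_
    rintro _ (⟨g, hg, rfl⟩ | ⟨σ, hσ, rfl⟩)
    · refine Algebra.subset_adjoin (Or.inl ⟨_, hg.comp_i f, ?_⟩)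
      exact funext fun y => (ExteriorAlgebra.map (f.φ y)).commutes _
    · refine Algebra.subset_adjoin (Or.inr ⟨_, f.hol W σ hσ, ?_⟩)
      exact funext fun y => ExteriorAlgebra.map_apply_ι _ _
  exact this hs

/-- The pullback of sections along an embedding. -/
noncomputable def pullback (W : Opens X.carrier) : X.Sec W →ₐ[ℂ] Y.Sec (f.preim W) :=
  ((f.roughPullback W).comp (X.Sec W).val).codRestrict (Y.Sec (f.preim W)) fun s y => by
    obtain ⟨V, hV, hy, hs⟩ := s.2 ⟨f.i y, y.2⟩
    exact ⟨f.preim V, f.preim_mono hV, hy, f.roughPullback_mem_genSec hs⟩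

theorem pullback_eq_zero_iff {W : Opens X.carrier} (s : X.Sec W) :
    f.pullback W s = 0 ↔ s ∈ f.kernelIdeal.sec W :=
  ⟨fun h y hy => congrArg (fun t : Y.Sec (f.preim W) => t.1 ⟨y, hy⟩) h,
    fun h => sec_ext fun y => h y y.2⟩

/-- Near `Y`, coefficients extend along the retraction and constant frame elements through `inclB`,
a section of `projB`. -/
theorem exists_pullback_eq {W : Opens X.carrier} (t : Y.Sec (f.preim W)) {x : X.carrier}
    (hx : x ∈ W) : ∃ (V : Opens X.carrier) (hV : V ≤ W) (s : X.Sec V), x ∈ V ∧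
      f.pullback V s = Y.res (f.preim_mono hV) t := by
  by_cases hxY : x ∈ Set.range f.i
  · obtain ⟨y, rfl⟩ := hxY
    obtain ⟨n, m, l, U, hyU, ⟨M⟩⟩ := f.exists_localModel y
    let P := W ⊓ U
    obtain ⟨g, hg, hgt⟩ := M.frY.exists_sum (f.preim_mono (inf_le_right : P ≤ U))
      (Y.res (f.preim_mono (inf_le_left : P ≤ W)) t)
    let V : Opens X.carrier := P ⊓ ⟨(U : Set X.carrier) ∩ M.coords.ρ ⁻¹' f.preim P,
      M.coords.hol_ρ.continuousOn.isOpen_inter_preimage U.2 (f.preim P).2⟩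
    have hVP : V ≤ P := inf_le_left
    have hgρ : ∀ k, X.IsHolFun V fun x => g k (M.coords.ρ x) := fun k =>
      ContMDiffOn.comp (hg k) (M.coords.hol_ρ.mono fun x hx => hx.2.1) fun x hx => hx.2.2
    refine ⟨V, hVP.trans inf_le_left, ∑ k, ofFun (hgρ k) * M.frX.const (hVP.trans inf_le_right)
      (ExteriorAlgebra.map (LocalModel.inclB (Fin m) (Fin l)) (Module.finBasis ℂ _ k)),
      ⟨⟨hx, hyU⟩, hyU, ?_⟩, ?_⟩
    · rw [Set.mem_preimage, M.coords.ρ_i y hyU]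
      exact ⟨hx, hyU⟩
    · have e : Y.res (f.preim_mono (hVP.trans inf_le_left)) t =
          Y.res (f.preim_mono hVP) (Y.res (f.preim_mono inf_le_left) t) := rfl
      rw [e, hgt, map_sum, map_sum]
      refine Finset.sum_congr rfl fun k _ => sec_ext fun y' => ?_
      rw [map_mul, map_mul]
      change ExteriorAlgebra.map (f.φ y') (algebraMap ℂ _ (g k (M.coords.ρ (f.i y')))) *
        ExteriorAlgebra.map (f.φ y') (ExteriorAlgebra.map (M.frX.ofV (f.i y')) _) =
        algebraMap ℂ _ (g k y') * ExteriorAlgebra.map (M.frY.ofV y') _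
      have hyU' : f.i y' ∈ U := y'.2.1.2
      rw [M.coords.ρ_i _ hyU', AlgHom.commutes, M.map_φ_ofV hyU', ← AlgHom.comp_apply
        (ExteriorAlgebra.map (LocalModel.projB (Fin m) (Fin l))), ExteriorAlgebra.map_comp_map]
      have : LocalModel.projB (Fin m) (Fin l) ∘ₗ LocalModel.inclB (Fin m) (Fin l) =
          LinearMap.id := LinearMap.ext fun _ => rfl
      rw [this, ExteriorAlgebra.map_id]
      rfl
  -- Over the complement of `Y` the target algebra is zero, so any section lifts.
  · refine ⟨W ⊓ ⟨(Set.range f.i)ᶜ, f.isClosed_range.isOpen_compl⟩, inf_le_left, 0, ⟨hx, hxY⟩, ?_⟩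
    exact sec_ext fun y => absurd ⟨y.1, rfl⟩ y.2.2

/-- The kernel is stable under taking homogeneous components, since `ExteriorAlgebra.map` preserves
degree; these components give the grading and the reductions. The pullback itself presents the
quotient, over all of `X`. -/
theorem isEmbeddingIdeal_kernelIdeal : f.IsEmbeddingIdeal f.kernelIdeal where
  graded U s hs :=
    have h : ∀ ε, parityPart ε s ∈ f.kernelIdeal.sec U := fun ε =>
      sum_mem fun i _ => f.secComp_mem_kernelIdeal hs i
    ⟨_, h 0, _, h 1, hasParity_parityPart 0 s, hasParity_parityPart 1 s, (parityPart_add s).symm⟩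
  reduces ε U s hs hp := by
    refine ⟨secComp ε.val s, ⟨hasDegree_secComp _ s, f.secComp_mem_kernelIdeal hs _⟩,
      fun x j hj => ?_⟩
    have e : (s - secComp ε.val s).1 x = s.1 x - (secComp ε.val s).1 x := rfl
    rw [e, comp_sub]
    by_cases h : j = ε.val
    · rw [comp_secComp, if_pos h.symm, sub_self]
    · rw [hasDegree_secComp ε.val s x j h, sub_zero]
      exact hp x j (by omega)
  lifts ε U n hn x hx :=
    ⟨U, le_rfl, n, hx, hn.2, hn.1.hasParity, fun x j _ => by
      rw [res_self, sub_self]; exact map_zero (ExteriorAlgebra.degProj j)⟩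
  localIso x := ⟨⊤, trivial, ⟨
    { map := fun W _ => f.pullback W
      map_res := fun _ _ _ => rfl
      parity := fun W _ ε s hs y j hj => by
        have h1 := ExteriorAlgebra.map_degProj (f.φ y) j (s.1 ⟨f.i y, y.2⟩)
        have h2 : ExteriorAlgebra.degProj j (s.1 ⟨f.i y, y.2⟩) = 0 := hs _ j hj
        rw [h2, map_zero] at h1
        exact h1.symm
      ker := fun W _ s => f.pullback_eq_zero_iff s
      surj := fun W _ t x hx => f.exists_pullback_eq t hx }⟩⟩

end SuperEmbedding

/-! ## Straightening generators by automorphisms -/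

namespace SuperEmbedding

open Supergeometry

variable {Y : Supergeometry.{v}} {X : Supergeometry.{u}} {f : SuperEmbedding Y X}

namespace GeneratorSystem

variable {I : X.IdealSheaf} (F : f.GeneratorSystem I)

theorem componentVanishes_of_lt {k : ℕ} (hk : (k : ℕ∞) ≤ F.maxSplittingDegree) (ε : Fin 2) {j : ℕ}
    (hj : 2 ≤ j) (hjk : j < k) : F.ComponentVanishes ε j := by
  have h1 : (j : ℕ∞) < F.splittingDegree ε := by
    refine lt_of_lt_of_le (by exact_mod_cast hjk) (hk.trans ?_)
    fin_cases ε
    exacts [min_le_left _ _, min_le_right _ _]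
  obtain ⟨_, ⟨n, rfl, hn⟩, hlt⟩ := lt_sSup_iff.1 h1
  exact hn j hj (by exact_mod_cast hlt)

/-- Degrees below `2` are controlled by `mod_square`. In degrees from `2` to `k - 1` the component
of `F` vanishes, and so does that of `n`, which sits in degree at most one. -/
theorem inJ_sub {k : ℕ} (hk : (k : ℕ∞) ≤ F.maxSplittingDegree) {ε : Fin 2} {U : Opens X.carrier}
    (n : f.conormal ε U) : InJ k (F.toFun ε U n - n.1) := fun x j hj => by
  by_cases h2 : j < 2
  · exact F.mod_square ε U n x j h2
  · have e : (F.toFun ε U n - n.1).1 x = (F.toFun ε U n).1 x - n.1.1 x := rfl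
    rw [e, comp_sub, F.componentVanishes_of_lt hk ε (by omega) hj U n x,
      n.2.1 x j (by omega), sub_zero]

theorem toFun_eq (h : F.maxSplittingDegree = ⊤) {ε : Fin 2} {U : Opens X.carrier}
    (n : f.conormal ε U) : F.toFun ε U n = n.1 :=
  sub_eq_zero.1 ((F.inJ_sub (k := X.rank + 1) (h ▸ le_top) n).eq_zero (by omega))

end GeneratorSystem

namespace LocalModel

variable {U : Opens X.carrier} {A B J : Type} [Fintype A] [DecidableEq A] [Fintype B] [Fintype J]
  [DecidableEq B] [DecidableEq J] (M : f.LocalModel U A B J)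

theorem exists_greenDer {m : ℕ} (hm : 2 ≤ m) {n : A → X.Sec U} {ξ : J → X.Sec U}
    (hn : ∀ a, HasParity 0 (n a)) (hn' : ∀ a, InJ m (n a)) (hξ : ∀ j, HasParity 1 (ξ j))
    (hξ' : ∀ j, InJ m (ξ j)) : ∃ δ : X.GreenDer m U, (∀ a, δ.D U le_rfl (M.z a) = n a) ∧
      ∀ j, δ.D U le_rfl (M.ζ j) = ξ j :=
  ⟨GreenDer.ofFrame M.frX M.coords.der (fun j => LinearMap.proj (Sum.inr j)) n ξ hm hn hn' hξ hξ',
    fun a => GreenDer.ofFrame_ofFun hm hn hn' hξ hξ' _ a fun a' x hx => M.coords.der_z a' a x hx,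
    fun j => GreenDer.ofFrame_const_ι hm hn hn' hξ hξ' _ j fun j' => by
      simp [Pi.single_apply]⟩

/-- A Newton step: take the exponential of the derivation `D` with `D z = z - x` and `D ζ = ζ - ξ`.
The new error is the exponential remainder plus `D (x - z)`, and both lie one degree deeper than `x
- z`. -/
theorem exists_green_step {m : ℕ} (hm : 2 ≤ m) {x : A → X.Sec U} {ξ : J → X.Sec U}
    (hx : ∀ a, HasParity 0 (x a)) (hx' : ∀ a, InJ m (x a - M.z a)) (hξ : ∀ j, HasParity 1 (ξ j))
    (hξ' : ∀ j, InJ m (ξ j - M.ζ j)) : ∃ β ∈ X.Green m U,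
      (∀ a, InJ (m + 1) (act β U le_rfl (x a) - M.z a)) ∧
      ∀ j, InJ (m + 1) (act β U le_rfl (ξ j) - M.ζ j) := by
  obtain ⟨δ, hz, hζ⟩ := M.exists_greenDer hm (n := fun a => M.z a - x a)
    (ξ := fun j => M.ζ j - ξ j)
    (fun a => (paritySub 0 U).sub_mem (HasDegree.hasParity (hasDegree_ofFun _)) (hx a))
    (fun a => by rw [← neg_sub, ← mem_jSub]; exact neg_mem (hx' a))
    (fun j => (paritySub 1 U).sub_mem (HasDegree.hasParity (M.hasDegree_ζ j)) (hξ j))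
    (fun j => by rw [← neg_sub, ← mem_jSub]; exact neg_mem (hξ' j))
  obtain ⟨β, hβ, hβδ⟩ := δ.exists_exp
  have key : ∀ s t : X.Sec U, InJ m (s - t) → δ.D U le_rfl t = t - s →
      InJ (m + 1) (act β U le_rfl s - t) := fun s t h1 h2 => by
    have e : act β U le_rfl s - t =
        (act β U le_rfl s - s - δ.D U le_rfl s) + δ.D U le_rfl (s - t) := by
      rw [map_sub, h2]; abel
    rw [e]
    exact (jSub (m + 1) U).add_mem (hβδ U le_rfl s) (δ.raise U le_rfl m _ h1)
  exact ⟨β, hβ, fun a => key _ _ (hx' a) (hz a), fun j => key _ _ (hξ' j) (hζ j)⟩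

/-- Newton steps are iterated until `m` exceeds the rank, where congruence modulo `J^m` is equality.
Later factors have higher level, so the product keeps the initial one. -/
theorem exists_green {m : ℕ} (hm : 2 ≤ m) {x : A → X.Sec U} {ξ : J → X.Sec U}
    (hx : ∀ a, HasParity 0 (x a)) (hx' : ∀ a, InJ m (x a - M.z a)) (hξ : ∀ j, HasParity 1 (ξ j))
    (hξ' : ∀ j, InJ m (ξ j - M.ζ j)) : ∃ α ∈ X.Green m U,
      (∀ a, act α U le_rfl (x a) = M.z a) ∧ ∀ j, act α U le_rfl (ξ j) = M.ζ j := by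
  obtain ⟨n, hn⟩ : ∃ n, X.rank < m + n := ⟨X.rank + 1, by omega⟩
  induction n generalizing m x ξ with
  | zero =>
    exact ⟨1, one_mem _, fun a => sub_eq_zero.1 ((hx' a).eq_zero hn),
      fun j => sub_eq_zero.1 ((hξ' j).eq_zero hn)⟩
  | succ n ih =>
    obtain ⟨β, hβ, h1, h2⟩ := M.exists_green_step hm hx hx' hξ hξ'
    obtain ⟨α, hα, h3, h4⟩ := ih (by omega) (fun a => (β.2.2 ⟨U, le_rfl⟩ 0 (x a)).2 (hx a)) h1
      (fun j => (β.2.2 ⟨U, le_rfl⟩ 1 (ξ j)).2 (hξ j)) h2 (by omega)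
    exact ⟨α * β, mul_mem (Green_succ_le m U hα) hβ, h3, h4⟩

theorem exists_straightening {k : ℕ} (hk : 2 ≤ k) {I : X.IdealSheaf} (F : f.GeneratorSystem I)
    (hF : (k : ℕ∞) ≤ F.maxSplittingDegree) : ∃ α ∈ X.Green k U,
      (∀ a, act α U le_rfl (F.toFun 0 U ⟨M.z a, M.z_mem a⟩) = M.z a) ∧
      ∀ j, act α U le_rfl (F.toFun 1 U ⟨M.ζ j, M.ζ_mem j⟩) = M.ζ j :=
  M.exists_green hk (fun _ => F.parity _ _ _) (fun _ => F.inJ_sub hF _)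
    (fun _ => F.parity _ _ _) fun _ => F.inJ_sub hF _

theorem carriesGenerators {I : X.IdealSheaf} {F : f.GeneratorSystem I}
    {Fhat : f.GeneratorSystem f.kernelIdeal} (hFhat : Fhat.maxSplittingDegree = ⊤)
    {α : X.Aut U} (hz : ∀ a, act α U le_rfl (F.toFun 0 U ⟨M.z a, M.z_mem a⟩) = M.z a)
    (hζ : ∀ j, act α U le_rfl (F.toFun 1 U ⟨M.ζ j, M.ζ_mem j⟩) = M.ζ j) :
    CarriesGenerators α F Fhat := fun y hy => by
  let T : ∀ ε : Fin 2, Set (f.conormal ε U) :=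
    Fin.cons (Set.range fun a => ⟨M.z a, M.z_mem a⟩)
      (Fin.cons (Set.range fun j => ⟨M.ζ j, M.ζ_mem j⟩) finZeroElim)
  have hT0 : T 0 = Set.range fun a => ⟨M.z a, M.z_mem a⟩ := rfl
  have hT1 : T 1 = Set.range fun j => ⟨M.ζ j, M.ζ_mem j⟩ := rfl
  refine ⟨U, le_rfl, hy, T, ?_, ?_, ?_⟩
  · refine Fin.forall_fin_two.2 ⟨?_, ?_⟩
    · rw [hT0]; exact Set.finite_range _
    · rw [hT1]; exact Set.finite_range _
  · have : {t | ∃ ε, ∃ n ∈ T ε, t = Fhat.toFun ε U n} = Set.range M.z ∪ Set.range M.ζ := by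
      ext t
      simp only [Fhat.toFun_eq hFhat, Set.mem_ofPred_eq, Fin.exists_fin_two, hT0, hT1,
        Set.mem_union, Set.mem_range, eq_comm]
      refine or_congr ?_ ?_ <;>
        exact ⟨fun ⟨_, ⟨a, ha⟩, e⟩ => ⟨a, by rw [e, ha]⟩, fun ⟨a, e⟩ => ⟨_, ⟨a, rfl⟩, e⟩⟩
    rw [this]
    exact M.generatedOn
  · simp only [Fhat.toFun_eq hFhat]
    refine Fin.forall_fin_two.2 ⟨?_, ?_⟩
    · rintro n hn
      obtain ⟨a, rfl⟩ := hT0 ▸ hn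
      exact hz a
    · rintro n hn
      obtain ⟨j, rfl⟩ := hT1 ▸ hn
      exact hζ j

end LocalModel

end SuperEmbedding

/-! ## Quotients of the sheaf of exterior algebras near the submanifold -/

namespace ExteriorAlgebra

variable {R V : Type*} [CommRing R] [AddCommGroup V] [Module R V]

theorem degProj_ι_mul (j : ℕ) (v : V) (a : ExteriorAlgebra R V) :
    degProj (j + 1) (ι R v * a) = ι R v * degProj j a := by
  rw [degProj_mul, Finset.sum_eq_single (1, j), degProj_of_mem (ι_mem v)]
  · intro il hil h
    have h1 := Finset.HasAntidiagonal.mem_antidiagonal.1 hil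
    rw [degProj_ι _ (fun e => h (Prod.ext e (by simp only; omega))), zero_mul]
  · intro h
    exact absurd (Finset.HasAntidiagonal.mem_antidiagonal.2 (add_comm 1 j)) h

theorem degProj_zero_ι_mul (v : V) (a : ExteriorAlgebra R V) : degProj 0 (ι R v * a) = 0 := by
  rw [degProj_mul]
  refine Finset.sum_eq_zero fun il hil => ?_
  have h1 := Finset.HasAntidiagonal.mem_antidiagonal.1 hil
  rw [degProj_ι _ (by omega), zero_mul]

end ExteriorAlgebra

namespace Supergeometry

variable {S : Supergeometry.{u}}

theorem InJ.mul {j k : ℕ} {U : Opens S.carrier} {s t : S.Sec U} (hs : InJ j s) (ht : InJ k t) :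
    InJ (j + k) (s * t) := fun x n hn => by
  refine (ExteriorAlgebra.degProj_mul n (s.1 x) (t.1 x)).trans (Finset.sum_eq_zero fun il hil => ?_)
  have h1 := Finset.HasAntidiagonal.mem_antidiagonal.1 hil
  by_cases h : il.1 < j
  · have h2 : ExteriorAlgebra.degProj il.1 (s.1 x) = 0 := hs x _ h
    rw [h2, zero_mul]
  · have h2 : ExteriorAlgebra.degProj il.2 (t.1 x) = 0 := ht x _ (by omega)
    rw [h2, mul_zero]

theorem HasParity.inJ_one {U : Opens S.carrier} {s : S.Sec U} (hs : HasParity 1 s) : InJ 1 s :=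
  fun x j hj => hs x j (by
    rw [Nat.lt_one_iff.1 hj]; exact Nat.zero_ne_one)

theorem eq_zero_of_hasParity {U : Opens S.carrier} {s : S.Sec U} (h0 : HasParity 0 s)
    (h1 : HasParity 1 s) : s = 0 := sec_ext_comp fun x j => by
  have e : S.comp x j ((0 : S.Sec U).1 x) = 0 := map_zero (ExteriorAlgebra.degProj j)
  rw [e]
  rcases Nat.mod_two_eq_zero_or_one j with h | h
  · exact h1 x j (by rw [h]; exact Nat.zero_ne_one)
  · exact h0 x j (by rw [h]; exact Nat.one_ne_zero)

end Supergeometry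

namespace SuperEmbedding

open Supergeometry ExteriorAlgebra

variable {Y : Supergeometry.{v}} {X : Supergeometry.{u}} {f : SuperEmbedding Y X}

namespace LocalModel

variable {U : Opens X.carrier} {A B J : Type} [Fintype A] [DecidableEq A] [Fintype B] [Fintype J]

/-- Restriction of a local model. -/
def restrict (M : f.LocalModel U A B J) {W : Opens X.carrier} (h : W ≤ U) :
    f.LocalModel W A B J where
  coords := M.coords.restrict h
  frX := M.frX.restrict h
  frY := M.frY.restrict (f.preim_mono h)
  compat y hy := M.compat y (h hy)

variable (M : f.LocalModel U A B J)

/-- The coefficients of the restriction of a section to the submanifold. -/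
noncomputable def symb {V : Opens X.carrier} (t : X.Sec V) (y : f.preim V) :
    ExteriorAlgebra ℂ (B → ℂ) :=
  map (projB B J) (M.frX.coef t ⟨f.i y, y.2⟩)

theorem symb_mul {V : Opens X.carrier} (s t : X.Sec V) (y : f.preim V) :
    M.symb (s * t) y = M.symb s y * M.symb t y := by
  rw [symb, M.frX.coef_mul, map_mul]; rfl

theorem symb_sub {V : Opens X.carrier} (s t : X.Sec V) (y : f.preim V) :
    M.symb (s - t) y = M.symb s y - M.symb t y := by
  rw [symb, sub_eq_add_neg, ← neg_one_smul ℂ t, M.frX.coef_add, M.frX.coef_smul, map_add, map_smul,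
    neg_one_smul, ← sub_eq_add_neg]
  rfl

theorem symb_ofFun {V : Opens X.carrier} {g : X.carrier → ℂ} (hg : X.IsHolFun V g)
    (y : f.preim V) : M.symb (ofFun hg) y = algebraMap ℂ _ (g (f.i y)) := by
  rw [symb, M.frX.coef_ofFun, AlgHom.commutes]

theorem mem_kernelIdeal_iff {V : Opens X.carrier} (h : V ≤ U) (t : X.Sec V) :
    t ∈ f.kernelIdeal.sec V ↔ ∀ y, M.symb t y = 0 :=
  ⟨fun ht y => (M.map_φ_eq_zero_iff h t y.2).1 (ht y y.2),
    fun ht y hy => (M.map_φ_eq_zero_iff h t hy).2 (ht ⟨y, hy⟩)⟩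

theorem degProj_symb_of_inJ {V : Opens X.carrier} {k : ℕ} {t : X.Sec V} (ht : InJ k t)
    (y : f.preim V) {j : ℕ} (hj : j < k) : degProj j (M.symb t y) = 0 := by
  rw [symb, ← map_degProj, M.frX.degProj_coef, ht _ j hj, map_zero, map_zero]

theorem exists_holFun_symb {V : Opens X.carrier} (h : V ≤ U)
    (ℓ : Module.Dual ℂ (ExteriorAlgebra ℂ (B → ℂ))) (t : X.Sec V) :
    ∃ g, X.IsHolFun V g ∧ ∀ y : f.preim V, g (f.i y) = ℓ (M.symb t y) :=
  ⟨_, ((M.frX.isHolVal_coef h t).map (map (projB B J)).toLinearMap) ℓ, fun y =>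
    extZero_apply (S := X) _ ⟨f.i y, y.2⟩⟩

/-! ### Rigidity: a surjection onto the exterior algebra of `Y` killing the kernel ideal has no
larger kernel. -/

section Quotient

variable (Q : ∀ V ≤ U, X.Sec V →ₐ[ℂ] Y.Sec (f.preim V))
  (hres : ∀ {V' V : Opens X.carrier} (h : V' ≤ V) (hV : V ≤ U) (s : X.Sec V),
    Q V' (h.trans hV) (X.res h s) = Y.res (f.preim_mono h) (Q V hV s))
  (hpar : ∀ V (hV : V ≤ U) (ε : Fin 2) (s : X.Sec V), HasParity ε s → HasParity ε (Q V hV s))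
  (hker : ∀ V (hV : V ≤ U) (s : X.Sec V), s ∈ f.kernelIdeal.sec V → Q V hV s = 0)
  (hsurj : ∀ V (hV : V ≤ U) (t : Y.Sec (f.preim V)), ∀ x ∈ V,
    ∃ (V' : Opens X.carrier) (h : V' ≤ V) (s : X.Sec V'), x ∈ V' ∧
      Q V' (h.trans hV) s = Y.res (f.preim_mono h) t)

include hpar hsurj in
-- The even part of a lift has an image that is both even and odd, hence zero. The odd part is
-- therefore still a lift, and odd sections lie in `J^1`.
theorem exists_odd_lift {V : Opens X.carrier} (hV : V ≤ U) {t : Y.Sec (f.preim V)}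
    (ht : HasParity 1 t) {x : X.carrier} (hx : x ∈ V) :
    ∃ (V' : Opens X.carrier) (h : V' ≤ V) (s : X.Sec V'), x ∈ V' ∧ InJ 1 s ∧
      Q V' (h.trans hV) s = Y.res (f.preim_mono h) t := by
  obtain ⟨V', h, s, hxV', hs⟩ := hsurj V hV t x hx
  obtain ⟨s₀, s₁, h0, h1, rfl⟩ : ∃ s₀ s₁ : X.Sec V', HasParity 0 s₀ ∧ HasParity 1 s₁ ∧ s = s₀ + s₁ :=
    ⟨_, _, hasParity_parityPart 0 s, hasParity_parityPart 1 s, (parityPart_add s).symm⟩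
  refine ⟨V', h, s₁, hxV', h1.inJ_one, ?_⟩
  rw [map_add] at hs
  have e : Q V' (h.trans hV) s₀ = Y.res (f.preim_mono h) t - Q V' (h.trans hV) s₁ :=
    eq_sub_of_add_eq hs
  have e0 : Q V' (h.trans hV) s₀ = 0 := eq_zero_of_hasParity (hpar _ _ 0 _ h0) (e ▸
    (paritySub 1 (f.preim V')).sub_mem (ht.res _) (hpar _ _ 1 _ h1))
  rwa [e0, zero_add] at hs

include hres hpar hsurj in
-- `Q` respects only parity, not degree, yet a product of `n` odd lifts lies in `J^n`. This is how a
-- top form gets a lift of top order.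
theorem exists_prod_lift (l : List (B → ℂ)) {V : Opens X.carrier} (hV : V ≤ U) {x : X.carrier}
    (hx : x ∈ V) : ∃ (V' : Opens X.carrier) (h : V' ≤ V) (s : X.Sec V'), x ∈ V' ∧
      InJ l.length s ∧ Q V' (h.trans hV) s =
        M.frY.const (f.preim_mono (h.trans hV)) (l.map (ι ℂ)).prod := by
  induction l with
  | nil =>
    exact ⟨V, le_rfl, 1, hx, inJ_zero 1, by rw [List.map_nil, List.prod_nil, map_one, map_one]⟩
  | cons v l ih =>
    obtain ⟨V₁, h₁, s₁, hx₁, hs₁, e₁⟩ := ih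
    obtain ⟨V₂, h₂, s₂, hx₂, hs₂, e₂⟩ := exists_odd_lift Q hpar hsurj (h₁.trans hV)
      (t := M.frY.const (f.preim_mono (h₁.trans hV)) (ι ℂ v)) (fun y j hj => by
        rw [M.frY.const_apply, map_apply_ι]
        exact degProj_ι j (fun e => hj (by rw [e]; rfl)) _) hx₁
    refine ⟨V₂, h₂.trans h₁, s₂ * X.res h₂ s₁, hx₂, ?_, ?_⟩
    · rw [List.length_cons, add_comm]
      exact hs₂.mul (hs₁.res h₂)
    · rw [map_mul, List.map_cons, List.prod_cons, map_mul]
      congr 1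
      exact (hres h₂ (h₁.trans hV) s₁).trans (by rw [e₁]; rfl)

include hres hpar hker hsurj in
-- On `Y`, `t` and a lift `u` of a non-zero top form are sections of a line bundle. If `t` were
-- non-zero at `y`, then near `y` the section `u` would be a multiple of `t` modulo the kernel
-- ideal, forcing `Q u = 0`.
theorem degProj_symb_top {V : Opens X.carrier} (hV : V ≤ U) {t : X.Sec V} (ht : Q V hV t = 0)
    (hlow : ∀ y, ∀ j < Fintype.card B, degProj j (M.symb t y) = 0) (y : f.preim V) :
    degProj (Fintype.card B) (M.symb t y) = 0 := by
  have hr : Module.finrank ℂ (B → ℂ) = Fintype.card B := Module.finrank_fintype_fun_eq_card ℂ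
  have htop : ∀ {V : Opens X.carrier} {t : X.Sec V},
      (∀ y, ∀ j < Fintype.card B, degProj j (M.symb t y) = 0) →
      ∀ y, M.symb t y ∈ ⋀[ℂ]^(Module.finrank ℂ (B → ℂ)) (B → ℂ) := fun {V t} hlow y => by
    rw [mem_iff_degProj, hr]
    intro j hj
    rcases lt_or_gt_of_ne hj with h | h
    · exact hlow y j h
    · exact degProj_eq_zero (by omega) _
  by_contra hne
  have hne' : M.symb t y ≠ 0 := fun e => hne (by rw [e, map_zero])
  obtain ⟨ℓ, hℓ⟩ : ∃ ℓ : Module.Dual ℂ (ExteriorAlgebra ℂ (B → ℂ)), ℓ (M.symb t y) ≠ 0 := by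
    by_contra h
    push Not at h
    exact hne' ((Module.forall_dual_apply_eq_zero_iff ℂ _).1 h)
  obtain ⟨g, hg, hgt⟩ := M.exists_holFun_symb hV ℓ t
  have hnV : hg.nonvanishing ≤ V := fun x hx => hx.1
  obtain ⟨l, hl, hl0⟩ := exists_prod_ι_ne_zero (K := ℂ) (V := B → ℂ) (Fintype.card B) hr.ge
  obtain ⟨V', h', u, hyV', hu, hQu⟩ := M.exists_prod_lift Q hres hpar hsurj l (hnV.trans hV)
    (x := f.i y) ⟨y.2, by rw [Set.mem_preimage, hgt]; exact hℓ⟩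
  have hV'V : V' ≤ V := h'.trans hnV
  obtain ⟨g', hg', hgu⟩ := M.exists_holFun_symb (hV'V.trans hV) ℓ u
  have hg0 := hg.mono hV'V
  -- Proportionality in the top power, with `g` and `g'` restricting on `Y` to the values of `ℓ` on
  -- the symbols of `t` and `u`.
  have hmem : ofFun hg0 * u - ofFun hg' * X.res hV'V t ∈ f.kernelIdeal.sec V' := by
    rw [M.mem_kernelIdeal_iff (hV'V.trans hV)]
    intro z
    have e : M.symb (X.res hV'V t) z = M.symb t ⟨z, hV'V z.2⟩ := rfl
    rw [symb_sub, symb_mul, symb_mul, symb_ofFun, symb_ofFun, e, hgt ⟨z, hV'V z.2⟩, hgu z,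
      ← Algebra.smul_def, ← Algebra.smul_def, sub_eq_zero]
    exact smul_comm_of_mem_top (htop (fun y j hj => M.degProj_symb_of_inJ hu y (hl ▸ hj)) z)
      (htop hlow ⟨z, hV'V z.2⟩) ℓ
  have h1 := hker V' (hV'V.trans hV) _ hmem
  rw [map_sub, map_mul, map_mul, hres hV'V hV, ht, map_zero, mul_zero, sub_zero] at h1
  -- The lift was taken over the set where `g` has no zeros, so `g` can be divided out and `Q u = 0`
  -- follows.
  have hinv := hg0.inv fun x hx => (h' hx).2
  have h2 : u = ofFun hinv * (ofFun hg0 * u) := sec_ext fun x => by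
    change _ = algebraMap ℂ _ (g x)⁻¹ * (algebraMap ℂ _ (g x) * u.1 x)
    have hx0 : g x ≠ 0 := (h' x.2).2
    rw [← mul_assoc, ← map_mul, inv_mul_cancel₀ hx0, map_one, one_mul]
  have h3 : Q V' (hV'V.trans hV) u = 0 := by
    rw [h2, map_mul, map_mul, h1, mul_zero]
  rw [hQu] at h3
  refine hl0 ?_
  have h4 := M.frY.coef_const (f.preim_mono (hV'V.trans hV)) (l.map (ι ℂ)).prod ⟨y, hyV'⟩
  rw [← h4, h3]
  exact map_zero (map (M.frY.toV y))

include hres hpar hker hsurj in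
-- Descending induction on the degree `d`. Multiplying `t` by an odd section stays in the kernel of
-- `Q` and raises the lowest part by one degree; below top degree, a form annihilated by all vectors
-- is zero.
theorem degProj_symb_of_low [DecidableEq B] (n d : ℕ) (hd : d + n = Fintype.card B)
    {V : Opens X.carrier} (hV : V ≤ U) {t : X.Sec V} (ht : Q V hV t = 0)
    (hlow : ∀ y, ∀ j < d, degProj j (M.symb t y) = 0) (y : f.preim V) :
    degProj d (M.symb t y) = 0 := by
  induction n generalizing d t with
  | zero =>
    obtain rfl : d = Fintype.card B := hd
    exact M.degProj_symb_top Q hres hpar hker hsurj hV ht hlow y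
  | succ n ih =>
    refine eq_zero_of_forall_ι_mul_eq_zero (d := d) ?_ (degProj_mem d _) fun v => ?_
    · rw [Module.finrank_fintype_fun_eq_card]; omega
    · let σ : X.Sec V := M.frX.const hV (ι ℂ (inclB B J v))
      have hσ : ∀ y, M.symb σ y = ι ℂ v := fun y => by
        rw [symb, M.frX.coef_const, map_apply_ι]; rfl
      have hdeg : ∀ j y, degProj (j + 1) (M.symb (σ * t) y) = ι ℂ v * degProj j (M.symb t y) :=
        fun j y => by
          rw [symb_mul, hσ, degProj_ι_mul]
      rw [← hdeg]
      refine ih (d + 1) (by omega) (by rw [map_mul, ht, mul_zero]) fun z j hj => ?_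
      cases j with
      | zero => rw [symb_mul, hσ, degProj_zero_ι_mul]
      | succ j => rw [hdeg, hlow z j (by omega), mul_zero]

include M hres hpar hker hsurj in
theorem mem_kernelIdeal_of_quotient {V : Opens X.carrier} (hV : V ≤ U) {t : X.Sec V}
    (ht : Q V hV t = 0) : t ∈ f.kernelIdeal.sec V := by
  classical
  rw [M.mem_kernelIdeal_iff hV]
  have h1 : ∀ j y, degProj j (M.symb t y) = 0 := fun j => by
    induction j using Nat.strong_induction_on with
    | _ j ih =>
      intro y
      by_cases h : j ≤ Fintype.card B
      · exact M.degProj_symb_of_low Q hres hpar hker hsurj (Fintype.card B - j) j (by omega) hV ht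
          (fun y i hi => ih i hi y) y
      · exact degProj_eq_zero (by rw [Module.finrank_fintype_fun_eq_card]; omega) _
  exact fun y => eq_zero_of_degProj fun j => h1 j y

end Quotient

end LocalModel

end SuperEmbedding

/-! ## Existence of local straightenings -/

namespace Supergeometry

variable {S : Supergeometry.{u}}

theorem InJ.pow {k : ℕ} {U : Opens S.carrier} {s : S.Sec U} (hs : InJ k s) (n : ℕ) :
    InJ (n * k) (s ^ n) := by
  induction n with
  | zero => rw [zero_mul]; exact inJ_zero _
  | succ n ih => rw [pow_succ, Nat.succ_mul]; exact ih.mul hs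

theorem InJ.isNilpotent {k : ℕ} (hk : 0 < k) {U : Opens S.carrier} {s : S.Sec U} (hs : InJ k s) :
    IsNilpotent s :=
  ⟨S.rank + 1, (hs.pow (S.rank + 1)).eq_zero (by nlinarith)⟩

end Supergeometry

namespace SuperEmbedding

open Supergeometry

variable {Y : Supergeometry.{v}} {X : Supergeometry.{u}} {f : SuperEmbedding Y X}

theorem mem_kernelIdeal_of_disjoint {W : Opens X.carrier} (hW : ∀ x ∈ W, x ∉ Set.range f.i)
    (s : X.Sec W) : s ∈ f.kernelIdeal.sec W := fun y hy => absurd ⟨y, rfl⟩ (hW _ hy)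

/-- Off `Y` the function `1` is a conormal section, so locally `I` contains an element congruent to
`1` modulo `J^2`. Sections of `J^2` are nilpotent, hence this element is a unit. -/
theorem IsEmbeddingIdeal.mem_of_disjoint {I : X.IdealSheaf} (hI : f.IsEmbeddingIdeal I)
    {W : Opens X.carrier} (hW : ∀ x ∈ W, x ∉ Set.range f.i) (s : X.Sec W) : s ∈ I.sec W := by
  refine I.glue W s fun x hx => ?_
  have h1 : (1 : X.Sec W) ∈ f.conormal 0 W :=
    ⟨fun x j hj => by
      have h := ExteriorAlgebra.degProj_algebraMap (R := ℂ) (V := X.fibre x) j hj 1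
      rw [map_one] at h
      exact h, mem_kernelIdeal_of_disjoint hW 1⟩
  obtain ⟨V, hV, t, hxV, ht, -, ht2⟩ := hI.lifts 0 W 1 h1 x hx
  rw [map_one] at ht2
  have hu : IsUnit t := by
    have := (ht2.isNilpotent two_pos).isUnit_add_one
    rwa [sub_add_cancel] at this
  refine ⟨V, hV, hxV, ?_⟩
  rw [Ideal.eq_top_of_isUnit_mem _ ht hu]
  trivial

/-- `α⁻¹` sends the local generators `z`, `ζ` of the kernel ideal into `I`, so by gluing it sends
the whole kernel ideal into `I`. For the other inclusion, `q ∘ α⁻¹` is a surjection killing the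
kernel ideal, with kernel `α(I)`, and the rigidity of such surjections applies. -/
theorem LocalModel.straightens {U : Opens X.carrier} {A B J : Type} [Fintype A] [DecidableEq A]
    [Fintype B] [Fintype J] [DecidableEq B] [DecidableEq J] (M : f.LocalModel U A B J)
    {I : X.IdealSheaf} (q : f.LocalQuotientIso I U) {α : X.Aut U} {x : A → X.Sec U}
    {ξ : J → X.Sec U} (hx : ∀ a, x a ∈ I.sec U) (hξ : ∀ j, ξ j ∈ I.sec U)
    (hz : ∀ a, act α U le_rfl (x a) = M.z a) (hζ : ∀ j, act α U le_rfl (ξ j) = M.ζ j) :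
    f.Straightens α I := by
  have hinv : ∀ {V : Opens X.carrier} (hV : V ≤ U) (s t : X.Sec U), act α U le_rfl s = t →
      (act α V hV).symm (X.res hV t) = X.res hV s := fun {V} hV s t e => by
    rw [AlgEquiv.symm_apply_eq, ← e]
    exact α.2.1 ⟨V, hV⟩ ⟨U, le_rfl⟩ hV s
  have hα' : ∀ {V' V : Opens X.carrier} (h : V' ≤ V) (hV : V ≤ U) (s : X.Sec V),
      X.res h ((act α V hV).symm s) = (act α V' (h.trans hV)).symm (X.res h s) := fun h hV s =>
    (α⁻¹).2.1 ⟨_, h.trans hV⟩ ⟨_, hV⟩ h s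
  have hspan : ∀ {V : Opens X.carrier} (hV : V ≤ U) (s : X.Sec V), s ∈ M.idealSpan V hV →
      (act α V hV).symm s ∈ I.sec V := fun {V} hV s hs => by
    have : M.idealSpan V hV ≤ (I.sec V).comap (act α V hV).symm := by
      refine Ideal.span_le.2 ?_
      rintro _ ⟨_, ⟨a, rfl⟩ | ⟨j, rfl⟩, rfl⟩
      · change (act α V hV).symm _ ∈ I.sec V
        rw [hinv hV _ _ (hz a)]
        exact I.res_mem hV _ (hx a)
      · change (act α V hV).symm _ ∈ I.sec V
        rw [hinv hV _ _ (hζ j)]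
        exact I.res_mem hV _ (hξ j)
    exact this hs
  have hK : ∀ {V : Opens X.carrier} (hV : V ≤ U) (s : X.Sec V), s ∈ f.kernelIdeal.sec V →
      (act α V hV).symm s ∈ I.sec V := fun {V} hV s hs => by
    refine I.glue V _ fun x hx => ?_
    obtain ⟨V', hV', hxV', h⟩ := M.exists_mem_idealSpan_of_mem hV hs hx
    refine ⟨V', hV', hxV', ?_⟩
    rw [hα' hV' hV]
    exact hspan _ _ h
  let Q : ∀ V ≤ U, X.Sec V →ₐ[ℂ] Y.Sec (f.preim V) := fun V hV =>
    (q.map V hV).comp (act α V hV).symm.toAlgHom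
  have hQ : ∀ V (hV : V ≤ U) s, Q V hV s = q.map V hV ((act α V hV).symm s) := fun _ _ _ => rfl
  intro W hW s
  refine ⟨fun h => ?_, fun h => ?_⟩
  · have := hK hW _ h
    rwa [AlgEquiv.symm_apply_apply] at this
  · refine M.mem_kernelIdeal_of_quotient Q ?_ ?_ ?_ ?_ hW ?_
    · intro V' V h' hV t
      rw [hQ, hQ, ← hα' h' hV, q.map_res h' hV]
    · exact fun V hV ε t ht => q.parity V hV ε _ (((α⁻¹).2.2 ⟨V, hV⟩ ε t).2 ht)
    · exact fun V hV t ht => (q.ker V hV _).2 (hK hV t ht)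
    · intro V hV t x hx
      obtain ⟨V', hV', r, hxV', hr⟩ := q.surj V hV t x hx
      refine ⟨V', hV', act α V' (hV'.trans hV) r, hxV', ?_⟩
      rw [hQ, AlgEquiv.symm_apply_apply, hr]
    · rw [hQ, AlgEquiv.symm_apply_apply]
      exact (q.ker W hW s).2 h

/-- Restriction of a local isomorphism of quotients. -/
def LocalQuotientIso.restrict {I : X.IdealSheaf} {U V : Opens X.carrier}
    (q : f.LocalQuotientIso I U) (h : V ≤ U) : f.LocalQuotientIso I V where
  map W hW := q.map W (hW.trans h)
  map_res h' hW := q.map_res h' (hW.trans h)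
  parity W hW := q.parity W (hW.trans h)
  ker W hW := q.ker W (hW.trans h)
  surj W hW := q.surj W (hW.trans h)

theorem exists_local_straightening {Fhat : f.GeneratorSystem f.kernelIdeal}
    (hFhat : Fhat.maxSplittingDegree = ⊤) {k : ℕ} (hk : 2 ≤ k) (p : f.GeneratedIdeals k)
    (x : X.carrier) : ∃ (U : Opens X.carrier) (α : X.Aut U), x ∈ U ∧ α ∈ X.Green k U ∧
      f.Straightens α p.1.1 ∧ CarriesGenerators α p.1.2 Fhat := by
  by_cases hx : x ∈ Set.range f.i
  · obtain ⟨y, rfl⟩ := hx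
    obtain ⟨U₁, hU₁, ⟨q⟩⟩ := p.2.1.localIso (f.i y)
    obtain ⟨n, m, l, U₂, hU₂, ⟨M₂⟩⟩ := f.exists_localModel y
    let M := M₂.restrict (inf_le_right : U₁ ⊓ U₂ ≤ U₂)
    obtain ⟨α, hα, hz, hζ⟩ := M.exists_straightening hk p.1.2 p.2.2
    exact ⟨U₁ ⊓ U₂, α, ⟨hU₁, hU₂⟩, hα,
      M.straightens (q.restrict inf_le_left) (fun _ => p.1.2.mem _ _ _) (fun _ => p.1.2.mem _ _ _)
        hz hζ, M.carriesGenerators hFhat hz hζ⟩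
  · refine ⟨⟨(Set.range f.i)ᶜ, f.isClosed_range.isOpen_compl⟩, 1, hx, one_mem _, ?_, ?_⟩
    · exact fun W h s => iff_of_true (mem_kernelIdeal_of_disjoint h _)
        (p.2.1.mem_of_disjoint h s)
    · exact fun y hy => absurd ⟨y, rfl⟩ hy

end SuperEmbedding

theorem mainTheorem6 {Y : Supergeometry.{v}} {X : Supergeometry.{u}} (f : SuperEmbedding Y X)
    (Fhat : f.GeneratorSystem f.kernelIdeal) (hFhat : Fhat.maxSplittingDegree = ⊤) :
    ∃ Φ : ∀ k : ℕ, f.GeneratedIdeals k → CechH1 (f.greenSheaf k), ∀ k : ℕ, 2 ≤ k →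
      -- base points go to base points
      (∃ h, Φ k ⟨⟨f.kernelIdeal, Fhat⟩, h⟩ = CechH1.base (f.greenSheaf k)) ∧
      -- compatibility with the inclusions from level `k + 1` to level `k`
      (∀ p : f.GeneratedIdeals (k + 1),
        Φ k (SuperEmbedding.GeneratedIdeals.incl f k p) =
          CechH1.map (f.greenIncl k) (Φ (k + 1) p)) ∧
      -- description of the map
      ∀ p : f.GeneratedIdeals k,
        (∃ (𝔘 : SpaceCover X.carrier) (α : ∀ i, X.Aut (𝔘.U i)), ∀ i,
          α i ∈ X.Green k (𝔘.U i) ∧ f.Straightens (α i) p.1.1 ∧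
            SuperEmbedding.CarriesGenerators (α i) p.1.2 Fhat) ∧
        ∀ (𝔘 : SpaceCover X.carrier) (α : ∀ i, X.Aut (𝔘.U i)),
          (∀ i, α i ∈ X.Green k (𝔘.U i) ∧ f.Straightens (α i) p.1.1) →
          ∃ γ : CategoryTheory.PresheafOfGroups.OneCocycle (f.greenSheaf k) 𝔘.U,
            (∀ (i j : 𝔘.ι) (T : TopologicalSpace.Opens X.carrier)
              (a : T ⟶ 𝔘.U i) (b : T ⟶ 𝔘.U j),
              f.greenToAut (γ.ev i j a b) =
                X.autRes a.le (α i) * (X.autRes b.le (α j))⁻¹) ∧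
            Φ k p = CechH1.mk (f.greenSheaf k) 𝔘 γ := by
  exact f.exists_obstructionMap Fhat hFhat f.isEmbeddingIdeal_kernelIdeal
    fun _ hk p x => SuperEmbedding.exists_local_straightening hFhat hk p x
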